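/- Let $h,\lambda,x\in\mathbb R$ with $\lambda\neq 0$, put $\varepsilon_x(k)=\sqrt{1+x^2+2x\cos k}$, and let $\nu$ be a measurable excitation density with $0\le \nu(k)\le \frac1{4\pi}$ for $0<k<\pi$ and $\nu(k)\neq\frac1{4\pi}$ for almost every $k$. Put $$\mathcal E(\nu)=-\frac1\pi\int_0^\pi \varepsilon_x(k)\,(1-4\pi\nu(k))\,dk-\frac{(x-h)^2}{4\lambda},$$ regarded as a function of $x$, and assume that $x$ solves the mean-field equation $x+\frac{2\lambda}{\pi}\int_0^\pi\partial_x\varepsilon_x(k)(1-4\pi\nu(k))\,dk=h$. Assume moreover that $x$ is not a degenerate critical point: if $\partial_x^2\mathcal E(\nu)$ exists at $x$, it is non-zero. A mode is a pair $P=(k,s)$, $k\in(0,\pi)$, $s\in\{+,-\}$; modes carry the measure $$\int F\,d\mu_\nu=\int_0^\pi\big[(1-2\pi\nu(k))F(k,+)+2\pi\nu(k)F(k,-)\big]dk ,$$ so that $\nu$ is the density of momenta on the branch $-$. For a mode let $$\phi(k,\pm)=\frac{x+\cos k}{\sin k}\pm\sqrt{\Big(\frac{x+\cos k}{\sin k}\Big)^2+1},\qquad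 \rho_*=\frac1{2\pi}\frac{\phi^2}{1+\phi^2},$$ $$d(k,s)=\sin k\,\big(\phi+\tfrac1\phi\big),\qquad w(k,s)=\frac{\sin k}{\phi+\frac1\phi}.$$ The second-order kernel is sought among the complex kernels $$f_2\big((k,s),(q,t)\big)=m_{st}(k)\,\delta(k-q)+r\big((k,s),(q,t)\big)$$ with $m,r$ measurable and symmetric under exchange of the two arguments, and $\iint |r(P,Q)|^2|w(P)||w(Q)|\,d\mu_\nu\,d\mu_\nu<\infty$. The Riccati equation is $$16\lambda+f_2(P,Q)\big(d(P)+d(Q)\big)-\frac1\pi\int f_2(P,R)\,w(R)\,f_2(R,Q)\,d\mu_\nu(R)=0,$$ understood as equality of the coefficients of $\delta(k-q)$ and of the regular parts, almost everywhere. The Hessian kernel is $$\mathcal H(P,Q)=\frac{\delta(P,Q)}{\rho_*(P)(1-2\pi\rho_*(P))}-2\,\mathrm{Re} f_2(P,Q),$$ where $\delta(P,Q)$ is the identity kernel for $\mu_\nu$. It is called positive definite if $\iint u\,\mathcal H\,u\,d\mu_\nu d\mu_\nu>0$ for every real measurable $u$ on modes, not $\mu_\nu$-a.e. zero, with $\int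 u^2/|w|\,d\mu_\nu<\infty$ and with the $\delta(k-q)$ part of the form (summed over branches at each $k$) integrable over $k$. Then the Riccati equation has a solution $f_2$ for which $\mathcal H$ is positive definite if and only if either $\lambda\ge 0$ and $x$ is a local maximum of $\mathcal E(\nu)$, or $\lambda<0$ and $x$ is a local minimum of $\mathcal E(\nu)$. Moreover, if $x\ne0$ or $\nu=0$ almost everywhere, such a solution is unique (up to almost everywhere equality) whenever it exists. -/

import Mathlib

open MeasureTheory

noncomputable section

namespace RiccatiHessian

/-- The mean-field dispersion `ε_x(k) = √(1 + x² + 2 x cos k)`. -/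
def eps (x k : ℝ) : ℝ := Real.sqrt (1 + x ^ 2 + 2 * x * Real.cos k)

/-- The energy density `𝓔(ν)`, as a function of the effective field `x`. -/
def energy (ν : ℝ → ℝ) (h lam : ℝ) (x : ℝ) : ℝ :=
  -(1 / Real.pi) * (∫ k in (0 : ℝ)..Real.pi, eps x k * (1 - 4 * Real.pi * ν k))
    - (x - h) ^ 2 / (4 * lam)

/-- The self-consistency equation for the effective field `x`. -/
def MeanField (ν : ℝ → ℝ) (h lam x : ℝ) : Prop :=
  x + 2 * lam / Real.pi *
    (∫ k in (0 : ℝ)..Real.pi, deriv (fun y => eps y k) x * (1 - 4 * Real.pi * ν k)) = h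

/-- A mode: a momentum `k ∈ (0, π)` together with the branch (`true` is `+`, `false` is `-`)
chosen at that momentum in the quadratic equation for `φ_{ρ_*}`. In the thermodynamic limit both
branches occur in any neighbourhood of `k`, in proportions fixed by the excitation density. -/
abbrev Mode : Type := ℝ × Bool

/-- The sign of a branch. -/
def branchSign (s : Bool) : ℝ := if s then 1 else -1

/-- The fraction of the momenta near `k` that are on branch `s`. As momenta have density `1/(2π)`
and those on the branch `-` have density `ν(k)`, it is `2πν(k)` for `-`, `1 - 2πν(k)` for `+`. -/
def frac (ν : ℝ → ℝ) (k : ℝ) (s : Bool) : ℝ :=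
  if s then 1 - 2 * Real.pi * ν k else 2 * Real.pi * ν k

/-- Lebesgue measure on the momenta `(0, π)`. -/
def momentum : Measure ℝ := volume.restrict (Set.Ioo 0 Real.pi)

/-- The measure on modes: an integral `∫₀^π F(p, branch at p) dp` over momenta becomes, in the
thermodynamic limit, `∫₀^π [(1 - 2πν(p)) F(p, +) + 2πν(p) F(p, -)] dp`. -/
def modes (ν : ℝ → ℝ) : Measure Mode :=
  (momentum.prod Measure.count).withDensity (fun P => ENNReal.ofReal (frac ν P.1 P.2))

/-- The amplitude `φ_{ρ_*}` at the dominant density, at a given mode. -/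
def phi (x : ℝ) (P : Mode) : ℝ :=
  (x + Real.cos P.1) / Real.sin P.1
    + branchSign P.2 * Real.sqrt (((x + Real.cos P.1) / Real.sin P.1) ^ 2 + 1)

/-- The dominant density `ρ_*`, at a given mode. -/
def rhoStar (x : ℝ) (P : Mode) : ℝ :=
  1 / (2 * Real.pi) * (phi x P ^ 2 / (1 + phi x P ^ 2))

/-- `sin p (φ_{ρ_*}(p) + 1/φ_{ρ_*}(p))`. -/
def lin (x : ℝ) (P : Mode) : ℝ := Real.sin P.1 * (phi x P + 1 / phi x P)

/-- The weight `sin p / (φ_{ρ_*}(p) + 1/φ_{ρ_*}(p))` (it has the sign of the branch). -/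
def wt (x : ℝ) (P : Mode) : ℝ := Real.sin P.1 / (phi x P + 1 / phi x P)

/-- A complex integral kernel on modes with a Dirac part on equal momenta, that is
`f((k,s),(q,t)) = dia k s t · δ(k - q) + reg (k,s) (q,t)`. -/
structure DKernel where
  /-- The coefficient of `δ(k - q)`. -/
  dia : ℝ → Bool → Bool → ℂ
  /-- The regular part. -/
  reg : Mode → Mode → ℂ

namespace DKernel

/-- Almost everywhere equality of kernels; branches that are absent at a momentum are ignored. -/
def AEEq (ν : ℝ → ℝ) (f g : DKernel) : Prop :=
  (∀ᵐ k ∂momentum, ∀ s t, frac ν k s ≠ 0 → frac ν k t ≠ 0 → f.dia k s t = g.dia k s t) ∧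
  (∀ᵐ z ∂(modes ν).prod (modes ν), f.reg z.1 z.2 = g.reg z.1 z.2)

/-- The class of kernels in which `f₂` is sought: measurable, symmetric in the two arguments, and
with a regular part that is square integrable for the weight occurring in the Riccati equation
(so that the integral in that equation converges). -/
structure Admissible (ν : ℝ → ℝ) (x : ℝ) (f : DKernel) : Prop where
  measurable_dia : ∀ s t, Measurable (fun k => f.dia k s t)
  measurable_reg : Measurable (fun z : Mode × Mode => f.reg z.1 z.2)
  symm_dia : ∀ k s t, f.dia k s t = f.dia k t s
  symm_reg : ∀ P Q, f.reg P Q = f.reg Q P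
  sq_integrable : Integrable
    (fun z : Mode × Mode => ‖f.reg z.1 z.2‖ ^ 2 * |wt x z.1| * |wt x z.2|)
    ((modes ν).prod (modes ν))

/-- The composition `∫ f(P, R) w(R) g(R, Q) dR` over all modes `R`, where `w = wt x`, expanded by
`∫ A(r) δ(k - r) dr = A(k)` into its Dirac part and its regular part. -/
def comp (ν : ℝ → ℝ) (x : ℝ) (f g : DKernel) : DKernel where
  dia k s t := ∑ r : Bool, f.dia k s r * ((frac ν k r * wt x (k, r) : ℝ) : ℂ) * g.dia k r t
  reg P Q :=
    (∑ r : Bool, f.dia P.1 P.2 r * ((frac ν P.1 r * wt x (P.1, r) : ℝ) : ℂ) * g.reg (P.1, r) Q)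
    + (∑ r : Bool, f.reg P (Q.1, r) * ((frac ν Q.1 r * wt x (Q.1, r) : ℝ) : ℂ) * g.dia Q.1 r Q.2)
    + ∫ R, f.reg P R * ((wt x R : ℝ) : ℂ) * g.reg R Q ∂(modes ν)

/-- The left-hand side of the Riccati equation,
`16λ + f(P,Q) (sin k (φ(P) + 1/φ(P)) + sin q (φ(Q) + 1/φ(Q)))
  - (1/π) ∫ f(P,R) sin r / (φ(R) + 1/φ(R)) f(R,Q) dR`. -/
def riccati (ν : ℝ → ℝ) (lam x : ℝ) (f : DKernel) : DKernel where
  dia k s t := f.dia k s t * ((lin x (k, s) + lin x (k, t) : ℝ) : ℂ)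
    - ((1 / Real.pi : ℝ) : ℂ) * (comp ν x f f).dia k s t
  reg P Q := ((16 * lam : ℝ) : ℂ) + f.reg P Q * ((lin x P + lin x Q : ℝ) : ℂ)
    - ((1 / Real.pi : ℝ) : ℂ) * (comp ν x f f).reg P Q

/-- `f₂` solves the Riccati equation. -/
def IsSolution (ν : ℝ → ℝ) (lam x : ℝ) (f : DKernel) : Prop :=
  f.Admissible ν x ∧ AEEq ν (riccati ν lam x f) ⟨fun _ _ _ => 0, fun _ _ => 0⟩

/-- The contribution of momentum `k` to the Dirac part of the quadratic form, at the real function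
`u` on modes, of the Hessian kernel `𝓗 = δ / (ρ_* (1 - 2πρ_*)) - 2 Re f₂`. -/
def hessianDia (ν : ℝ → ℝ) (x : ℝ) (f : DKernel) (u : Mode → ℝ) (k : ℝ) : ℝ :=
  (∑ s : Bool, frac ν k s * u (k, s) ^ 2 /
      (rhoStar x (k, s) * (1 - 2 * Real.pi * rhoStar x (k, s))))
  - 2 * ∑ s : Bool, ∑ t : Bool,
      frac ν k s * frac ν k t * (f.dia k s t).re * u (k, s) * u (k, t)

/-- The quadratic form `∬ u(P) 𝓗(P,Q) u(Q) dP dQ` of the Hessian kernel. -/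
def hessianForm (ν : ℝ → ℝ) (x : ℝ) (f : DKernel) (u : Mode → ℝ) : ℝ :=
  (∫ k, hessianDia ν x f u k ∂momentum)
  - 2 * ∫ z : Mode × Mode, u z.1 * (f.reg z.1 z.2).re * u z.2 ∂(modes ν).prod (modes ν)

/-- `𝓗` is positive definite: its quadratic form is positive on every real function of modes that
is not almost everywhere zero and on which the form converges. For the regular part of an
admissible kernel, convergence is ensured by the integrability of `u² / |wt|`. -/
def HessianPosDef (ν : ℝ → ℝ) (x : ℝ) (f : DKernel) : Prop :=
  ∀ u : Mode → ℝ, Measurable u →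
    Integrable (fun P => u P ^ 2 / |wt x P|) (modes ν) →
    Integrable (fun k => hessianDia ν x f u k) momentum →
    ¬ (u =ᵐ[modes ν] 0) →
    0 < hessianForm ν x f u

end DKernel

end RiccatiHessian

end

noncomputable section

namespace RiccatiHessian

open Set Filter Topology

/-! Multiply the Riccati equation by `π`. On branch `s = ±1` the linear coefficient becomes `s·ω`
with `ω = 2πε` (`freq`), the weight is `s·absWt`, and the inhomogeneity is `g = 16πλ`. Let `V = amp
= √(frac·absWt)` be the vector of branch amplitudes and `J` the diagonal matrix of signs. Absorb the
amplitudes into the kernel: `R` is the regular part, and `L = Jω - (Dirac part)·J`. The equation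
then says that `L² = ω²` at each momentum and that `T = L - RJ` satisfies `T² = ω² + g V Vᵀ J`. So a
solution is a square root of a rank one perturbation of a multiplication operator. With `u = wt·α`
and `ψ = amp·α`, the Hessian form is `2⟨ψ, Re(JT) ψ⟩`. As `Vᵀ J V = gapWt`, the perturbation
determinant is `D(t) = 1 + g ∫ gapWt/(ω² + t²)`. Its value at `t = 0`, when finite, is `-2λ ∂ₓ²𝓔`,
which ties the operator problem to the energy.

Existence. If `D` is bounded below by a positive constant, the integral formula for a square root
and the resolvent of a rank one perturbation give an explicit kernel, `rootKernel`;
`rootKernel_riccati` verifies its equation by a principal value computation. The Dirac part `solDia`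
makes `V` an eigenvector of `L` with eigenvalue `+ω`. The Hessian is positive because `rootKernel`
is a positive semidefinite kernel when `g ≥ 0`, and by a Schur test with relative bound `-g ∫
gapWt/ω² < 1` when `g < 0`.

Necessity. For `λ > 0` the energy is concave and every mean-field solution is a maximum, so nothing
is to be shown. For `λ < 0` and an unstable point, continuity of the determinant gives `τ > 0` for
which `T²` has eigenvalue `-τ` with eigenvector `Ψ = (ω² + τ)⁻¹V`. Since `T` commutes with `T²`,
`commutator_of_riccati` shows that `R` commutes with `ω²` up to rank two, and then that `TΨ` is a
multiple `-cΨ` with `c² = -τ`. So `c` is imaginary, the real form vanishes at the real vector `Ψ`,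
and the Hessian is not positive definite (`IsSolution.not_hessianPosDef`). Nondegeneracy removes the
marginal case `D(0) = 0`, and Fatou's lemma handles an infinite second variation.

Uniqueness. If `x ≠ 0` then `ω²` is injective, and the commutator relation forces the regular part
to depend on the branches only through `amp` (`IsSolution.branchFree`); if `ν = 0` there is only one
branch. The local part is then fixed by its square, its eigenvector `amp` and the signs of its
diagonal (`local_part_unique`). The regular part reduces to a scalar Riccati equation; the
difference of two of its solutions satisfies a homogeneous Sylvester equation, which positivity
makes trivial (`scalar_riccati_unique`). -/

/-- The modulus `sin² k / (2 ε_x(k))` of the weight `wt`. -/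
def absWt (x k : ℝ) : ℝ := Real.sin k ^ 2 / (2 * eps x k)

/-- The frequency `2π ε_x(k)`. -/
def freq (x k : ℝ) : ℝ := 2 * Real.pi * eps x k

/-- The difference `1 - 4πν(k)` of the two branch fractions. -/
def gap (ν : ℝ → ℝ) (k : ℝ) : ℝ := 1 - 4 * Real.pi * ν k

lemma branchSign_sq (s : Bool) : branchSign s ^ 2 = 1 := by cases s <;> simp [branchSign]

@[simp] lemma branchSign_true : branchSign true = 1 := rfl
@[simp] lemma branchSign_false : branchSign false = -1 := by simp [branchSign]

lemma abs_branchSign (s : Bool) : |branchSign s| = 1 := by cases s <;> simp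

/-! ### The mode weights in terms of the dispersion. -/

section Dispersion

variable {x k : ℝ}

/-- Geometrically `ε_x(k) = |x + e^{ik}|`. Hence `ε ≥ sin k > 0` on `(0, π)`, although `ε` may
vanish at an endpoint when `|x| = 1`. -/
lemma eps_sq_eq (x k : ℝ) : eps x k ^ 2 = (x + Real.cos k) ^ 2 + Real.sin k ^ 2 := by
  have e : 1 + x ^ 2 + 2 * x * Real.cos k = (x + Real.cos k) ^ 2 + Real.sin k ^ 2 := by
    nlinarith [Real.sin_sq_add_cos_sq k]
  rw [eps, Real.sq_sqrt (by rw [e]; positivity), e]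

lemma eps_nonneg (x k : ℝ) : 0 ≤ eps x k := Real.sqrt_nonneg _

lemma sin_le_eps (x k : ℝ) : Real.sin k ≤ eps x k :=
  abs_le_of_sq_le_sq' (by rw [eps_sq_eq]; nlinarith [sq_nonneg (x + Real.cos k)])
    (eps_nonneg x k) |>.2

lemma sin_pos_of_mem (hk : k ∈ Ioo 0 Real.pi) : 0 < Real.sin k := Real.sin_pos_of_mem_Ioo hk

lemma eps_pos (hk : k ∈ Ioo 0 Real.pi) : 0 < eps x k :=
  (sin_pos_of_mem hk).trans_le (sin_le_eps x k)

lemma freq_pos (hk : k ∈ Ioo 0 Real.pi) : 0 < freq x k := by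
  have := eps_pos (x := x) hk
  have := Real.pi_pos
  unfold freq; positivity

lemma freq_nonneg (x k : ℝ) : 0 ≤ freq x k := by
  have := eps_nonneg x k
  have := Real.pi_pos
  unfold freq; positivity

lemma absWt_pos (hk : k ∈ Ioo 0 Real.pi) : 0 < absWt x k := by
  have := eps_pos (x := x) hk
  have := sin_pos_of_mem hk
  unfold absWt; positivity

lemma absWt_nonneg (x k : ℝ) : 0 ≤ absWt x k := by
  have := eps_nonneg x k
  unfold absWt; positivity

lemma eps_le (x k : ℝ) : eps x k ≤ 1 + |x| := by
  refine Real.sqrt_le_iff.mpr ⟨by positivity, ?_⟩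
  have h1 : x * Real.cos k ≤ |x| := by
    refine (le_abs_self _).trans ?_
    rw [abs_mul]
    exact mul_le_of_le_one_right (abs_nonneg x) (Real.abs_cos_le_one k)
  nlinarith [sq_abs x]

lemma absWt_le_freq (hk : k ∈ Ioo 0 Real.pi) : absWt x k ≤ freq x k := by
  have h1 := eps_pos (x := x) hk
  have h2 := sin_le_eps x k
  have h3 := sin_pos_of_mem hk
  have := Real.pi_gt_three
  rw [absWt, freq, div_le_iff₀ (by positivity)]
  nlinarith [mul_pos h1 h1]

lemma absWt_le_one (hk : k ∈ Ioo 0 Real.pi) : absWt x k ≤ 1 := by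
  have h1 := eps_pos (x := x) hk
  have h2 := sin_le_eps x k
  have h3 := sin_pos_of_mem hk
  have := Real.sin_le_one k
  rw [absWt, div_le_iff₀ (by positivity)]
  nlinarith [mul_pos h1 h1]

lemma continuous_eps (x : ℝ) : Continuous (eps x) := by unfold eps; fun_prop

lemma measurable_absWt (x : ℝ) : Measurable (absWt x) :=
  (by fun_prop : Measurable fun k => Real.sin k ^ 2).div
    ((continuous_eps x).measurable.const_mul 2)

lemma measurable_freq (x : ℝ) : Measurable (freq x) :=
  (continuous_eps x).measurable.const_mul _

/-- The two branches are the roots of `φ² - 2aφ - 1`, whose product is `-1`. So `1/φ` is minus the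
other root, and `φ + 1/φ` is a difference of roots. -/
lemma phi_aux (hk : k ∈ Ioo 0 Real.pi) (s : Bool) :
    phi x (k, s) ≠ 0 ∧ phi x (k, s) + 1 / phi x (k, s) =
      branchSign s * (2 * (eps x k / Real.sin k)) := by
  have hs := sin_pos_of_mem hk
  set a := (x + Real.cos k) / Real.sin k with ha
  have hr : Real.sqrt (a ^ 2 + 1) = eps x k / Real.sin k := by
    rw [Real.sqrt_eq_iff_mul_self_eq (by positivity) (div_nonneg (eps_nonneg x k) hs.le)]
    have := eps_sq_eq x k
    rw [ha]
    field_simp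
    linarith
  have h1 : phi x (k, s) * (branchSign s * Real.sqrt (a ^ 2 + 1) - a) = 1 := by
    have h2 := Real.sq_sqrt (by positivity : 0 ≤ a ^ 2 + 1)
    have h3 := branchSign_sq s
    simp only [phi, ← ha]
    calc _ = branchSign s ^ 2 * Real.sqrt (a ^ 2 + 1) ^ 2 - a ^ 2 := by ring
      _ = 1 := by rw [h2, h3]; ring
  have h0 : phi x (k, s) ≠ 0 := left_ne_zero_of_mul_eq_one h1
  refine ⟨h0, ?_⟩
  rw [one_div, inv_eq_of_mul_eq_one_right h1, ← hr]
  simp only [phi, ← ha]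
  ring

lemma lin_eq (hk : k ∈ Ioo 0 Real.pi) (s : Bool) :
    lin x (k, s) = branchSign s * (2 * eps x k) := by
  have hs := sin_pos_of_mem hk
  rw [lin, (phi_aux hk s).2]
  simp only
  field_simp

lemma wt_eq (hk : k ∈ Ioo 0 Real.pi) (s : Bool) :
    wt x (k, s) = branchSign s * absWt x k := by
  have hs := sin_pos_of_mem hk
  have he := eps_pos (x := x) hk
  rw [wt, (phi_aux hk s).2, absWt]
  simp only
  cases s <;> simp <;> field_simp

/-- The left side is `1/(2π(φ + 1/φ)²)`, which does not see the branch. The identity part of the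
Hessian is thus multiplication by `2·freq/absWt`. -/
lemma rhoStar_mul (hk : k ∈ Ioo 0 Real.pi) (s : Bool) :
    rhoStar x (k, s) * (1 - 2 * Real.pi * rhoStar x (k, s)) = absWt x k / (2 * freq x k) := by
  obtain ⟨h0, h1⟩ := phi_aux (x := x) hk s
  have hs := sin_pos_of_mem hk
  have he := eps_pos (x := x) hk
  have hpi := Real.pi_pos
  have h2 : 0 < 1 + phi x (k, s) ^ 2 := by positivity
  have h3 : (1 + phi x (k, s) ^ 2) ^ 2 = phi x (k, s) ^ 2 * (2 * (eps x k / Real.sin k)) ^ 2 := by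
    have h4 : 1 + phi x (k, s) ^ 2 = phi x (k, s) * (phi x (k, s) + 1 / phi x (k, s)) := by
      field_simp
      ring
    rw [h4, h1, mul_pow, mul_pow (branchSign s), branchSign_sq, one_mul]
  have h5 : rhoStar x (k, s) * (1 - 2 * Real.pi * rhoStar x (k, s)) =
      1 / (2 * Real.pi) * (phi x (k, s) ^ 2 / (1 + phi x (k, s) ^ 2) ^ 2) := by
    rw [rhoStar]
    field_simp
    ring
  rw [h5, h3, absWt, freq]
  field_simp

end Dispersion

/-! ### Reduction of integrals over modes to the two branches. -/

section Measures

instance : IsFiniteMeasure momentum := by unfold momentum; infer_instance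

instance : NullSingletonClass momentum := by unfold momentum; infer_instance

lemma ae_mem_momentum : ∀ᵐ k ∂momentum, k ∈ Ioo 0 Real.pi := ae_restrict_mem measurableSet_Ioo

variable {ν : ℝ → ℝ}

lemma measurable_frac (hν : Measurable ν) (s : Bool) : Measurable (fun k => frac ν k s) := by
  cases s
  · simpa [frac] using hν.const_mul (2 * Real.pi)
  · simpa [frac] using (hν.const_mul (2 * Real.pi)).const_sub 1

lemma measurable_gap (hν : Measurable ν) : Measurable (gap ν) := by
  unfold gap; fun_prop

lemma frac_sum (k : ℝ) : frac ν k true + frac ν k false = 1 := by simp [frac]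

lemma frac_sub (k : ℝ) : frac ν k true - frac ν k false = gap ν k := by
  simp [frac, gap]; ring

/-- The excitation density satisfies `0 ≤ ν ≤ 1/(4π)` on `(0, π)`. -/
def BoundedDensity (ν : ℝ → ℝ) : Prop :=
  ∀ k ∈ Ioo (0 : ℝ) Real.pi, 0 ≤ ν k ∧ ν k ≤ 1 / (4 * Real.pi)

lemma frac_nonneg (hb : BoundedDensity ν) {k : ℝ} (hk : k ∈ Ioo 0 Real.pi) (s : Bool) :
    0 ≤ frac ν k s := by
  obtain ⟨h1, h2⟩ := hb k hk
  have hpi := Real.pi_pos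
  rw [le_div_iff₀ (by positivity)] at h2
  cases s <;> simp [frac]
  · positivity
  · nlinarith

lemma frac_le_one (hb : BoundedDensity ν) {k : ℝ} (hk : k ∈ Ioo 0 Real.pi) (s : Bool) :
    frac ν k s ≤ 1 := by
  have h1 := frac_nonneg hb hk (!s)
  have h2 := frac_sum (ν := ν) k
  cases s <;> simp at h1 <;> linarith

lemma half_le_frac_true (hb : BoundedDensity ν) {k : ℝ} (hk : k ∈ Ioo 0 Real.pi) :
    1 / 2 ≤ frac ν k true := by
  obtain ⟨h1, h2⟩ := hb k hk
  have hpi := Real.pi_pos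
  rw [le_div_iff₀ (by positivity)] at h2
  simp [frac]
  linarith

lemma gap_nonneg (hb : BoundedDensity ν) {k : ℝ} (hk : k ∈ Ioo 0 Real.pi) : 0 ≤ gap ν k := by
  obtain ⟨h1, h2⟩ := hb k hk
  have hpi := Real.pi_pos
  rw [le_div_iff₀ (by positivity)] at h2
  simp only [gap]
  linarith

lemma gap_le_one (hb : BoundedDensity ν) {k : ℝ} (hk : k ∈ Ioo 0 Real.pi) : gap ν k ≤ 1 := by
  obtain ⟨h1, h2⟩ := hb k hk
  have hpi := Real.pi_pos
  simp only [gap]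
  nlinarith

lemma ae_gap_pos (hb : BoundedDensity ν) (hs : ∀ᵐ k ∂momentum, ν k ≠ 1 / (4 * Real.pi)) :
    ∀ᵐ k ∂momentum, 0 < gap ν k := by
  filter_upwards [hs, ae_mem_momentum] with k h1 hk
  refine lt_of_le_of_ne (gap_nonneg hb hk) fun h => h1 ?_
  have hpi := Real.pi_pos
  simp only [gap] at h
  rw [eq_div_iff (by positivity)]
  linarith

/-- The distribution of momenta on one branch. -/
def branchMeasure (ν : ℝ → ℝ) (s : Bool) : Measure ℝ :=
  momentum.withDensity fun k => ENNReal.ofReal (frac ν k s)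

lemma measurable_ofReal_frac (hν : Measurable ν) (s : Bool) :
    Measurable fun k => ENNReal.ofReal (frac ν k s) := (measurable_frac hν s).ennreal_ofReal

instance (s : Bool) : SFinite (branchMeasure ν s) := by unfold branchMeasure; infer_instance

lemma measurableEmbedding_mode (s : Bool) : MeasurableEmbedding (fun k : ℝ => (k, s)) :=
  measurableEmbedding_prod_mk_right s

/-- A finite sum of embedded copies of weighted momentum measures: null sets, integrability and
integrals on modes can then be read off branch by branch, with `frac` as density. -/
lemma modes_eq_sum (hν : Measurable ν) :
    modes ν = ∑ s : Bool, (branchMeasure ν s).map fun k => (k, s) := by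
  have hm : Measurable fun P : Mode => ENNReal.ofReal (frac ν P.1 P.2) :=
    measurable_from_prod_countable_left fun s => measurable_ofReal_frac hν s
  ext S hS
  rw [modes, withDensity_apply _ hS, ← lintegral_indicator hS,
    lintegral_prod _ (hm.indicator hS).aemeasurable, Measure.finsetSum_apply, Fintype.sum_bool]
  have h1 : ∀ s : Bool, (branchMeasure ν s).map (fun k => (k, s)) S =
      ∫⁻ k, S.indicator (fun P : Mode => ENNReal.ofReal (frac ν P.1 P.2)) (k, s) ∂momentum := by
    intro s
    have hS' : MeasurableSet ((fun k => (k, s)) ⁻¹' S) := (by fun_prop : Measurable _) hS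
    rw [Measure.map_apply (by fun_prop) hS, branchMeasure, withDensity_apply _ hS',
      ← lintegral_indicator hS']
    rfl
  have h2 : ∀ s : Bool, Measurable fun k =>
      S.indicator (fun P : Mode => ENNReal.ofReal (frac ν P.1 P.2)) (k, s) := fun s =>
    (hm.indicator hS).comp (by fun_prop)
  rw [h1, h1, ← lintegral_add_left (h2 true)]
  refine lintegral_congr fun k => ?_
  rw [lintegral_count, tsum_fintype, Fintype.sum_bool]

lemma ae_ofReal_frac (hb : BoundedDensity ν) (s : Bool) :
    ∀ᵐ k ∂momentum, (ENNReal.ofReal (frac ν k s) ≠ 0 ↔ frac ν k s ≠ 0) ∧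
      (ENNReal.ofReal (frac ν k s)).toReal = frac ν k s := by
  filter_upwards [ae_mem_momentum] with k hk
  have h := frac_nonneg hb hk s
  refine ⟨?_, ENNReal.toReal_ofReal h⟩
  rw [Ne, Ne, ENNReal.ofReal_eq_zero, not_iff_not]
  exact ⟨fun h' => le_antisymm h' h, fun h' => h'.le⟩

lemma ae_modes_iff (hν : Measurable ν) (hb : BoundedDensity ν) {p : Mode → Prop} :
    (∀ᵐ P ∂modes ν, p P) ↔ ∀ s, ∀ᵐ k ∂momentum, frac ν k s ≠ 0 → p (k, s) := by
  simp only [modes_eq_sum hν, ae_finsetSum_measure_iff, Finset.mem_univ, true_imp_iff,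
    (measurableEmbedding_mode _).ae_map_iff, branchMeasure,
    ae_withDensity_iff (measurable_ofReal_frac hν _)]
  refine forall_congr' fun s => ?_
  refine eventually_congr ?_
  filter_upwards [ae_ofReal_frac hb s] with k hk
  rw [hk.1]

variable {F : Type*} [NormedAddCommGroup F] [NormedSpace ℝ F]

lemma integrable_modes_iff (hν : Measurable ν) (hb : BoundedDensity ν) {f : Mode → F} :
    Integrable f (modes ν) ↔ ∀ s, Integrable (fun k => frac ν k s • f (k, s)) momentum := by
  simp only [modes_eq_sum hν, integrable_finsetSum_measure, Finset.mem_univ, true_imp_iff,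
    (measurableEmbedding_mode _).integrable_map_iff, branchMeasure]
  refine forall_congr' fun s => ?_
  rw [integrable_withDensity_iff_integrable_smul' (measurable_ofReal_frac hν s)
    (Eventually.of_forall fun _ => ENNReal.ofReal_lt_top)]
  refine integrable_congr ?_
  filter_upwards [ae_ofReal_frac hb s] with k hk
  rw [hk.2]
  rfl

lemma integral_modes (hν : Measurable ν) (hb : BoundedDensity ν) {f : Mode → F}
    (hf : ∀ s, Integrable (fun k => frac ν k s • f (k, s)) momentum) :
    ∫ P, f P ∂modes ν = ∫ k, ∑ s, frac ν k s • f (k, s) ∂momentum := by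
  have hf' := (integrable_modes_iff hν hb).mpr hf
  rw [integral_finsetSum _ fun s _ => hf s]
  rw [modes_eq_sum hν, integrable_finsetSum_measure] at hf'
  rw [modes_eq_sum hν, integral_finsetSum_measure hf']
  refine Finset.sum_congr rfl fun s _ => ?_
  rw [(measurableEmbedding_mode s).integral_map, branchMeasure,
    integral_withDensity_eq_integral_toReal_smul (measurable_ofReal_frac hν s)
    (Eventually.of_forall fun _ => ENNReal.ofReal_lt_top)]
  refine integral_congr_ae ?_
  filter_upwards [ae_ofReal_frac hb s] with k hk
  rw [hk.2]

/-- A pair of modes from a pair of momenta and a pair of branches. -/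
def modePair (s t : Bool) (z : ℝ × ℝ) : Mode × Mode := ((z.1, s), (z.2, t))

lemma measurableEmbedding_modePair (s t : Bool) : MeasurableEmbedding (modePair s t) :=
  (measurableEmbedding_mode s).prodMap (measurableEmbedding_mode t)

lemma measurable_modePair (s t : Bool) : Measurable (modePair s t) :=
  (measurableEmbedding_modePair s t).measurable

/-- The joint density of a pair of branches. -/
def pairDensity (ν : ℝ → ℝ) (s t : Bool) (z : ℝ × ℝ) : ENNReal :=
  ENNReal.ofReal (frac ν z.1 s) * ENNReal.ofReal (frac ν z.2 t)

lemma measurable_pairDensity (hν : Measurable ν) (s t : Bool) :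
    Measurable (pairDensity ν s t) :=
  ((measurable_ofReal_frac hν s).comp measurable_fst).mul
    ((measurable_ofReal_frac hν t).comp measurable_snd)

lemma pairDensity_lt_top (s t : Bool) (z : ℝ × ℝ) : pairDensity ν s t z < ⊤ :=
  ENNReal.mul_lt_top ENNReal.ofReal_lt_top ENNReal.ofReal_lt_top

lemma ae_pairDensity (hb : BoundedDensity ν) (s t : Bool) :
    ∀ᵐ z ∂momentum.prod momentum,
      (pairDensity ν s t z ≠ 0 ↔ frac ν z.1 s ≠ 0 ∧ frac ν z.2 t ≠ 0) ∧
      (pairDensity ν s t z).toReal = frac ν z.1 s * frac ν z.2 t := by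
  filter_upwards [Measure.quasiMeasurePreserving_fst.ae (ae_ofReal_frac hb s),
    Measure.quasiMeasurePreserving_snd.ae (ae_ofReal_frac hb t)] with z h1 h2
  rw [pairDensity, ENNReal.toReal_mul, h1.2, h2.2, mul_ne_zero_iff, h1.1, h2.1]
  exact ⟨Iff.rfl, rfl⟩

lemma modes_prod_eq_sum (hν : Measurable ν) :
    (modes ν).prod (modes ν) = ∑ s : Bool, ∑ t : Bool,
      ((momentum.prod momentum).withDensity (pairDensity ν s t)).map (modePair s t) := by
  have h : ∀ s t : Bool, ((branchMeasure ν s).map fun k => (k, s)).prod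
      ((branchMeasure ν t).map fun k => (k, t)) =
      ((momentum.prod momentum).withDensity (pairDensity ν s t)).map (modePair s t) := by
    intro s t
    rw [Measure.map_prod_map _ _ (by fun_prop) (by fun_prop), branchMeasure, branchMeasure,
      prod_withDensity (measurable_ofReal_frac hν s) (measurable_ofReal_frac hν t)]
    rfl
  simp only [modes_eq_sum hν, Fintype.sum_bool]
  rw [Measure.add_prod, Measure.prod_add, Measure.prod_add, h, h, h, h]

lemma ae_modes_prod_iff (hν : Measurable ν) (hb : BoundedDensity ν) {p : Mode × Mode → Prop} :
    (∀ᵐ z ∂(modes ν).prod (modes ν), p z) ↔ ∀ s t, ∀ᵐ z ∂momentum.prod momentum,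
      frac ν z.1 s ≠ 0 → frac ν z.2 t ≠ 0 → p ((z.1, s), (z.2, t)) := by
  simp only [modes_prod_eq_sum hν, ae_finsetSum_measure_iff, Finset.mem_univ, true_imp_iff,
    (measurableEmbedding_modePair _ _).ae_map_iff,
    ae_withDensity_iff (measurable_pairDensity hν _ _)]
  refine forall_congr' fun s => forall_congr' fun t => ?_
  refine eventually_congr ?_
  filter_upwards [ae_pairDensity hb s t] with k hk
  rw [hk.1, and_imp]
  rfl

lemma integrable_modes_prod_iff (hν : Measurable ν) (hb : BoundedDensity ν)
    {f : Mode × Mode → F} :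
    Integrable f ((modes ν).prod (modes ν)) ↔ ∀ s t, Integrable (fun z : ℝ × ℝ =>
      (frac ν z.1 s * frac ν z.2 t) • f ((z.1, s), (z.2, t))) (momentum.prod momentum) := by
  simp only [modes_prod_eq_sum hν, integrable_finsetSum_measure, Finset.mem_univ, true_imp_iff,
    (measurableEmbedding_modePair _ _).integrable_map_iff]
  refine forall_congr' fun s => forall_congr' fun t => ?_
  rw [integrable_withDensity_iff_integrable_smul' (measurable_pairDensity hν s t)
    (Eventually.of_forall fun _ => pairDensity_lt_top s t _)]
  refine integrable_congr ?_
  filter_upwards [ae_pairDensity hb s t] with k hk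
  rw [hk.2]
  rfl

lemma integral_modes_prod (hν : Measurable ν) (hb : BoundedDensity ν) {f : Mode × Mode → F}
    (hf : ∀ s t, Integrable (fun z : ℝ × ℝ =>
      (frac ν z.1 s * frac ν z.2 t) • f ((z.1, s), (z.2, t))) (momentum.prod momentum)) :
    ∫ z, f z ∂(modes ν).prod (modes ν) = ∫ z, ∑ s, ∑ t,
      (frac ν z.1 s * frac ν z.2 t) • f ((z.1, s), (z.2, t)) ∂momentum.prod momentum := by
  have hf' := (integrable_modes_prod_iff hν hb).mpr hf
  rw [integral_finsetSum _ fun s _ => integrable_finsetSum _ fun t _ => hf s t]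
  rw [modes_prod_eq_sum hν, integrable_finsetSum_measure] at hf'
  rw [modes_prod_eq_sum hν, integral_finsetSum_measure hf']
  refine Finset.sum_congr rfl fun s _ => ?_
  have hf'' := hf' s (Finset.mem_univ s)
  rw [integrable_finsetSum_measure] at hf''
  rw [integral_finsetSum_measure hf'', integral_finsetSum _ fun t _ => hf s t]
  refine Finset.sum_congr rfl fun t _ => ?_
  rw [(measurableEmbedding_modePair s t).integral_map,
    integral_withDensity_eq_integral_toReal_smul (measurable_pairDensity hν s t)
    (Eventually.of_forall fun _ => pairDensity_lt_top s t _)]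
  refine integral_congr_ae ?_
  filter_upwards [ae_pairDensity hb s t] with k hk
  rw [hk.2]
  rfl

end Measures

/-! ### Lorentzian integrals and a symmetrised principal value identity. -/

/-- Lebesgue measure on the positive half-line. -/
def halfLine : Measure ℝ := volume.restrict (Ioi 0)

instance : SigmaFinite halfLine := by unfold halfLine; infer_instance

lemma ae_halfLine_pos : ∀ᵐ t ∂halfLine, 0 < t := ae_restrict_mem measurableSet_Ioi

lemma integrable_lorentz {b : ℝ} (hb : 0 < b) :
    Integrable (fun s : ℝ => 1 / (b ^ 2 + s ^ 2)) volume := by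
  have h := (integrable_inv_one_add_sq.comp_div hb.ne').const_mul (1 / b ^ 2)
  refine h.congr (Eventually.of_forall fun s => ?_)
  have : 0 < b ^ 2 + s ^ 2 := by positivity
  simp only
  field_simp

lemma integral_lorentz {b : ℝ} (hb : 0 < b) :
    ∫ s, 1 / (b ^ 2 + s ^ 2) ∂halfLine = Real.pi / (2 * b) := by
  have h1 : ∀ s ∈ Ici (0 : ℝ), HasDerivAt (fun s => Real.arctan (s / b) / b)
      (1 / (b ^ 2 + s ^ 2)) s := by
    intro s _
    have := (((hasDerivAt_id s).div_const b).arctan).div_const b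
    refine this.congr_deriv ?_
    have : 0 < b ^ 2 + s ^ 2 := by positivity
    simp only [id]
    field_simp
  have h2 : Tendsto (fun s => Real.arctan (s / b) / b) atTop (𝓝 (Real.pi / 2 / b)) :=
    ((tendsto_nhds_of_tendsto_nhdsWithin Real.tendsto_arctan_atTop).comp
      (tendsto_id.atTop_div_const hb)).div_const b
  have := integral_Ioi_of_hasDerivAt_of_tendsto' (a := 0) h1
    (integrable_lorentz hb).integrableOn h2
  rw [halfLine, this]
  simp
  field_simp

lemma integrable_lorentz_half {b : ℝ} (hb : 0 < b) :
    Integrable (fun s : ℝ => 1 / (b ^ 2 + s ^ 2)) halfLine :=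
  (integrable_lorentz hb).integrableOn

lemma sqkernel_le {a b t : ℝ} (ha : 0 < a) (hb : 0 < b) :
    t ^ 2 / ((a ^ 2 + t ^ 2) * (b ^ 2 + t ^ 2)) ≤ 1 / (a ^ 2 + t ^ 2) := by
  have : 0 < a ^ 2 + t ^ 2 := by positivity
  have : 0 < b ^ 2 + t ^ 2 := by positivity
  rw [div_le_div_iff₀ (by positivity) (by positivity)]
  nlinarith [mul_pos ‹0 < a ^ 2 + t ^ 2› (pow_pos hb 2)]

lemma integrable_sqkernel {a b : ℝ} (ha : 0 < a) (hb : 0 < b) :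
    Integrable (fun t : ℝ => t ^ 2 / ((a ^ 2 + t ^ 2) * (b ^ 2 + t ^ 2))) halfLine := by
  refine (integrable_lorentz_half ha).mono' (Measurable.aestronglyMeasurable (by fun_prop))
    (Eventually.of_forall fun t => ?_)
  rw [Real.norm_of_nonneg (by positivity)]
  exact sqkernel_le ha hb

lemma integral_sqkernel {a b : ℝ} (ha : 0 < a) (hb : 0 < b) :
    ∫ t, t ^ 2 / ((a ^ 2 + t ^ 2) * (b ^ 2 + t ^ 2)) ∂halfLine = Real.pi / (2 * (a + b)) := by
  -- Partial fractions degenerate at `a = b`, where an explicit antiderivative replaces them.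
  rcases eq_or_ne a b with rfl | hab
  · have h1 : ∀ s ∈ Ici (0 : ℝ), HasDerivAt
        (fun s => Real.arctan (s / a) / a / 2 - s / (2 * (a ^ 2 + s ^ 2)))
        (s ^ 2 / ((a ^ 2 + s ^ 2) * (a ^ 2 + s ^ 2))) s := by
      intro s _
      have hp : 0 < a ^ 2 + s ^ 2 := by positivity
      have := ((((hasDerivAt_id s).div_const a).arctan).div_const a).div_const 2
      have h3 : HasDerivAt (fun s : ℝ => 2 * (a ^ 2 + s ^ 2)) (2 * (2 * s)) s := by
        simpa using (((hasDerivAt_pow 2 s).const_add (a ^ 2)).const_mul 2)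
      refine (this.sub ((hasDerivAt_id s).div h3 (by positivity))).congr_deriv ?_
      simp only [id]
      field_simp
      ring
    have h2 : Tendsto (fun s => Real.arctan (s / a) / a / 2 - s / (2 * (a ^ 2 + s ^ 2))) atTop
        (𝓝 (Real.pi / 2 / a / 2 - 0)) := by
      refine ((((tendsto_nhds_of_tendsto_nhdsWithin Real.tendsto_arctan_atTop).comp
        (tendsto_id.atTop_div_const ha)).div_const a).div_const 2).sub ?_
      refine squeeze_zero' (g := fun s => s⁻¹) ?_ ?_ tendsto_inv_atTop_zero
      · filter_upwards [eventually_gt_atTop 0] with s hs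
        positivity
      · filter_upwards [eventually_gt_atTop 0] with s hs
        rw [inv_eq_one_div, div_le_div_iff₀ (by positivity) hs]
        nlinarith [sq_nonneg a]
    have := integral_Ioi_of_hasDerivAt_of_tendsto' (a := 0) h1
      (integrable_sqkernel ha ha) h2
    rw [halfLine, this]
    simp
    field_simp
    norm_num
  · have hab' : a ^ 2 - b ^ 2 ≠ 0 := by
      intro h
      have : (a - b) * (a + b) = 0 := by linarith
      rcases mul_eq_zero.mp this with h | h
      · exact hab (by linarith)
      · linarith
    have : ∀ t : ℝ, t ^ 2 / ((a ^ 2 + t ^ 2) * (b ^ 2 + t ^ 2))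
        = (a ^ 2 / (a ^ 2 - b ^ 2)) * (1 / (a ^ 2 + t ^ 2))
          - (b ^ 2 / (a ^ 2 - b ^ 2)) * (1 / (b ^ 2 + t ^ 2)) := by
      intro t
      have : 0 < a ^ 2 + t ^ 2 := by positivity
      have : 0 < b ^ 2 + t ^ 2 := by positivity
      field_simp
      ring
    simp_rw [this]
    rw [integral_sub ((integrable_lorentz_half ha).const_mul _)
      ((integrable_lorentz_half hb).const_mul _), integral_const_mul, integral_const_mul,
      integral_lorentz ha, integral_lorentz hb]
    have : a + b ≠ 0 := by positivity
    have : (a ^ 2 - b ^ 2) = (a - b) * (a + b) := by ring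
    have : a - b ≠ 0 := sub_ne_zero.mpr hab
    rw [‹a ^ 2 - b ^ 2 = _›]
    field_simp

/-- Pairs of positive numbers whose ratio is outside `(1/θ, θ)`. -/
def offDiag (θ : ℝ) : Set (ℝ × ℝ) := {z | θ * z.2 ≤ z.1 ∨ θ * z.1 ≤ z.2}

lemma measurableSet_offDiag (θ : ℝ) : MeasurableSet (offDiag θ) :=
  (measurableSet_le (f := fun z : ℝ × ℝ => θ * z.2) (g := Prod.fst) (by fun_prop)
    (by fun_prop)).union (measurableSet_le (f := fun z : ℝ × ℝ => θ * z.1) (g := Prod.snd)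
    (by fun_prop) (by fun_prop))

/-- The cutoff around `t` is multiplicative so that the two pieces cancel exactly, without a limit:
`log |(s - t)/(s + t)|` is invariant under `s ↦ t²/s`, which exchanges `t/θ` and `θt`, and it
vanishes at `0` and at infinity. -/
lemma integrableOn_pv {t θ : ℝ} (ht : 0 < t) (hθ : 1 < θ) :
    IntegrableOn (fun s : ℝ => 1 / (s ^ 2 - t ^ 2)) (Ioc 0 (t / θ)) ∧
    IntegrableOn (fun s : ℝ => 1 / (s ^ 2 - t ^ 2)) (Ioi (θ * t)) ∧
    (∫ s in Ioc 0 (t / θ), 1 / (s ^ 2 - t ^ 2)) + ∫ s in Ioi (θ * t), 1 / (s ^ 2 - t ^ 2) = 0 := by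
  have hθ0 : 0 < θ := by linarith
  have hle : 0 ≤ t / θ := by positivity
  have hlt : t / θ < t := div_lt_self ht hθ
  have hlt2 : t < θ * t := by nlinarith
  have hc : ContinuousOn (fun s : ℝ => 1 / (s ^ 2 - t ^ 2)) (Icc 0 (t / θ)) := by
    refine continuousOn_const.div (by fun_prop) fun s hs => ?_
    have : s < t := hs.2.trans_lt hlt
    nlinarith [hs.1]
  have hi1 : IntegrableOn (fun s : ℝ => 1 / (s ^ 2 - t ^ 2)) (Ioc 0 (t / θ)) :=
    (hc.integrableOn_compact isCompact_Icc).mono_set Ioc_subset_Icc_self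
  -- `Real.log` ignores the sign of its argument, so one antiderivative serves on both sides of `t`.
  have hd : ∀ s, 0 ≤ s → s ≠ t → HasDerivAt (fun s => (Real.log (s - t) - Real.log (s + t)) / (2 * t))
      (1 / (s ^ 2 - t ^ 2)) s := by
    intro s hs hst
    have h1 : s - t ≠ 0 := sub_ne_zero.mpr hst
    have h2 : s + t ≠ 0 := by positivity
    have := (((hasDerivAt_id s).sub_const t).log h1).sub
      (((hasDerivAt_id s).add_const t).log h2) |>.div_const (2 * t)
    refine this.congr_deriv ?_
    have : s ^ 2 - t ^ 2 = (s - t) * (s + t) := by ring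
    rw [this]
    simp only [id]
    field_simp
    ring
  have hlim : Tendsto (fun s => (Real.log (s - t) - Real.log (s + t)) / (2 * t)) atTop (𝓝 (0 / (2 * t))) := by
    refine Tendsto.div_const ?_ _
    have h1 : Tendsto (fun s : ℝ => Real.log (1 - 2 * t / (s + t))) atTop (𝓝 (Real.log (1 - 0))) := by
      refine Tendsto.log (tendsto_const_nhds.sub ?_) (by norm_num)
      exact tendsto_const_nhds.div_atTop (tendsto_id.atTop_add tendsto_const_nhds)
    rw [sub_zero, Real.log_one] at h1
    refine h1.congr' ?_
    filter_upwards [eventually_gt_atTop t] with s hs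
    rw [← Real.log_div (by linarith) (by linarith)]
    congr 1
    have : s + t ≠ 0 := by linarith
    field_simp
    ring
  have hi2 : IntegrableOn (fun s : ℝ => 1 / (s ^ 2 - t ^ 2)) (Ioi (θ * t)) := by
    refine integrableOn_Ioi_deriv_of_nonneg' (a := θ * t) (fun s hs => hd s ?_ ?_) ?_ hlim
    · exact le_trans (by positivity) hs
    · exact (hlt2.trans_le hs).ne'
    · intro s hs
      have : t < s := hlt2.trans hs
      have : 0 < s ^ 2 - t ^ 2 := by nlinarith
      positivity
  refine ⟨hi1, hi2, ?_⟩
  rw [integral_Ioi_of_hasDerivAt_of_tendsto' (fun s hs => hd s (le_trans (by positivity) hs)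
    (hlt2.trans_le hs).ne') hi2 hlim, ← intervalIntegral.integral_of_le hle,
    intervalIntegral.integral_eq_sub_of_hasDerivAt
      (f := fun s => (Real.log (s - t) - Real.log (s + t)) / (2 * t))]
  · have e1 : θ * t - t = t * (θ - 1) := by ring
    have e2 : θ * t + t = t * (θ + 1) := by ring
    have e3 : t / θ - t = -(t * (θ - 1) / θ) := by field_simp; ring
    have e4 : t / θ + t = t * (θ + 1) / θ := by field_simp; ring
    have e5 : θ - 1 ≠ 0 := by linarith
    rw [e1, e2, e3, e4, Real.log_neg_eq_log, zero_sub, zero_add, Real.log_neg_eq_log,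
      Real.log_div (by positivity) (by positivity), Real.log_div (by positivity) (by positivity)]
    ring
  · intro s hs
    rw [uIcc_of_le hle] at hs
    exact hd s hs.1 (hs.2.trans_lt hlt).ne
  · rw [intervalIntegrable_iff_integrableOn_Ioc_of_le hle]
    exact hi1

lemma pv_section_eq {t θ : ℝ} (hθ : 1 < θ) :
    (fun s => (Prod.mk t ⁻¹' offDiag θ).indicator (fun s => 1 / (s ^ 2 - t ^ 2)) s)
      =ᵐ[halfLine] (Ioc 0 (t / θ) ∪ Ioi (θ * t)).indicator (fun s => 1 / (s ^ 2 - t ^ 2)) := by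
  have : ∀ᵐ s ∂halfLine, s ≠ θ * t :=
    ae_restrict_of_ae (Measure.ae_ne volume (θ * t))
  filter_upwards [ae_halfLine_pos, this] with s hs hne
  have h0 : 0 < θ := by linarith
  have hiff : s ∈ Prod.mk t ⁻¹' offDiag θ ↔ s ∈ Ioc 0 (t / θ) ∪ Ioi (θ * t) := by
    simp only [offDiag, mem_preimage, mem_ofPred_eq, mem_union, mem_Ioc, mem_Ioi, hs, true_and]
    rw [le_div_iff₀ h0, mul_comm s θ, le_iff_lt_or_eq (a := θ * t)]
    constructor
    · rintro (h | h | h)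
      · exact Or.inl h
      · exact Or.inr h
      · exact absurd h.symm hne
    · rintro (h | h)
      · exact Or.inl h
      · exact Or.inr (Or.inl h)
  by_cases h : s ∈ Prod.mk t ⁻¹' offDiag θ
  · rw [indicator_of_mem h, indicator_of_mem (hiff.mp h)]
  · rw [indicator_of_notMem h, indicator_of_notMem (fun h' => h (hiff.mpr h'))]

lemma integral_pv {t θ : ℝ} (ht : 0 < t) (hθ : 1 < θ) :
    Integrable ((Prod.mk t ⁻¹' offDiag θ).indicator (fun s => 1 / (s ^ 2 - t ^ 2))) halfLine ∧
    ∫ s, (Prod.mk t ⁻¹' offDiag θ).indicator (fun s => 1 / (s ^ 2 - t ^ 2)) s ∂halfLine = 0 := by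
  obtain ⟨h1, h2, h3⟩ := integrableOn_pv ht hθ
  have h0 : 0 < θ := by linarith
  have hlt : t / θ < t := div_lt_self ht hθ
  have hlt2 : t < θ * t := by nlinarith
  have hsub : Ioc 0 (t / θ) ∪ Ioi (θ * t) ⊆ Ioi (0 : ℝ) := by
    rintro s (hs | hs)
    · exact hs.1
    · exact lt_trans (by positivity : (0 : ℝ) < θ * t) hs
  have hm : MeasurableSet (Ioc 0 (t / θ) ∪ Ioi (θ * t)) := measurableSet_Ioc.union measurableSet_Ioi
  have hdisj : Disjoint (Ioc 0 (t / θ)) (Ioi (θ * t)) := by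
    rw [Set.disjoint_left]
    intro s hs hs'
    have := hs.2
    have : θ * t < s := hs'
    linarith
  constructor
  · refine Integrable.congr ?_ (pv_section_eq hθ).symm
    exact ((h1.union h2).integrable_indicator hm).mono_measure Measure.restrict_le_self
  · rw [integral_congr_ae (pv_section_eq hθ), halfLine, setIntegral_indicator hm,
      inter_eq_self_of_subset_right hsub, setIntegral_union hdisj measurableSet_Ioi h1 h2, h3]

/-- The singular kernel of the symmetrised principal-value identity. -/
def pvKernel (a b : ℝ) (z : ℝ × ℝ) : ℝ :=
  z.1 ^ 2 * z.2 ^ 2 / ((a ^ 2 + z.1 ^ 2) * (b ^ 2 + z.2 ^ 2) * (z.2 ^ 2 - z.1 ^ 2))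

lemma pvKernel_swap (a b : ℝ) (z : ℝ × ℝ) : pvKernel a b z.swap = -pvKernel b a z := by
  simp only [pvKernel, Prod.fst_swap, Prod.snd_swap]
  rw [← div_neg]
  congr 1 <;> ring

lemma measurable_pvKernel (a b : ℝ) : Measurable (pvKernel a b) := by
  unfold pvKernel; fun_prop

lemma ae_prod_halfLine_pos : ∀ᵐ z ∂halfLine.prod halfLine, 0 < z.1 ∧ 0 < z.2 :=
  (Measure.quasiMeasurePreserving_fst.ae ae_halfLine_pos).and
    (Measure.quasiMeasurePreserving_snd.ae ae_halfLine_pos)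

lemma ae_prod_halfLine_ne : ∀ᵐ z ∂halfLine.prod halfLine, z.1 ≠ z.2 := by
  rw [Measure.ae_prod_iff_ae_ae (p := fun z : ℝ × ℝ => z.1 ≠ z.2)]
  · refine Eventually.of_forall fun s => ?_
    filter_upwards [ae_restrict_of_ae (Measure.ae_ne volume s)] with t ht using ht.symm
  · exact (measurableSet_eq_fun measurable_fst measurable_snd).compl

variable {a b C θ : ℝ} {q : ℝ → ℝ}

/-- Outside the cutoff `|s² - t²| ≥ (1 - θ⁻²) s²`, and this cancels the factor `s²` of the
numerator. -/
lemma abs_pvKernel_le (ha : 0 < a) (hb : 0 < b) (hθ : 1 < θ) {z : ℝ × ℝ} (h1 : 0 < z.1)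
    (h2 : 0 < z.2) (hz : z ∈ offDiag θ) :
    |pvKernel a b z| ≤ (1 - 1 / θ ^ 2)⁻¹ * (z.1 ^ 2 / (a ^ 2 + z.1 ^ 2)) * (1 / (b ^ 2 + z.2 ^ 2)) := by
  obtain ⟨t, s⟩ := z
  simp only at h1 h2
  have hθ2 : 1 < θ ^ 2 := by nlinarith
  have hc : 0 < 1 - 1 / θ ^ 2 := by
    rw [sub_pos, div_lt_one (by positivity)]; exact hθ2
  have key : (1 - 1 / θ ^ 2) * s ^ 2 ≤ |s ^ 2 - t ^ 2| := by
    have e : (1 - 1 / θ ^ 2) * s ^ 2 = s ^ 2 - s ^ 2 / θ ^ 2 := by ring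
    rcases hz with h | h
    · simp only at h
      have h' : θ ^ 2 * s ^ 2 ≤ t ^ 2 := by
        rw [← mul_pow]; exact pow_le_pow_left₀ (by positivity) h 2
      have hst : s ^ 2 ≤ t ^ 2 := by nlinarith [sq_nonneg s]
      rw [abs_sub_comm, abs_of_nonneg (by linarith), e]
      have h3 : 0 ≤ s ^ 2 / θ ^ 2 := by positivity
      have h4 : θ ^ 2 * s ^ 2 + s ^ 2 / θ ^ 2 ≥ 2 * s ^ 2 := by
        have : θ ^ 2 * s ^ 2 + s ^ 2 / θ ^ 2 - 2 * s ^ 2 = (θ * s - s / θ) ^ 2 := by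
          field_simp; ring
        nlinarith [sq_nonneg (θ * s - s / θ)]
      linarith
    · simp only at h
      have h' : t ^ 2 ≤ s ^ 2 / θ ^ 2 := by
        rw [le_div_iff₀ (by positivity), mul_comm, ← mul_pow]
        exact pow_le_pow_left₀ (by positivity) h 2
      have : s ^ 2 / θ ^ 2 ≤ s ^ 2 := div_le_self (by positivity) hθ2.le
      rw [abs_of_nonneg (by linarith), e]
      linarith
  have hpos : 0 < |s ^ 2 - t ^ 2| := lt_of_lt_of_le (by positivity) key
  have hA : 0 < a ^ 2 + t ^ 2 := by positivity
  have hB : 0 < b ^ 2 + s ^ 2 := by positivity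
  rw [pvKernel]
  simp only
  rw [abs_div, abs_mul _ (s ^ 2 - t ^ 2), abs_of_nonneg (by positivity : 0 ≤ t ^ 2 * s ^ 2),
    abs_of_pos (by positivity : 0 < (a ^ 2 + t ^ 2) * (b ^ 2 + s ^ 2))]
  rw [show (1 - 1 / θ ^ 2)⁻¹ * (t ^ 2 / (a ^ 2 + t ^ 2)) * (1 / (b ^ 2 + s ^ 2))
    = t ^ 2 / ((a ^ 2 + t ^ 2) * (b ^ 2 + s ^ 2) * (1 - 1 / θ ^ 2)) by field_simp,
    div_le_div_iff₀ (by positivity) (by positivity)]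
  have := mul_le_mul_of_nonneg_left key
    (by positivity : 0 ≤ t ^ 2 * ((a ^ 2 + t ^ 2) * (b ^ 2 + s ^ 2)))
  linarith

lemma integrable_truncated (ha : 0 < a) (hb : 0 < b) (hθ : 1 < θ) (hq : Measurable q)
    (hC : ∀ t, 0 < t → |q t| * t ^ 2 ≤ C) :
    Integrable ((offDiag θ).indicator fun z => q z.1 * pvKernel a b z)
      (halfLine.prod halfLine) := by
  have hC0 : 0 ≤ C := le_trans (by positivity) (hC 1 one_pos)
  have hθ2 : 1 < θ ^ 2 := by nlinarith
  have hc : 0 < 1 - 1 / θ ^ 2 := by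
    rw [sub_pos, div_lt_one (by positivity)]; exact hθ2
  have hdom := ((integrable_lorentz_half ha).mul_prod (integrable_lorentz_half hb)).const_mul
    ((1 - 1 / θ ^ 2)⁻¹ * C)
  refine hdom.mono' ((((hq.comp measurable_fst).mul (measurable_pvKernel a b)).indicator
    (measurableSet_offDiag θ)).aestronglyMeasurable) ?_
  filter_upwards [ae_prod_halfLine_pos] with z hz
  by_cases hmem : z ∈ offDiag θ
  · rw [indicator_of_mem hmem, Real.norm_eq_abs, abs_mul]
    have h1 := abs_pvKernel_le ha hb hθ hz.1 hz.2 hmem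
    have h2 := mul_le_mul_of_nonneg_left h1 (abs_nonneg (q z.1))
    refine h2.trans ?_
    have e : |q z.1| * ((1 - 1 / θ ^ 2)⁻¹ * (z.1 ^ 2 / (a ^ 2 + z.1 ^ 2)) * (1 / (b ^ 2 + z.2 ^ 2)))
      = (|q z.1| * z.1 ^ 2) * ((1 - 1 / θ ^ 2)⁻¹ *
        (1 / (a ^ 2 + z.1 ^ 2) * (1 / (b ^ 2 + z.2 ^ 2)))) := by ring
    rw [e, mul_comm _ C, mul_assoc C]
    exact mul_le_mul_of_nonneg_right (hC _ hz.1) (by positivity)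
  · rw [indicator_of_notMem hmem, norm_zero]
    positivity

/-- In partial fractions, `s²/((b² + s²)(s² - t²))` is `(b²/(b² + s²) + t²/(s² - t²))/(b² + t²)`.
The singular term integrates to zero by `integral_pv`, which leaves a Lorentzian. -/
lemma integral_truncated_section (ha : 0 < a) (hb : 0 < b) (hθ : 1 < θ) {t : ℝ} (ht : 0 < t) :
    ∫ s, (offDiag θ).indicator (fun z => q z.1 * pvKernel a b z) (t, s) ∂halfLine =
      q t * (t ^ 2 / ((a ^ 2 + t ^ 2) * (b ^ 2 + t ^ 2))) *
        (b ^ 2 * ∫ s, (Prod.mk t ⁻¹' offDiag θ).indicator (fun s => 1 / (b ^ 2 + s ^ 2)) s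
          ∂halfLine) := by
  obtain ⟨hi, h0⟩ := integral_pv ht hθ
  have hm : MeasurableSet (Prod.mk t ⁻¹' offDiag θ) :=
    measurable_prodMk_left (measurableSet_offDiag θ)
  have hib := (integrable_lorentz_half hb).indicator hm
  have : ∀ᵐ s ∂halfLine, (offDiag θ).indicator (fun z => q z.1 * pvKernel a b z) (t, s)
      = q t * (t ^ 2 / ((a ^ 2 + t ^ 2) * (b ^ 2 + t ^ 2))) *
      (b ^ 2 * (Prod.mk t ⁻¹' offDiag θ).indicator (fun s => 1 / (b ^ 2 + s ^ 2)) s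
        + t ^ 2 * (Prod.mk t ⁻¹' offDiag θ).indicator (fun s => 1 / (s ^ 2 - t ^ 2)) s) := by
    filter_upwards [ae_halfLine_pos] with s hs0
    by_cases hs : (t, s) ∈ offDiag θ
    · have hs' : s ∈ Prod.mk t ⁻¹' offDiag θ := hs
      rw [indicator_of_mem hs, indicator_of_mem hs', indicator_of_mem hs', pvKernel]
      have hA : 0 < a ^ 2 + t ^ 2 := by positivity
      have hB : 0 < b ^ 2 + t ^ 2 := by positivity
      have hB : 0 < b ^ 2 + s ^ 2 := by positivity
      rcases eq_or_ne (s ^ 2 - t ^ 2) 0 with h | h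
      · exfalso
        have hst : s = t ∨ s = -t := sq_eq_sq_iff_eq_or_eq_neg.mp (by linarith)
        rcases hs with h' | h' <;> simp only at h' <;> rcases hst with rfl | rfl <;> nlinarith
      · simp only
        field_simp
        ring
    · have hs' : s ∉ Prod.mk t ⁻¹' offDiag θ := hs
      rw [indicator_of_notMem hs, indicator_of_notMem hs', indicator_of_notMem hs']
      simp
  rw [integral_congr_ae this, integral_const_mul, integral_add (hib.const_mul _) (hi.const_mul _), integral_const_mul,
    integral_const_mul, h0, mul_zero, add_zero]

lemma ratio_seq_gt (n : ℕ) : 1 < 1 + 1 / ((n : ℝ) + 1) := by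
  have : 0 < 1 / ((n : ℝ) + 1) := by positivity
  linarith

lemma tendsto_ratio_seq : Tendsto (fun n : ℕ => 1 + 1 / ((n : ℝ) + 1)) atTop (𝓝 1) := by
  simpa using (tendsto_one_div_add_atTop_nhds_zero_nat (𝕜 := ℝ)).const_add 1

lemma eventually_mem_offDiag {z : ℝ × ℝ} (hne : z.1 ≠ z.2) :
    ∀ᶠ n : ℕ in atTop, z ∈ offDiag (1 + 1 / ((n : ℝ) + 1)) := by
  rcases lt_or_gt_of_ne hne with h | h
  · have := (tendsto_ratio_seq.mul_const z.1).eventually (gt_mem_nhds (by linarith : 1 * z.1 < z.2))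
    filter_upwards [this] with n hn using Or.inr hn.le
  · have := (tendsto_ratio_seq.mul_const z.2).eventually (gt_mem_nhds (by linarith : 1 * z.2 < z.1))
    filter_upwards [this] with n hn using Or.inl hn.le

/-- As the cutoff closes, the remaining Lorentzian integral tends to `π/(2b)`, whence the constant
`b²·π/(2b) = πb/2`. The decay `|q| t² ≤ C` provides the dominating function. -/
lemma tendsto_integral_truncated (ha : 0 < a) (hb : 0 < b) (hq : Measurable q)
    (hC : ∀ t, 0 < t → |q t| * t ^ 2 ≤ C) :
    Tendsto (fun n : ℕ => ∫ z, (offDiag (1 + 1 / ((n : ℝ) + 1))).indicator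
      (fun z => q z.1 * pvKernel a b z) z ∂halfLine.prod halfLine) atTop
      (𝓝 (∫ t, q t * (t ^ 2 / ((a ^ 2 + t ^ 2) * (b ^ 2 + t ^ 2))) * (Real.pi * b / 2)
        ∂halfLine)) := by
  have hC0 : 0 ≤ C := le_trans (by positivity) (hC 1 one_pos)
  have heq : ∀ n : ℕ, ∫ z, (offDiag (1 + 1 / ((n : ℝ) + 1))).indicator
      (fun z => q z.1 * pvKernel a b z) z ∂halfLine.prod halfLine
      = ∫ t, q t * (t ^ 2 / ((a ^ 2 + t ^ 2) * (b ^ 2 + t ^ 2))) *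
        (b ^ 2 * ∫ s, (Prod.mk t ⁻¹' offDiag (1 + 1 / ((n : ℝ) + 1))).indicator
          (fun s => 1 / (b ^ 2 + s ^ 2)) s ∂halfLine) ∂halfLine := by
    intro n
    rw [integral_prod _ (integrable_truncated ha hb (ratio_seq_gt n) hq hC)]
    refine integral_congr_ae ?_
    filter_upwards [ae_halfLine_pos] with t ht
    exact integral_truncated_section ha hb (ratio_seq_gt n) ht
  simp_rw [heq]
  have hind : ∀ (n : ℕ) (t s : ℝ), ‖(Prod.mk t ⁻¹' offDiag (1 + 1 / ((n : ℝ) + 1))).indicator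
      (fun s => 1 / (b ^ 2 + s ^ 2)) s‖ ≤ 1 / (b ^ 2 + s ^ 2) := by
    intro n t s
    refine (norm_indicator_le_norm_self _ _).trans ?_
    rw [Real.norm_of_nonneg (by positivity)]
  refine tendsto_integral_of_dominated_convergence
    (fun t => C / b ^ 2 * (1 / (a ^ 2 + t ^ 2)) * (b ^ 2 * (Real.pi / (2 * b)))) ?_ ?_ ?_ ?_
  · intro n
    refine (Measurable.aestronglyMeasurable ?_)
    refine (hq.mul (by fun_prop)).mul (measurable_const.mul ?_)
    have : StronglyMeasurable (fun z : ℝ × ℝ => (offDiag (1 + 1 / ((n : ℝ) + 1))).indicator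
      (fun z => 1 / (b ^ 2 + z.2 ^ 2)) z) :=
      (Measurable.indicator (by fun_prop) (measurableSet_offDiag _)).stronglyMeasurable
    exact this.integral_prod_right'.measurable
  · exact ((integrable_lorentz_half ha).const_mul _).mul_const _
  · intro n
    filter_upwards [ae_halfLine_pos] with t ht
    rw [norm_mul, norm_mul]
    refine mul_le_mul ?_ ?_ (norm_nonneg _) (by positivity)
    · rw [Real.norm_eq_abs, Real.norm_of_nonneg (by positivity)]
      have h2 : t ^ 2 / ((a ^ 2 + t ^ 2) * (b ^ 2 + t ^ 2))
          ≤ t ^ 2 / ((a ^ 2 + t ^ 2) * b ^ 2) := by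
        have : b ^ 2 ≤ b ^ 2 + t ^ 2 := by nlinarith
        gcongr
      calc |q t| * (t ^ 2 / ((a ^ 2 + t ^ 2) * (b ^ 2 + t ^ 2)))
          ≤ |q t| * (t ^ 2 / ((a ^ 2 + t ^ 2) * b ^ 2)) := by gcongr
        _ = (|q t| * t ^ 2) * (1 / b ^ 2 * (1 / (a ^ 2 + t ^ 2))) := by field_simp
        _ ≤ C * (1 / b ^ 2 * (1 / (a ^ 2 + t ^ 2))) := by gcongr; exact hC t ht
        _ = _ := by ring
    · rw [norm_mul, Real.norm_of_nonneg (by positivity)]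
      gcongr
      rw [← integral_lorentz hb]
      exact norm_integral_le_of_norm_le (integrable_lorentz_half hb)
        (Eventually.of_forall fun s => hind n t s)
  · filter_upwards [ae_halfLine_pos] with t ht
    have hlim : Tendsto (fun n : ℕ => ∫ s, (Prod.mk t ⁻¹' offDiag (1 + 1 / ((n : ℝ) + 1))).indicator
        (fun s => 1 / (b ^ 2 + s ^ 2)) s ∂halfLine) atTop (𝓝 (Real.pi / (2 * b))) := by
      rw [← integral_lorentz hb]
      refine tendsto_integral_of_dominated_convergence _ ?_ (integrable_lorentz_half hb)
        (fun n => Eventually.of_forall fun s => hind n t s) ?_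
      · intro n
        exact (Measurable.indicator (by fun_prop)
          (measurable_prodMk_left (measurableSet_offDiag _))).aestronglyMeasurable
      · filter_upwards [ae_halfLine_pos, ae_restrict_of_ae (Measure.ae_ne volume t)] with s hs hne
        refine tendsto_const_nhds.congr' ?_
        filter_upwards [eventually_mem_offDiag (z := (t, s)) hne.symm] with n hn
        rw [indicator_of_mem (show s ∈ Prod.mk t ⁻¹' offDiag (1 + 1 / ((n : ℝ) + 1)) from hn)]
    have := (hlim.const_mul (b ^ 2)).const_mul (q t * (t ^ 2 / ((a ^ 2 + t ^ 2) * (b ^ 2 + t ^ 2))))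
    refine this.congr' ?_ |>.trans ?_
    · exact EventuallyEq.rfl
    · rw [show b ^ 2 * (Real.pi / (2 * b)) = Real.pi * b / 2 by field_simp]

/-- The double integral of `(q τ - q σ) / (σ² - τ²)` against two Lorentzians. -/
lemma integral_difference_quotient (ha : 0 < a) (hb : 0 < b) (hq : Measurable q)
    (hC : ∀ t, 0 < t → |q t| * t ^ 2 ≤ C)
    (hint : Integrable (fun z => (q z.1 - q z.2) * pvKernel a b z) (halfLine.prod halfLine)) :
    ∫ z, (q z.1 - q z.2) * pvKernel a b z ∂halfLine.prod halfLine =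
      Real.pi / 2 * (a + b) * ∫ t, q t * (t ^ 2 / ((a ^ 2 + t ^ 2) * (b ^ 2 + t ^ 2)))
        ∂halfLine := by
  have h1 := tendsto_integral_truncated ha hb hq hC
  have h2 := tendsto_integral_truncated hb ha hq hC
  have hsum := h1.add h2
  have hlim : Tendsto (fun n : ℕ => ∫ z, (offDiag (1 + 1 / ((n : ℝ) + 1))).indicator
      (fun z => (q z.1 - q z.2) * pvKernel a b z) z ∂halfLine.prod halfLine) atTop
      (𝓝 (∫ z, (q z.1 - q z.2) * pvKernel a b z ∂halfLine.prod halfLine)) := by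
    refine tendsto_integral_of_dominated_convergence _ ?_ hint.norm
      (fun n => Eventually.of_forall fun s => norm_indicator_le_norm_self _ _) ?_
    · intro n
      exact (hint.1.indicator (measurableSet_offDiag _))
    · filter_upwards [ae_prod_halfLine_pos, ae_prod_halfLine_ne] with z hz hne
      refine tendsto_const_nhds.congr' ?_
      filter_upwards [eventually_mem_offDiag hne] with n hn
      rw [indicator_of_mem hn]
  -- The cutoff region is symmetric and both terms are integrable on it. Exchanging the variables in
  -- the second one turns `pvKernel a b` into `-pvKernel b a`.
  have heq : ∀ n : ℕ, ∫ z, (offDiag (1 + 1 / ((n : ℝ) + 1))).indicator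
      (fun z => (q z.1 - q z.2) * pvKernel a b z) z ∂halfLine.prod halfLine =
      (∫ z, (offDiag (1 + 1 / ((n : ℝ) + 1))).indicator
        (fun z => q z.1 * pvKernel a b z) z ∂halfLine.prod halfLine) +
      ∫ z, (offDiag (1 + 1 / ((n : ℝ) + 1))).indicator
        (fun z => q z.1 * pvKernel b a z) z ∂halfLine.prod halfLine := by
    intro n
    have i1 := integrable_truncated ha hb (ratio_seq_gt n) hq hC
    have i2 := integrable_truncated hb ha (ratio_seq_gt n) hq hC
    rw [← integral_prod_swap ((offDiag (1 + 1 / ((n : ℝ) + 1))).indicator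
        (fun z => q z.1 * pvKernel b a z))]
    refine Eq.trans ?_ (integral_add i1 i2.swap)
    congr 1
    ext z
    have hsw : z.swap ∈ offDiag (1 + 1 / ((n : ℝ) + 1)) ↔ z ∈ offDiag (1 + 1 / ((n : ℝ) + 1)) :=
      or_comm
    by_cases hz : z ∈ offDiag (1 + 1 / ((n : ℝ) + 1))
    · rw [indicator_of_mem hz, indicator_of_mem hz, indicator_of_mem (hsw.mpr hz),
        pvKernel_swap, Prod.fst_swap]
      ring
    · rw [indicator_of_notMem hz, indicator_of_notMem hz, indicator_of_notMem (mt hsw.mp hz)]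
      simp
  simp_rw [heq] at hlim
  rw [tendsto_nhds_unique hlim hsum, integral_mul_const, integral_mul_const]
  simp_rw [mul_comm (b ^ 2 + _) (a ^ 2 + _)]
  ring

/-! ### The square root of a rank one perturbation and its quadratic equation. -/

section RootKernel

variable {X : Type*} [MeasurableSpace X] (μ : Measure X) (ω E : X → ℝ) (g : ℝ)

/-- The perturbation determinant `1 + g ∫ ω / (E² + t²)` of a rank one perturbation. -/
def pertDet (t : ℝ) : ℝ := 1 + g * ∫ x, ω x / (E x ^ 2 + t ^ 2) ∂μ

/-- The integral kernel of the difference between the square root of multiplication by `E²`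
perturbed by `g` times a rank one operator and multiplication by `E`. -/
def rootKernel (a b : ℝ) : ℝ :=
  2 * g / Real.pi * ∫ t, 1 / pertDet μ ω E g t *
    (t ^ 2 / ((a ^ 2 + t ^ 2) * (b ^ 2 + t ^ 2))) ∂halfLine

lemma rootKernel_comm (a b : ℝ) : rootKernel μ ω E g a b = rootKernel μ ω E g b a := by
  simp only [rootKernel, mul_comm (a ^ 2 + _)]

variable {μ ω E g}

lemma measurable_pertDet [SFinite μ] (hω : Measurable ω) (hE : Measurable E) :
    Measurable (pertDet μ ω E g) := by
  have : StronglyMeasurable (fun z : ℝ × X => ω z.2 / (E z.2 ^ 2 + z.1 ^ 2)) :=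
    Measurable.stronglyMeasurable (by fun_prop)
  exact (this.integral_prod_right'.measurable.const_mul g).const_add 1

lemma measurable_rootKernel [SFinite μ] (hω : Measurable ω) (hE : Measurable E) :
    Measurable (fun z : ℝ × ℝ => rootKernel μ ω E g z.1 z.2) := by
  have hD := measurable_pertDet (μ := μ) (g := g) hω hE
  have : StronglyMeasurable (fun z : (ℝ × ℝ) × ℝ => 1 / pertDet μ ω E g z.2 *
      (z.2 ^ 2 / ((z.1.1 ^ 2 + z.2 ^ 2) * (z.1.2 ^ 2 + z.2 ^ 2)))) := by
    refine Measurable.stronglyMeasurable ?_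
    exact (measurable_const.div (hD.comp measurable_snd)).mul (by fun_prop)
  exact (this.integral_prod_right' (ν := halfLine)).measurable.const_mul _

variable {δ : ℝ}

lemma integrable_rootKernel_integrand [SFinite μ] (hω : Measurable ω) (hE : Measurable E) (hδ : 0 < δ)
    (hD : ∀ t, 0 < t → δ ≤ pertDet μ ω E g t) {a b : ℝ} (ha : 0 < a) (hb : 0 < b) :
    Integrable (fun t => 1 / pertDet μ ω E g t *
      (t ^ 2 / ((a ^ 2 + t ^ 2) * (b ^ 2 + t ^ 2)))) halfLine := by
  refine (integrable_sqkernel ha hb).bdd_mul (c := 1 / δ)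
    (measurable_const.div (measurable_pertDet hω hE)).aestronglyMeasurable ?_
  filter_upwards [ae_halfLine_pos] with t ht
  have := hD t ht
  have : 0 < pertDet μ ω E g t := hδ.trans_le this
  rw [Real.norm_of_nonneg (by positivity)]
  gcongr

lemma abs_rootKernel_le (hδ : 0 < δ)
    (hD : ∀ t, 0 < t → δ ≤ pertDet μ ω E g t) {a b : ℝ} (ha : 0 < a) (hb : 0 < b) :
    |rootKernel μ ω E g a b| ≤ |g| / δ / (a + b) := by
  have h : |∫ t, 1 / pertDet μ ω E g t *
      (t ^ 2 / ((a ^ 2 + t ^ 2) * (b ^ 2 + t ^ 2))) ∂halfLine| ≤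
      1 / δ * (Real.pi / (2 * (a + b))) := by
    rw [← integral_sqkernel ha hb, ← integral_const_mul, ← Real.norm_eq_abs]
    refine norm_integral_le_of_norm_le ((integrable_sqkernel ha hb).const_mul _) ?_
    filter_upwards [ae_halfLine_pos] with t ht
    have := hD t ht
    have : 0 < pertDet μ ω E g t := hδ.trans_le this
    rw [Real.norm_of_nonneg (by positivity)]
    gcongr
  rw [rootKernel, abs_mul, abs_div, abs_mul, abs_two, abs_of_pos Real.pi_pos]
  refine (mul_le_mul_of_nonneg_left h (by positivity)).trans (le_of_eq ?_)
  have := Real.pi_pos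
  field_simp

/-- The determinant tends to `1` at the rate `t⁻²`. This is the decay that
`integral_difference_quotient` asks of its function `q`. -/
lemma pertDet_sub_one_le (hω0 : ∀ᵐ x ∂μ, 0 ≤ ω x) (hωi : Integrable ω μ) (t : ℝ) :
    |pertDet μ ω E g t - 1| * t ^ 2 ≤ |g| * ∫ x, ω x ∂μ := by
  rw [pertDet, add_sub_cancel_left, abs_mul, mul_assoc]
  gcongr
  rw [← abs_of_nonneg (sq_nonneg t), ← abs_mul, ← integral_mul_const,
    ← Real.norm_eq_abs]
  refine norm_integral_le_of_norm_le hωi ?_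
  filter_upwards [hω0] with x hx
  rw [Real.norm_of_nonneg (by positivity), div_mul_eq_mul_div]
  refine div_le_of_le_mul₀ (by positivity) hx ?_
  gcongr
  nlinarith [sq_nonneg (E x), le_abs_self (t ^ 2)]

lemma integrable_resolvent (hω : Measurable ω) (hE : Measurable E) (hωi : Integrable ω μ) {t : ℝ}
    (ht : 0 < t) : Integrable (fun x => ω x / (E x ^ 2 + t ^ 2)) μ := by
  refine (hωi.norm.div_const (t ^ 2)).mono' (hω.div (by fun_prop)).aestronglyMeasurable
    (Eventually.of_forall fun x => ?_)
  rw [norm_div, Real.norm_of_nonneg (by positivity : 0 ≤ E x ^ 2 + t ^ 2)]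
  gcongr
  nlinarith [sq_nonneg (E x)]

/-- A resolvent identity: the integral of a product of two Lorentzians is a difference quotient of
the determinant. It introduces the denominator `s² - t²` that calls for principal values. -/
lemma pertDet_sub (hω : Measurable ω) (hE : Measurable E) (hωi : Integrable ω μ) {t s : ℝ}
    (ht : 0 < t) (hs : 0 < s) :
    g * (∫ x, ω x / ((E x ^ 2 + t ^ 2) * (E x ^ 2 + s ^ 2)) ∂μ) * (s ^ 2 - t ^ 2) =
      pertDet μ ω E g t - pertDet μ ω E g s := by
  rw [pertDet, pertDet, add_sub_add_left_eq_sub, ← mul_sub,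
    ← integral_sub (integrable_resolvent hω hE hωi ht) (integrable_resolvent hω hE hωi hs),
    mul_assoc, ← integral_mul_const]
  congr 2
  ext x
  have : 0 < E x ^ 2 + t ^ 2 := by positivity
  have : 0 < E x ^ 2 + s ^ 2 := by positivity
  field_simp
  ring

/-- The quadratic equation solved by `rootKernel`. -/
theorem rootKernel_riccati [SFinite μ] (hω : Measurable ω) (hE : Measurable E) (hω0 : ∀ᵐ x ∂μ, 0 ≤ ω x)
    (hωi : Integrable ω μ) (hE0 : ∀ᵐ x ∂μ, 0 < E x) (hδ : 0 < δ)
    (hD : ∀ t, 0 < t → δ ≤ pertDet μ ω E g t) {a b : ℝ} (ha : 0 < a) (hb : 0 < b) :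
    (a + b) * rootKernel μ ω E g a b +
      ∫ x, ω x * rootKernel μ ω E g a (E x) * rootKernel μ ω E g (E x) b ∂μ = g := by
  by_cases hg : g = 0
  · simp [rootKernel, hg]
  set D := pertDet μ ω E g with hDdef
  have hDm : Measurable D := measurable_pertDet hω hE
  set p : ℝ → ℝ := fun t => 1 / D t with hp
  have hpm : Measurable p := measurable_const.div hDm
  have hpb : ∀ t, 0 < t → 0 ≤ p t ∧ p t ≤ 1 / δ := fun t ht => by
    have := hD t ht
    have : 0 < D t := hδ.trans_le this
    exact ⟨by positivity, by simp only [hp]; gcongr⟩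
  -- `p` tends to `1`, so `q` decays. The identity `p(t) p(s) (D(t) - D(s)) = p(s) - p(t) = q(t) -
  -- q(s)` makes the double integral a difference quotient of `q`.
  set q : ℝ → ℝ := fun t => 1 - p t with hq
  have hqC : ∀ t, 0 < t → |q t| * t ^ 2 ≤ 1 / δ * (|g| * ∫ x, ω x ∂μ) := by
    intro t ht
    have h1 := hD t ht
    have h2 : 0 < D t := hδ.trans_le h1
    have e : q t = p t * (D t - 1) := by
      simp only [hq, hp]; field_simp
    rw [e, abs_mul, mul_assoc]
    have h3 := pertDet_sub_one_le (E := E) (g := g) hω0 hωi t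
    have h4 : |p t| ≤ 1 / δ := by rw [abs_of_nonneg (hpb t ht).1]; exact (hpb t ht).2
    exact mul_le_mul h4 h3 (by positivity) (by positivity)
  -- The integrand of `∫ ω K(a, E) K(E, b)` with both kernels unfolded. Integrating over `z` first
  -- recovers the kernels (`hL`); integrating over `x` first produces the difference quotient
  -- (`hR`).
  set Ψ : X → ℝ × ℝ → ℝ := fun x z => ω x *
    ((p z.1 * (z.1 ^ 2 / ((a ^ 2 + z.1 ^ 2) * (E x ^ 2 + z.1 ^ 2)))) *
     (p z.2 * (z.2 ^ 2 / ((E x ^ 2 + z.2 ^ 2) * (b ^ 2 + z.2 ^ 2))))) with hΨ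
  have hΨm : Measurable (Function.uncurry Ψ) := by
    simp only [hΨ, Function.uncurry_def]
    have h1 : Measurable fun z : X × ℝ × ℝ => p z.2.1 := hpm.comp (by fun_prop)
    have h2 : Measurable fun z : X × ℝ × ℝ => p z.2.2 := hpm.comp (by fun_prop)
    refine (hω.comp measurable_fst).mul ((h1.mul ?_).mul (h2.mul ?_)) <;> fun_prop
  have hΨi : Integrable (Function.uncurry Ψ) (μ.prod (halfLine.prod halfLine)) := by
    have hdom := hωi.norm.mul_prod
      (((integrable_lorentz_half ha).mul_prod (integrable_lorentz_half hb)).const_mul (1 / δ * (1 / δ)))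
    refine hdom.mono' hΨm.aestronglyMeasurable ?_
    filter_upwards [Measure.quasiMeasurePreserving_fst.ae hE0,
      Measure.quasiMeasurePreserving_snd.ae ae_prod_halfLine_pos] with z hz1 hz2
    obtain ⟨x, t, s⟩ := z
    simp only at hz1 hz2
    obtain ⟨h1, h2⟩ := hz2
    have ht := hpb t h1
    have hs := hpb s h2
    simp only [Function.uncurry, hΨ]
    rw [norm_mul]
    gcongr
    have e1 := sqkernel_le (t := t) ha hz1
    have e2 := sqkernel_le (t := s) hb hz1
    rw [mul_comm (b ^ 2 + s ^ 2)] at e2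
    have ht0 := ht.1
    have hs0 := hs.1
    rw [Real.norm_of_nonneg (by positivity)]
    calc _ ≤ (1 / δ * (1 / (a ^ 2 + t ^ 2))) * (1 / δ * (1 / (b ^ 2 + s ^ 2))) := by
          refine mul_le_mul ?_ ?_ (by positivity) (by positivity)
          · exact mul_le_mul ht.2 e1 (by positivity) (by positivity)
          · exact mul_le_mul hs.2 e2 (by positivity) (by positivity)
      _ = _ := by ring
  have hswap := integral_integral_swap hΨi
  have hL : ∀ x, ∫ z, Ψ x z ∂halfLine.prod halfLine = (Real.pi / (2 * g)) ^ 2 *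
      (ω x * rootKernel μ ω E g a (E x) * rootKernel μ ω E g (E x) b) := by
    intro x
    simp only [hΨ]
    rw [integral_const_mul, integral_prod_mul (fun t => p t * (t ^ 2 / ((a ^ 2 + t ^ 2) * (E x ^ 2 + t ^ 2))))
      (fun s => p s * (s ^ 2 / ((E x ^ 2 + s ^ 2) * (b ^ 2 + s ^ 2)))), rootKernel, rootKernel]
    have := Real.pi_pos
    simp only [hp, hDdef]
    field_simp
  have hR : ∀ᵐ z ∂halfLine.prod halfLine, ∫ x, Ψ x z ∂μ =
      1 / g * ((q z.1 - q z.2) * pvKernel a b z) := by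
    filter_upwards [ae_prod_halfLine_pos, ae_prod_halfLine_ne] with z hz hne
    obtain ⟨t, s⟩ := z
    simp only at hz hne
    have e : ∀ x, Ψ x (t, s) = (p t * p s * (t ^ 2 * s ^ 2 / ((a ^ 2 + t ^ 2) * (b ^ 2 + s ^ 2)))) *
        (ω x / ((E x ^ 2 + t ^ 2) * (E x ^ 2 + s ^ 2))) := by
      intro x
      have h1 := hz.1
      have h2 := hz.2
      have : 0 < E x ^ 2 + t ^ 2 := by positivity
      have : 0 < E x ^ 2 + s ^ 2 := by positivity
      have : 0 < b ^ 2 + s ^ 2 := by positivity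
      have : 0 < a ^ 2 + t ^ 2 := by positivity
      simp only [hΨ]
      field_simp
    simp_rw [e]
    rw [integral_const_mul]
    have hsub := pertDet_sub (g := g) hω hE hωi hz.1 hz.2
    have hst : s ^ 2 - t ^ 2 ≠ 0 := by
      rw [sub_ne_zero]
      intro h
      exact hne ((sq_eq_sq₀ hz.2.le hz.1.le).mp h).symm
    have hDt : 0 < D t := hδ.trans_le (hD t hz.1)
    have hDs : 0 < D s := hδ.trans_le (hD s hz.2)
    have hI : ∫ x, ω x / ((E x ^ 2 + t ^ 2) * (E x ^ 2 + s ^ 2)) ∂μ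
        = (D t - D s) / (g * (s ^ 2 - t ^ 2)) := by
      rw [eq_div_iff (mul_ne_zero hg hst), ← hsub]; ring
    have hb2 : 0 < b ^ 2 + s ^ 2 := by positivity
    have ha2 : 0 < a ^ 2 + t ^ 2 := by positivity
    rw [hI, pvKernel]
    simp only [hq, hp]
    field_simp
    ring
  have hHi : Integrable (fun z => (q z.1 - q z.2) * pvKernel a b z) (halfLine.prod halfLine) := by
    have := (hΨi.integral_prod_right.congr hR).const_mul g
    refine this.congr (Eventually.of_forall fun z => ?_)
    simp only
    field_simp
  have hPV := integral_difference_quotient (q := q) ha hb (measurable_const.sub hpm) hqC hHi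
  simp_rw [hL] at hswap
  rw [integral_const_mul, integral_congr_ae hR, integral_const_mul, hPV] at hswap
  -- Splitting `q = 1 - p`: the constant `1` gives `integral_sqkernel` and, in the end, the
  -- inhomogeneity `g`, while `p` gives the linear term in `rootKernel`.
  have hqi : ∫ t, q t * (t ^ 2 / ((a ^ 2 + t ^ 2) * (b ^ 2 + t ^ 2))) ∂halfLine =
      Real.pi / (2 * (a + b)) - Real.pi / (2 * g) * rootKernel μ ω E g a b := by
    have e : ∀ t, q t * (t ^ 2 / ((a ^ 2 + t ^ 2) * (b ^ 2 + t ^ 2))) =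
        t ^ 2 / ((a ^ 2 + t ^ 2) * (b ^ 2 + t ^ 2)) -
        1 / D t * (t ^ 2 / ((a ^ 2 + t ^ 2) * (b ^ 2 + t ^ 2))) := fun t => by
      simp only [hq, hp]; ring
    simp_rw [e]
    rw [integral_sub (integrable_sqkernel ha hb) (integrable_rootKernel_integrand hω hE hδ hD ha hb),
      integral_sqkernel ha hb, rootKernel]
    have := Real.pi_pos
    field_simp
  rw [hqi] at hswap
  have hpi := Real.pi_pos
  have hab : 0 < a + b := by positivity
  field_simp at hswap
  linarith

end RootKernel

/-! ### Positivity and form bounds for the root kernel. -/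

section RootKernelForm

variable {X : Type*} [MeasurableSpace X] {μ : Measure X} {ω E : X → ℝ} {g δ : ℝ}

lemma measurable_rootKernel_comp [SFinite μ] (hω : Measurable ω) (hE : Measurable E) :
    Measurable fun z : X × X => rootKernel μ ω E g (E z.1) (E z.2) := by
  have hpair : Measurable fun z : X × X => (E z.1, E z.2) := by fun_prop
  have := (measurable_rootKernel (μ := μ) (g := g) hω hE).comp hpair
  exact this

/-- For a non-negative coupling the kernel `rootKernel` is positive semidefinite. -/
lemma rootKernel_form_nonneg [SFinite μ] (hω : Measurable ω) (hE : Measurable E)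
    (hE0 : ∀ᵐ x ∂μ, 0 < E x) (hg : 0 ≤ g) (hδ : 0 < δ)
    (hD : ∀ t, 0 < t → δ ≤ pertDet μ ω E g t) {β : X → ℝ} (hβ : Measurable β)
    (hβi : Integrable (fun z : X × X => |β z.1| * |β z.2| / (E z.1 + E z.2)) (μ.prod μ)) :
    0 ≤ ∫ z : X × X, β z.1 * rootKernel μ ω E g (E z.1) (E z.2) * β z.2 ∂μ.prod μ := by
  have hDm := measurable_pertDet (μ := μ) (g := g) hω hE
  have hae : ∀ᵐ z ∂μ.prod μ, 0 < E z.1 ∧ 0 < E z.2 :=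
    (Measure.quasiMeasurePreserving_fst.ae hE0).and (Measure.quasiMeasurePreserving_snd.ae hE0)
  set K : X × X → ℝ → ℝ := fun z t => (β z.1 * β z.2) * (1 / pertDet μ ω E g t *
    (t ^ 2 / ((E z.1 ^ 2 + t ^ 2) * (E z.2 ^ 2 + t ^ 2)))) with hK
  have hKm : Measurable (Function.uncurry K) := by
    simp only [hK, Function.uncurry_def]
    have h2 : Measurable fun z : (X × X) × ℝ => pertDet μ ω E g z.2 := hDm.comp measurable_snd
    exact Measurable.mul (by fun_prop) ((measurable_const.div h2).mul (by fun_prop))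
  have hKi : Integrable (Function.uncurry K) ((μ.prod μ).prod halfLine) := by
    rw [integrable_prod_iff hKm.aestronglyMeasurable]
    constructor
    · filter_upwards [hae] with z hz
      exact (integrable_rootKernel_integrand hω hE hδ hD hz.1 hz.2).const_mul (β z.1 * β z.2)
    · refine (hβi.const_mul (1 / δ * (Real.pi / 2))).mono'
        hKm.norm.stronglyMeasurable.integral_prod_right'.aestronglyMeasurable ?_
      filter_upwards [hae] with z hz
      rw [Real.norm_of_nonneg (integral_nonneg fun _ => norm_nonneg _)]
      have h1 : ∀ᵐ t ∂halfLine, ‖Function.uncurry K (z, t)‖ ≤ |β z.1| * |β z.2| * (1 / δ) *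
          (t ^ 2 / ((E z.1 ^ 2 + t ^ 2) * (E z.2 ^ 2 + t ^ 2))) := by
        filter_upwards [ae_halfLine_pos] with t ht
        have h2 := hD t ht
        have h3 : 0 < pertDet μ ω E g t := hδ.trans_le h2
        simp only [hK, Function.uncurry]
        rw [norm_mul, norm_mul, norm_mul, Real.norm_eq_abs, Real.norm_eq_abs,
          Real.norm_of_nonneg (by positivity : 0 ≤ 1 / pertDet μ ω E g t),
          Real.norm_of_nonneg (by positivity), ← mul_assoc]
        gcongr
      have h2 := integral_mono_of_nonneg (Eventually.of_forall fun _ => norm_nonneg _)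
        ((integrable_sqkernel hz.1 hz.2).const_mul (|β z.1| * |β z.2| * (1 / δ))) h1
      refine h2.trans (le_of_eq ?_)
      rw [integral_const_mul, integral_sqkernel hz.1 hz.2]
      have := hz.1
      have := hz.2
      field_simp
  have hswap := integral_integral_swap hKi
  have hL : ∀ z, (∫ t, K z t ∂halfLine) * (2 * g / Real.pi) =
      β z.1 * rootKernel μ ω E g (E z.1) (E z.2) * β z.2 := by
    intro z
    simp only [hK]
    rw [integral_const_mul, rootKernel]
    ring
  simp_rw [← hL]
  rw [integral_mul_const, hswap]
  have hpi := Real.pi_pos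
  refine mul_nonneg (integral_nonneg_of_ae ?_) (by positivity)
  filter_upwards [ae_halfLine_pos] with t ht
  have h3 : 0 < pertDet μ ω E g t := hδ.trans_le (hD t ht)
  -- At each fixed `t` the kernel is a positive multiple of a product `f(x) f(y)`, so its form is a
  -- positive multiple of a square.
  have e : ∀ z : X × X, K z t = (t ^ 2 / pertDet μ ω E g t) *
      ((β z.1 / (E z.1 ^ 2 + t ^ 2)) * (β z.2 / (E z.2 ^ 2 + t ^ 2))) := by
    intro z
    simp only [hK]
    have : 0 < E z.1 ^ 2 + t ^ 2 := by positivity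
    have : 0 < E z.2 ^ 2 + t ^ 2 := by positivity
    field_simp
  simp_rw [e]
  rw [integral_const_mul, integral_prod_mul (fun x => β x / (E x ^ 2 + t ^ 2))
    (fun x => β x / (E x ^ 2 + t ^ 2))]
  exact mul_nonneg (by positivity) (mul_self_nonneg _)

/-- A lower bound for the determinant at negative coupling. -/
lemma pertDet_ge (hω : Measurable ω) (hE : Measurable E) (hω0 : ∀ᵐ x ∂μ, 0 ≤ ω x)
    (hωi : Integrable ω μ) (hE0 : ∀ᵐ x ∂μ, 0 < E x) (hg : g ≤ 0)
    (hI : Integrable (fun x => ω x / E x ^ 2) μ) {t : ℝ} (ht : 0 < t) :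
    1 + g * ∫ x, ω x / E x ^ 2 ∂μ ≤ pertDet μ ω E g t := by
  rw [pertDet, add_le_add_iff_left]
  refine mul_le_mul_of_nonpos_left ?_ hg
  refine integral_mono_ae (integrable_resolvent hω hE hωi ht) hI ?_
  filter_upwards [hω0, hE0] with x h1 h2
  gcongr
  nlinarith [sq_nonneg t]

/-- The Schur test for `rootKernel` at negative coupling. -/
lemma rootKernel_schur [SFinite μ] (hω : Measurable ω) (hE : Measurable E) (hω0 : ∀ᵐ x ∂μ, 0 ≤ ω x)
    (hωi : Integrable ω μ) (hE0 : ∀ᵐ x ∂μ, 0 < E x) (hg : g ≤ 0)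
    (hI : Integrable (fun x => ω x / E x ^ 2) μ) (hΔ : 0 < 1 + g * ∫ x, ω x / E x ^ 2 ∂μ)
    {a : ℝ} (ha : 0 < a) :
    Integrable (fun x => ω x / E x ^ 2 * |rootKernel μ ω E g a (E x)|) μ ∧
    ∫ x, ω x / E x ^ 2 * |rootKernel μ ω E g a (E x)| ∂μ ≤
      (-g * ∫ x, ω x / E x ^ 2 ∂μ) / a := by
  set F0 := ∫ x, ω x / E x ^ 2 ∂μ with hF0
  set δ := 1 + g * F0 with hδ
  have hD : ∀ t, 0 < t → δ ≤ pertDet μ ω E g t := fun t ht => pertDet_ge hω hE hω0 hωi hE0 hg hI ht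
  have hDm := measurable_pertDet (μ := μ) (g := g) hω hE
  set K : X → ℝ → ℝ := fun x t => (ω x / E x ^ 2) * (1 / pertDet μ ω E g t *
    (t ^ 2 / ((a ^ 2 + t ^ 2) * (E x ^ 2 + t ^ 2)))) with hK
  have hKm : Measurable (Function.uncurry K) := by
    simp only [hK, Function.uncurry_def]
    have h2 : Measurable fun z : X × ℝ => pertDet μ ω E g z.2 := hDm.comp measurable_snd
    exact Measurable.mul (by fun_prop) ((measurable_const.div h2).mul (by fun_prop))
  have hKi : Integrable (Function.uncurry K) (μ.prod halfLine) := by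
    refine (hI.mul_prod ((integrable_lorentz_half ha).const_mul (1 / δ))).mono'
      hKm.aestronglyMeasurable ?_
    filter_upwards [Measure.quasiMeasurePreserving_fst.ae (hω0.and hE0),
      Measure.quasiMeasurePreserving_snd.ae ae_halfLine_pos] with z hz ht
    have h2 := hD z.2 ht
    have h3 : 0 < pertDet μ ω E g z.2 := hΔ.trans_le h2
    have h4 := sqkernel_le (t := z.2) ha hz.2
    obtain ⟨h5, h6⟩ := hz
    simp only [hK, Function.uncurry]
    rw [Real.norm_of_nonneg (by positivity)]
    gcongr
  have hpi := Real.pi_pos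
  have hL : ∀ᵐ x ∂μ, ω x / E x ^ 2 * |rootKernel μ ω E g a (E x)| =
      -(2 * g / Real.pi) * ∫ t, K x t ∂halfLine := by
    filter_upwards with x
    simp only [hK]
    rw [integral_const_mul, rootKernel, abs_mul, abs_div, abs_mul, abs_two, abs_of_nonpos hg,
      abs_of_pos hpi, abs_of_nonneg (integral_nonneg_of_ae ?_)]
    · ring
    · filter_upwards [ae_halfLine_pos] with t ht
      have h3 : 0 < pertDet μ ω E g t := hΔ.trans_le (hD t ht)
      simp only [Pi.zero_apply]
      positivity
  refine ⟨((hKi.integral_prod_left).const_mul _).congr (hL.mono fun x hx => hx.symm), ?_⟩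
  rw [integral_congr_ae hL, integral_const_mul, integral_integral_swap hKi, ← integral_const_mul]
  have hle : ∀ᵐ t ∂halfLine, -(2 * g / Real.pi) * ∫ x, K x t ∂μ ≤
      2 / Real.pi * (-g * F0) * (1 / (a ^ 2 + t ^ 2)) := by
    filter_upwards [ae_halfLine_pos] with t ht
    have h2 := hD t ht
    have h3 : 0 < pertDet μ ω E g t := hΔ.trans_le h2
    -- The test weight `ω/E²` is chosen so that multiplication by `t²/(E² + t²)` yields a difference
    -- of two known integrals.
    have e : ∀ᵐ x ∂μ, K x t = (1 / pertDet μ ω E g t * (1 / (a ^ 2 + t ^ 2))) *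
        (ω x / E x ^ 2 - ω x / (E x ^ 2 + t ^ 2)) := by
      filter_upwards [hE0] with x hx
      simp only [hK]
      have : 0 < a ^ 2 + t ^ 2 := by positivity
      have : 0 < E x ^ 2 + t ^ 2 := by positivity
      field_simp
      ring
    rw [integral_congr_ae e, integral_const_mul, integral_sub hI (integrable_resolvent hω hE hωi ht)]
    -- Right side minus left side is `δ·(-g) ∫ ω/(E² + t²) ≥ 0`. So the numerator is at most `-g·F0`
    -- times the determinant, and the bound does not degrade with `1/δ`.
    have h4 : -g * (F0 - ∫ x, ω x / (E x ^ 2 + t ^ 2) ∂μ) ≤ (-g * F0) * pertDet μ ω E g t := by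
      have h5 : 0 ≤ -g * ∫ x, ω x / (E x ^ 2 + t ^ 2) ∂μ := by
        refine mul_nonneg (by linarith) (integral_nonneg_of_ae ?_)
        filter_upwards [hω0] with x hx
        simp only [Pi.zero_apply]
        positivity
      have h6 : -g * F0 ≤ 1 := by linarith
      rw [pertDet]
      nlinarith
    have h7 : -(2 * g / Real.pi) * ((1 / pertDet μ ω E g t * (1 / (a ^ 2 + t ^ 2))) *
        (F0 - ∫ x, ω x / (E x ^ 2 + t ^ 2) ∂μ)) =
        (2 / Real.pi * (1 / (a ^ 2 + t ^ 2))) *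
        ((-g * (F0 - ∫ x, ω x / (E x ^ 2 + t ^ 2) ∂μ)) / pertDet μ ω E g t) := by
      have : 0 < a ^ 2 + t ^ 2 := by positivity
      field_simp
    rw [h7]
    have h8 : (-g * (F0 - ∫ x, ω x / (E x ^ 2 + t ^ 2) ∂μ)) / pertDet μ ω E g t ≤ -g * F0 := by
      rwa [div_le_iff₀ h3]
    refine (mul_le_mul_of_nonneg_left h8 (by positivity)).trans (le_of_eq (by ring))
  refine (integral_mono_ae (hKi.integral_prod_right.const_mul _)
    ((integrable_lorentz_half ha).const_mul _) hle).trans (le_of_eq ?_)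
  rw [integral_const_mul, integral_lorentz ha]
  field_simp

/-- The form bound of `rootKernel` relative to multiplication by `E`, at negative coupling. -/
lemma abs_rootKernel_form_le [SFinite μ] (hω : Measurable ω) (hE : Measurable E) (hω0 : ∀ᵐ x ∂μ, 0 < ω x)
    (hωi : Integrable ω μ) (hE0 : ∀ᵐ x ∂μ, 0 < E x) (hg : g ≤ 0)
    (hI : Integrable (fun x => ω x / E x ^ 2) μ) (hΔ : 0 < 1 + g * ∫ x, ω x / E x ^ 2 ∂μ)
    {β : X → ℝ} (hβ : Measurable β) (hβi : Integrable (fun x => E x * β x ^ 2 / ω x) μ) :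
    |∫ z : X × X, β z.1 * rootKernel μ ω E g (E z.1) (E z.2) * β z.2 ∂μ.prod μ| ≤
      (-g * ∫ x, ω x / E x ^ 2 ∂μ) * ∫ x, E x * β x ^ 2 / ω x ∂μ := by
  have hω0' : ∀ᵐ x ∂μ, 0 ≤ ω x := hω0.mono fun x hx => hx.le
  set ρ := rootKernel μ ω E g with hρ
  obtain ⟨θ, hθ⟩ : ∃ θ, θ = -g * ∫ x, ω x / E x ^ 2 ∂μ := ⟨_, rfl⟩
  rw [← hθ]
  have hρm : Measurable fun z : X × X => ρ (E z.1) (E z.2) := measurable_rootKernel_comp hω hE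
  set G : X × X → ℝ := fun z => (E z.1 ^ 2 * β z.1 ^ 2 / ω z.1) *
    (ω z.2 / E z.2 ^ 2 * |ρ (E z.1) (E z.2)|) with hG
  have hGm : Measurable G := by
    simp only [hG]
    have := hρm.abs
    fun_prop
  have hsec : ∀ᵐ x ∂μ, ∫ y, G (x, y) ∂μ ≤ θ * (E x * β x ^ 2 / ω x) := by
    filter_upwards [hω0, hE0] with x h1 h2
    simp only [hG]
    rw [integral_const_mul]
    refine (mul_le_mul_of_nonneg_left
      (rootKernel_schur hω hE hω0' hωi hE0 hg hI hΔ h2).2 (by positivity)).trans (le_of_eq ?_)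
    rw [← hθ]
    field_simp
  have hsec0 : ∀ᵐ x ∂μ, 0 ≤ᵐ[μ] fun y => G (x, y) := by
    filter_upwards [hω0] with x h1
    filter_upwards [hω0] with y h2
    simp only [hG, Pi.zero_apply]
    positivity
  have hGi : Integrable G (μ.prod μ) := by
    rw [integrable_prod_iff hGm.aestronglyMeasurable]
    constructor
    · filter_upwards [hE0] with x h2
      exact (rootKernel_schur hω hE hω0' hωi hE0 hg hI hΔ h2).1.const_mul (E x ^ 2 * β x ^ 2 / ω x)
    · refine (hβi.const_mul θ).mono'
        hGm.norm.stronglyMeasurable.integral_prod_right'.aestronglyMeasurable ?_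
      filter_upwards [hsec, hsec0] with x h1 h2
      rw [Real.norm_of_nonneg (integral_nonneg fun _ => norm_nonneg _)]
      refine le_trans (le_of_eq (integral_congr_ae ?_)) h1
      filter_upwards [h2] with y hy using Real.norm_of_nonneg hy
  have hGint : ∫ z, G z ∂μ.prod μ ≤ θ * ∫ x, E x * β x ^ 2 / ω x ∂μ := by
    rw [integral_prod _ hGi, ← integral_const_mul]
    exact integral_mono_ae hGi.integral_prod_left (hβi.const_mul θ) hsec
  have hpt : ∀ᵐ z ∂μ.prod μ, ‖β z.1 * ρ (E z.1) (E z.2) * β z.2‖ ≤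
      1 / 2 * (G z + G z.swap) := by
    filter_upwards [Measure.quasiMeasurePreserving_fst.ae (hω0.and hE0),
      Measure.quasiMeasurePreserving_snd.ae (hω0.and hE0)] with z hz1 hz2
    obtain ⟨h1, h2⟩ := hz1
    obtain ⟨h3, h4⟩ := hz2
    have hcomm : ρ (E z.2) (E z.1) = ρ (E z.1) (E z.2) := rootKernel_comm ..
    simp only [hG, Prod.fst_swap, Prod.snd_swap, hcomm]
    rw [norm_mul, norm_mul, Real.norm_eq_abs, Real.norm_eq_abs, Real.norm_eq_abs]
    -- The weighted arithmetic-geometric inequality of the Schur test, with test weight `ω/E²` in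
    -- each variable.
    have h5 : |β z.1| * |β z.2| ≤ 1 / 2 * ((E z.1 ^ 2 * β z.1 ^ 2 / ω z.1) * (ω z.2 / E z.2 ^ 2) +
        (E z.2 ^ 2 * β z.2 ^ 2 / ω z.2) * (ω z.1 / E z.1 ^ 2)) := by
      have h6 : 0 ≤ (|β z.1| * E z.1 ^ 2 * ω z.2 - |β z.2| * E z.2 ^ 2 * ω z.1) ^ 2 /
          (E z.1 ^ 2 * E z.2 ^ 2 * ω z.1 * ω z.2) := by positivity
      have h7 : (|β z.1| * E z.1 ^ 2 * ω z.2 - |β z.2| * E z.2 ^ 2 * ω z.1) ^ 2 /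
          (E z.1 ^ 2 * E z.2 ^ 2 * ω z.1 * ω z.2) =
          (E z.1 ^ 2 * |β z.1| ^ 2 / ω z.1) * (ω z.2 / E z.2 ^ 2) +
          (E z.2 ^ 2 * |β z.2| ^ 2 / ω z.2) * (ω z.1 / E z.1 ^ 2) - 2 * (|β z.1| * |β z.2|) := by
        field_simp
        ring
      rw [h7, sq_abs, sq_abs] at h6
      linarith
    calc |β z.1| * |ρ (E z.1) (E z.2)| * |β z.2|
        = (|β z.1| * |β z.2|) * |ρ (E z.1) (E z.2)| := by ring
      _ ≤ _ := mul_le_mul_of_nonneg_right h5 (abs_nonneg _)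
      _ = _ := by ring
  rw [← Real.norm_eq_abs]
  refine (norm_integral_le_of_norm_le ((hGi.add hGi.swap).const_mul (1 / 2)) hpt).trans ?_
  rw [integral_const_mul]
  have : ∫ z, (G + G ∘ Prod.swap) z ∂μ.prod μ = ∫ z, G z ∂μ.prod μ + ∫ z, G z ∂μ.prod μ := by
    rw [integral_add' hGi hGi.swap]
    congr 1
    exact integral_prod_swap G
  rw [this]
  linarith

end RootKernelForm

/-! ### The energy and its second variation. -/

section Energy

/-- The derivative `∂_x ε_x(k)` of the dispersion. -/
def depsFn (x k : ℝ) : ℝ := (x + Real.cos k) / eps x k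

/-- The second derivative `∂_x² ε_x(k)` of the dispersion. -/
def curv (x k : ℝ) : ℝ := Real.sin k ^ 2 / eps x k ^ 3

variable {ν : ℝ → ℝ} {h lam x y k : ℝ}

lemma hasDerivAt_eps (hk : k ∈ Ioo 0 Real.pi) (y : ℝ) :
    HasDerivAt (fun y => eps y k) (depsFn y k) y := by
  have hp := eps_pos (x := y) hk
  have h0 : 1 + y ^ 2 + 2 * y * Real.cos k ≠ 0 := fun h0 => by
    rw [eps, h0, Real.sqrt_zero] at hp
    exact lt_irrefl _ hp
  have h1 : HasDerivAt (fun y : ℝ => 1 + y ^ 2 + 2 * y * Real.cos k)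
      (2 * y + 2 * Real.cos k) y := by
    have := ((hasDerivAt_pow 2 y).const_add 1).add
      (((hasDerivAt_id y).const_mul 2).mul_const (Real.cos k))
    refine this.congr_deriv ?_
    simp
  refine (h1.sqrt h0).congr_deriv ?_
  rw [depsFn, eps]
  have : Real.sqrt (1 + y ^ 2 + 2 * y * Real.cos k) ≠ 0 := hp.ne'
  field_simp

lemma hasDerivAt_depsFn (hk : k ∈ Ioo 0 Real.pi) (y : ℝ) :
    HasDerivAt (fun y => depsFn y k) (curv y k) y := by
  have hp := eps_pos (x := y) hk
  refine (((hasDerivAt_id y).add_const (Real.cos k)).div (hasDerivAt_eps hk y) hp.ne').congr_deriv ?_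
  have := eps_sq_eq y k
  rw [depsFn, curv]
  simp only [id]
  field_simp
  linarith

lemma abs_depsFn_le (y k : ℝ) : |depsFn y k| ≤ 1 := by
  rw [depsFn, abs_div, abs_of_nonneg (eps_nonneg y k)]
  refine div_le_one_of_le₀ (abs_le_of_sq_le_sq ?_ (eps_nonneg y k)) (eps_nonneg y k)
  rw [eps_sq_eq]
  nlinarith [sq_nonneg (Real.sin k)]

lemma measurable_depsFn (x : ℝ) : Measurable (depsFn x) :=
  (by fun_prop : Measurable fun k => x + Real.cos k).div (continuous_eps x).measurable

lemma measurable_curv (x : ℝ) : Measurable (curv x) :=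
  (by fun_prop : Measurable fun k => Real.sin k ^ 2).div ((continuous_eps x).measurable.pow_const 3)

lemma curv_nonneg (x k : ℝ) : 0 ≤ curv x k := by
  have := eps_nonneg x k
  unfold curv; positivity

lemma integral_momentum (f : ℝ → ℝ) : ∫ k in (0 : ℝ)..Real.pi, f k = ∫ k, f k ∂momentum := by
  rw [intervalIntegral.integral_of_le Real.pi_pos.le, integral_Ioc_eq_integral_Ioo, momentum]

lemma energy_eq (ν : ℝ → ℝ) (h lam x : ℝ) : energy ν h lam x =
    -(1 / Real.pi) * (∫ k, eps x k * gap ν k ∂momentum) - (x - h) ^ 2 / (4 * lam) := by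
  rw [energy, integral_momentum]
  rfl

lemma integrable_mul_gap (hν : Measurable ν) (hb : BoundedDensity ν) {f : ℝ → ℝ}
    (hf : Measurable f) {C : ℝ} (hC : ∀ k, |f k| ≤ C) :
    Integrable (fun k => f k * gap ν k) momentum := by
  refine Integrable.mono' (integrable_const C) (hf.mul (measurable_gap hν)).aestronglyMeasurable ?_
  filter_upwards [ae_mem_momentum] with k hk
  rw [norm_mul, Real.norm_eq_abs, Real.norm_of_nonneg (gap_nonneg hb hk)]
  have := gap_le_one hb hk
  have := gap_nonneg hb hk
  have := hC k
  have := abs_nonneg (f k)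
  nlinarith

lemma integrable_eps_gap (hν : Measurable ν) (hb : BoundedDensity ν) (x : ℝ) :
    Integrable (fun k => eps x k * gap ν k) momentum :=
  integrable_mul_gap hν hb (continuous_eps x).measurable fun k => by
    rw [abs_of_nonneg (eps_nonneg x k)]; exact eps_le x k

lemma integrable_deps_gap (hν : Measurable ν) (hb : BoundedDensity ν) (x : ℝ) :
    Integrable (fun k => depsFn x k * gap ν k) momentum :=
  integrable_mul_gap hν hb (measurable_depsFn x) (abs_depsFn_le x)

lemma hasDerivAt_energy (hν : Measurable ν) (hb : BoundedDensity ν) (h lam y : ℝ) :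
    HasDerivAt (energy ν h lam)
      (-(1 / Real.pi) * (∫ k, depsFn y k * gap ν k ∂momentum) - (y - h) / (2 * lam)) y := by
  have h1 := (hasDerivAt_integral_of_dominated_loc_of_deriv_le (μ := momentum) (bound := fun _ => 1)
    (F := fun y k => eps y k * gap ν k) (F' := fun y k => depsFn y k * gap ν k) (x₀ := y)
    (s := univ) univ_mem
    (Eventually.of_forall fun z => (integrable_eps_gap hν hb z).1) (integrable_eps_gap hν hb y)
    (integrable_deps_gap hν hb y).1 ?_ (integrable_const 1) ?_).2
  · have h2 : HasDerivAt (fun y : ℝ => (y - h) ^ 2 / (4 * lam)) ((y - h) / (2 * lam)) y := by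
      refine ((((hasDerivAt_id y).sub_const h).pow 2).div_const (4 * lam)).congr_deriv ?_
      simp only [id]
      rcases eq_or_ne lam 0 with rfl | hl
      · simp
      · field_simp
        ring
    have := (h1.const_mul (-(1 / Real.pi))).sub h2
    refine this.congr_of_eventuallyEq (Eventually.of_forall fun z => ?_)
    exact energy_eq ν h lam z
  · filter_upwards [ae_mem_momentum] with k hk z _
    rw [norm_mul, Real.norm_eq_abs, Real.norm_of_nonneg (gap_nonneg hb hk)]
    exact mul_le_one₀ (abs_depsFn_le z k) (gap_nonneg hb hk) (gap_le_one hb hk)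
  · filter_upwards [ae_mem_momentum] with k hk z _
    exact (hasDerivAt_eps hk z).mul_const _

lemma integral_deps_of_meanField (hlam : lam ≠ 0) (hx : MeanField ν h lam x) :
    ∫ k, depsFn x k * gap ν k ∂momentum = Real.pi * (h - x) / (2 * lam) := by
  rw [MeanField, integral_momentum] at hx
  have : ∫ k, deriv (fun y => eps y k) x * (1 - 4 * Real.pi * ν k) ∂momentum =
      ∫ k, depsFn x k * gap ν k ∂momentum := by
    refine integral_congr_ae ?_
    filter_upwards [ae_mem_momentum] with k hk
    rw [(hasDerivAt_eps hk x).deriv]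
    rfl
  rw [this] at hx
  have := Real.pi_pos
  rw [← hx]
  field_simp
  ring

lemma deriv_energy_eq_zero (hν : Measurable ν) (hb : BoundedDensity ν) (hlam : lam ≠ 0)
    (hx : MeanField ν h lam x) : deriv (energy ν h lam) x = 0 := by
  rw [(hasDerivAt_energy hν hb h lam x).deriv, integral_deps_of_meanField hlam hx]
  have := Real.pi_pos
  field_simp
  ring

/-- The gap between the dispersion and its tangent line. -/
lemma eps_sub_tangent (hk : k ∈ Ioo 0 Real.pi) (x y : ℝ) :
    0 < eps x k * eps y k + (x + Real.cos k) * (y + Real.cos k) + Real.sin k ^ 2 ∧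
    eps y k - eps x k - (y - x) * depsFn x k = (y - x) ^ 2 * (Real.sin k ^ 2 /
      (eps x k * (eps x k * eps y k + (x + Real.cos k) * (y + Real.cos k) + Real.sin k ^ 2))) := by
  have hs := sin_pos_of_mem hk
  have hx := eps_pos (x := x) hk
  have hy := eps_pos (x := y) hk
  have ex := eps_sq_eq x k
  have ey := eps_sq_eq y k
  set u := x + Real.cos k with hu
  set v := y + Real.cos k with hv
  set s := Real.sin k with hs'
  have hxy : y - x = v - u := by rw [hu, hv]; ring
  have hpos : 0 < eps x k * eps y k + u * v + s ^ 2 := by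
    have h1 : |u * v| ≤ eps x k * eps y k := by
      refine abs_le_of_sq_le_sq ?_ (by positivity)
      rw [mul_pow, mul_pow, ex, ey]
      nlinarith [sq_nonneg (u * s), sq_nonneg (v * s), sq_nonneg (s * s)]
    have := neg_abs_le (u * v)
    have : 0 < s ^ 2 := by positivity
    linarith
  refine ⟨hpos, ?_⟩
  rw [depsFn, ← hu, hxy]
  -- Lagrange's identity for the plane vectors `(u, s)` and `(v, s)`, whose lengths are `eps x k`
  -- and `eps y k`.
  have e : (eps x k * eps y k) ^ 2 - (u * v + s ^ 2) ^ 2 = (v - u) ^ 2 * s ^ 2 := by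
    rw [mul_pow, ex, ey]; ring
  have e2 : eps y k - eps x k - (v - u) * (u / eps x k) =
      (eps x k * eps y k - (u * v + s ^ 2)) / eps x k := by
    rw [eq_div_iff hx.ne']
    field_simp
    linear_combination -ex
  rw [e2, ← mul_div_assoc, div_eq_div_iff hx.ne' (by positivity), ← e]
  ring

/-- For positive coupling every solution of the mean-field equation is a global maximum. -/
lemma energy_le_of_meanField (hν : Measurable ν) (hb : BoundedDensity ν) (hlam : 0 < lam)
    (hx : MeanField ν h lam x) (y : ℝ) : energy ν h lam y ≤ energy ν h lam x := by
  have h1 : ∫ k, eps x k * gap ν k ∂momentum + (y - x) * ∫ k, depsFn x k * gap ν k ∂momentum ≤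
      ∫ k, eps y k * gap ν k ∂momentum := by
    rw [← integral_const_mul, ← integral_add (integrable_eps_gap hν hb x)
      ((integrable_deps_gap hν hb x).const_mul _)]
    refine integral_mono_ae ((integrable_eps_gap hν hb x).add
      ((integrable_deps_gap hν hb x).const_mul _)) (integrable_eps_gap hν hb y) ?_
    filter_upwards [ae_mem_momentum] with k hk
    obtain ⟨hp, ht⟩ := eps_sub_tangent hk x y
    have h2 : 0 ≤ eps y k - eps x k - (y - x) * depsFn x k := by
      rw [ht]
      have := eps_nonneg x k
      positivity
    have := mul_nonneg h2 (gap_nonneg hb hk)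
    linarith
  rw [integral_deps_of_meanField hlam.ne' hx] at h1
  have hpi := Real.pi_pos
  have h2 := mul_le_mul_of_nonneg_left h1 (by positivity : 0 ≤ 1 / Real.pi)
  have e : 1 / Real.pi * (∫ k, eps x k * gap ν k ∂momentum +
      (y - x) * (Real.pi * (h - x) / (2 * lam))) = 1 / Real.pi * (∫ k, eps x k * gap ν k ∂momentum)
      + (y - x) * (h - x) / (2 * lam) := by field_simp
  rw [e] at h2
  rw [energy_eq, energy_eq]
  have e2 : (x - h) ^ 2 / (4 * lam) - (y - h) ^ 2 / (4 * lam) =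
      (y - x) * (h - x) / (2 * lam) - (y - x) ^ 2 / (4 * lam) := by
    field_simp; ring
  have : 0 ≤ (y - x) ^ 2 / (4 * lam) := by positivity
  linarith

/-- `ε_y(k)²` is a convex combination of `(y + 1)²` and `(y - 1)²`, with weights `(1 ± cos k)/2`
independent of `y`. Uniformity in `k` thus follows from two scalar comparisons, even at `x = ±1`. -/
lemma eventually_half_eps_le (x : ℝ) : ∃ s ∈ 𝓝 x, ∀ y ∈ s, ∀ k, eps x k ≤ 2 * eps y k := by
  have key : ∀ c : ℝ, ∀ᶠ y in 𝓝 x, (x + c) ^ 2 ≤ 4 * (y + c) ^ 2 := by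
    intro c
    rcases eq_or_ne (x + c) 0 with h0 | h0
    · rw [h0]
      exact Eventually.of_forall fun y =>
        le_trans (by norm_num) (by positivity : (0 : ℝ) ≤ 4 * (y + c) ^ 2)
    · have hc : ContinuousAt (fun y => 4 * (y + c) ^ 2) x := by fun_prop
      have : (x + c) ^ 2 < 4 * (x + c) ^ 2 := by
        have : 0 < (x + c) ^ 2 := by positivity
        linarith
      exact (hc.eventually (lt_mem_nhds this)).mono fun y hy => hy.le
  refine ⟨_, (key 1).and (key (-1)), fun y hy k => ?_⟩
  obtain ⟨h1, h2⟩ := hy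
  refine abs_le_of_sq_le_sq' ?_ (by have := eps_nonneg y k; positivity) |>.2
  rw [mul_pow, eps_sq_eq, eps_sq_eq]
  have e : ∀ z : ℝ, (z + Real.cos k) ^ 2 + Real.sin k ^ 2 =
      (1 + Real.cos k) / 2 * (z + 1) ^ 2 + (1 - Real.cos k) / 2 * (z + -1) ^ 2 := by
    intro z; nlinarith [Real.sin_sq_add_cos_sq k]
  rw [e, e]
  have := mul_le_mul_of_nonneg_left h1 (by linarith [Real.neg_one_le_cos k] : 0 ≤ (1 + Real.cos k) / 2)
  have := mul_le_mul_of_nonneg_left h2 (by linarith [Real.cos_le_one k] : 0 ≤ (1 - Real.cos k) / 2)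
  linarith

lemma hasDerivAt_deriv_energy (hν : Measurable ν) (hb : BoundedDensity ν) (h lam : ℝ)
    (hI : Integrable (fun k => curv x k * gap ν k) momentum) :
    HasDerivAt (deriv (energy ν h lam))
      (-(1 / Real.pi) * (∫ k, curv x k * gap ν k ∂momentum) - 1 / (2 * lam)) x := by
  obtain ⟨s, hs, hle⟩ := eventually_half_eps_le x
  -- The factor `8 = 2³` comes from `eps x ≤ 2 * eps y` and the cube in the denominator of `curv`.
  have h1 := (hasDerivAt_integral_of_dominated_loc_of_deriv_le (μ := momentum)
    (bound := fun k => 8 * (curv x k * gap ν k))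
    (F := fun y k => depsFn y k * gap ν k) (F' := fun y k => curv y k * gap ν k) (x₀ := x)
    (s := s) hs
    (Eventually.of_forall fun z => (integrable_deps_gap hν hb z).1) (integrable_deps_gap hν hb x)
    hI.1 ?_ (hI.const_mul 8) ?_).2
  · have h2 : HasDerivAt (fun y : ℝ => (y - h) / (2 * lam)) (1 / (2 * lam)) x :=
      ((hasDerivAt_id x).sub_const h).div_const (2 * lam)
    refine ((h1.const_mul (-(1 / Real.pi))).sub h2).congr_of_eventuallyEq
      (Eventually.of_forall fun z => ?_)
    exact (hasDerivAt_energy hν hb h lam z).deriv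
  · filter_upwards [ae_mem_momentum] with k hk z hz
    have hx := eps_pos (x := x) hk
    have hzp := eps_pos (x := z) hk
    rw [norm_mul, Real.norm_of_nonneg (curv_nonneg z k), Real.norm_of_nonneg (gap_nonneg hb hk),
      ← mul_assoc]
    refine mul_le_mul_of_nonneg_right ?_ (gap_nonneg hb hk)
    rw [curv, curv, ← mul_div_assoc, div_le_div_iff₀ (by positivity) (by positivity)]
    have : eps x k ^ 3 ≤ (2 * eps z k) ^ 3 := pow_le_pow_left₀ hx.le (hle z hz k) 3
    nlinarith [sq_nonneg (Real.sin k)]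
  · filter_upwards [ae_mem_momentum] with k hk z _
    exact (hasDerivAt_depsFn hk z).mul_const _

lemma isLocalMin_energy (hν : Measurable ν) (hb : BoundedDensity ν) (hlam : lam < 0)
    (hx : MeanField ν h lam x) (hI : Integrable (fun k => curv x k * gap ν k) momentum)
    (hΔ : 0 < 1 + 2 * lam / Real.pi * ∫ k, curv x k * gap ν k ∂momentum) :
    IsLocalMin (energy ν h lam) x := by
  refine isLocalMin_of_deriv_deriv_pos ?_ (deriv_energy_eq_zero hν hb hlam.ne hx)
    (hasDerivAt_energy hν hb h lam x).continuousAt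
  rw [(hasDerivAt_deriv_energy hν hb h lam hI).deriv]
  have hpi := Real.pi_pos
  have e : -(1 / Real.pi) * (∫ k, curv x k * gap ν k ∂momentum) - 1 / (2 * lam) =
      (1 + 2 * lam / Real.pi * ∫ k, curv x k * gap ν k ∂momentum) * (-1 / (2 * lam)) := by
    have := hlam.ne
    field_simp
    ring
  rw [e]
  exact mul_pos hΔ (div_pos_of_neg_of_neg (by norm_num) (by linarith))

/-- At a local minimum the second variation is finite and non-negative. -/
lemma integrable_of_isLocalMin (hν : Measurable ν) (hb : BoundedDensity ν) (hlam : lam < 0)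
    (hx : MeanField ν h lam x) (hmin : IsLocalMin (energy ν h lam) x) :
    Integrable (fun k => curv x k * gap ν k) momentum ∧
      0 ≤ 1 + 2 * lam / Real.pi * ∫ k, curv x k * gap ν k ∂momentum := by
  set den : ℝ → ℝ → ℝ := fun y k =>
    eps x k * eps y k + (x + Real.cos k) * (y + Real.cos k) + Real.sin k ^ 2 with hden
  set Q : ℝ → ℝ → ℝ := fun y k => Real.sin k ^ 2 / (eps x k * den y k) * gap ν k with hQ
  have hQm : ∀ y, Measurable (Q y) := by
    intro y
    have h1 := (continuous_eps x).measurable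
    have h2 := (continuous_eps y).measurable
    have h3 := measurable_gap hν
    simp only [hQ, hden]
    fun_prop
  have hQ0 : ∀ y, ∀ᵐ k ∂momentum, 0 ≤ Q y k := by
    intro y
    filter_upwards [ae_mem_momentum] with k hk
    have h1 := (eps_sub_tangent hk x y).1
    have h2 := eps_nonneg x k
    have h3 := gap_nonneg hb hk
    simp only [hQ, hden]
    positivity
  have hpi := Real.pi_pos
  -- First-order terms cancel by the mean-field equation. Minimality therefore compares the
  -- second-order remainder `(y - x)² ∫ Q y` of the dispersion with the quadratic term `(y -
  -- x)²·π/(4|λ|)`.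
  have hbound : ∀ᶠ y in 𝓝[≠] x, ∫⁻ k, ENNReal.ofReal (Q y k) ∂momentum ≤
      ENNReal.ofReal (Real.pi / (4 * -lam)) := by
    filter_upwards [hmin.filter_mono nhdsWithin_le_nhds, self_mem_nhdsWithin] with y hy hne
    have hne' : y - x ≠ 0 := sub_ne_zero.mpr hne
    have hpos : 0 < (y - x) ^ 2 := by positivity
    have hint : Integrable (fun k => (eps y k * gap ν k - eps x k * gap ν k)
        - (y - x) * (depsFn x k * gap ν k)) momentum :=
      ((integrable_eps_gap hν hb y).sub (integrable_eps_gap hν hb x)).sub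
        ((integrable_deps_gap hν hb x).const_mul _)
    have heq : (fun k => (eps y k * gap ν k - eps x k * gap ν k)
        - (y - x) * (depsFn x k * gap ν k)) =ᵐ[momentum] fun k => (y - x) ^ 2 * Q y k := by
      filter_upwards [ae_mem_momentum] with k hk
      have := (eps_sub_tangent hk x y).2
      simp only [hQ, hden]
      linear_combination gap ν k * this
    have hQi : Integrable (Q y) momentum := by
      refine ((hint.congr heq).const_mul ((y - x) ^ 2)⁻¹).congr (Eventually.of_forall fun k => ?_)
      simp only
      rw [inv_mul_cancel_left₀ hpos.ne']
    rw [← ofReal_integral_eq_lintegral_ofReal hQi (hQ0 y)]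
    refine ENNReal.ofReal_le_ofReal ?_
    have h1 := integral_congr_ae heq
    rw [integral_const_mul, integral_sub (f := fun k => eps y k * gap ν k - eps x k * gap ν k)
      ((integrable_eps_gap hν hb y).sub (integrable_eps_gap hν hb x)) ((integrable_deps_gap hν hb x).const_mul _),
      integral_sub (integrable_eps_gap hν hb y) (integrable_eps_gap hν hb x),
      integral_const_mul, integral_deps_of_meanField hlam.ne hx] at h1
    rw [energy_eq, energy_eq] at hy
    set A := ∫ k, eps y k * gap ν k ∂momentum
    set B := ∫ k, eps x k * gap ν k ∂momentum
    have hl : 0 < -lam := by linarith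
    have h2 : (A - B) ≤ Real.pi * ((x - h) ^ 2 / (4 * lam) - (y - h) ^ 2 / (4 * lam)) := by
      have := mul_le_mul_of_nonneg_left hy hpi.le
      have e1 : Real.pi * (-(1 / Real.pi) * B - (x - h) ^ 2 / (4 * lam)) =
        -B - Real.pi * ((x - h) ^ 2 / (4 * lam)) := by field_simp
      have e2 : Real.pi * (-(1 / Real.pi) * A - (y - h) ^ 2 / (4 * lam)) =
        -A - Real.pi * ((y - h) ^ 2 / (4 * lam)) := by field_simp
      rw [e1, e2] at this
      linarith
    have h3 : Real.pi * ((x - h) ^ 2 / (4 * lam) - (y - h) ^ 2 / (4 * lam)) -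
        (y - x) * (Real.pi * (h - x) / (2 * lam)) = (y - x) ^ 2 * (Real.pi / (4 * -lam)) := by
      have := hlam.ne
      field_simp
      ring
    have h4 : (y - x) ^ 2 * ∫ k, Q y k ∂momentum ≤ (y - x) ^ 2 * (Real.pi / (4 * -lam)) := by
      linarith
    exact le_of_mul_le_mul_left h4 hpos
  have hlim : ∀ᵐ k ∂momentum, Tendsto (fun y => ENNReal.ofReal (Q y k)) (𝓝[≠] x)
      (𝓝 (ENNReal.ofReal (curv x k * gap ν k / 2))) := by
    filter_upwards [ae_mem_momentum] with k hk
    refine (ENNReal.continuous_ofReal.tendsto _).comp ?_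
    have hp := eps_pos (x := x) hk
    have hd : den x k = 2 * eps x k ^ 2 := by
      simp only [hden]; rw [eps_sq_eq, ← sq, eps_sq_eq]; ring
    have hc : ContinuousAt (fun y => Q y k) x := by
      have h1 : ContinuousAt (fun y => eps y k) x := (hasDerivAt_eps hk x).continuousAt
      have h2 : ContinuousAt (fun y => den y k) x := by simp only [hden]; fun_prop
      have h3 : eps x k * den x k ≠ 0 := by rw [hd]; positivity
      exact (continuousAt_const.div (continuousAt_const.mul h2) h3).mul continuousAt_const
    have e : curv x k * gap ν k / 2 = Q x k := by
      simp only [hQ, hd, curv]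
      field_simp
    rw [e]
    exact hc.tendsto.mono_left nhdsWithin_le_nhds
  -- The remainder `Q y` tends to `curv·gap/2`. Integrability of the limit is a conclusion, not a
  -- triviality: for `|x| = 1`, `curv` behaves like an inverse distance at one endpoint.
  have hfatou : ∫⁻ k, ENNReal.ofReal (curv x k * gap ν k / 2) ∂momentum ≤
      ENNReal.ofReal (Real.pi / (4 * -lam)) := by
    calc _ = ∫⁻ k, liminf (fun y => ENNReal.ofReal (Q y k)) (𝓝[≠] x) ∂momentum := by
          refine lintegral_congr_ae ?_
          filter_upwards [hlim] with k hk using hk.liminf_eq.symm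
      _ ≤ liminf (fun y => ∫⁻ k, ENNReal.ofReal (Q y k) ∂momentum) (𝓝[≠] x) :=
          lintegral_liminf_le' (fun y => (hQm y).ennreal_ofReal.aemeasurable)
      _ ≤ _ := by
          refine Filter.liminf_le_of_le ?_ ?_
          · isBoundedDefault
          · intro b hb'
            obtain ⟨y, h1, h2⟩ := (hb'.and hbound).exists
            exact h1.trans h2
  have hnn : 0 ≤ᵐ[momentum] fun k => curv x k * gap ν k / 2 := by
    filter_upwards [ae_mem_momentum] with k hk
    have := mul_nonneg (curv_nonneg x k) (gap_nonneg hb hk)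
    simp only [Pi.zero_apply]
    positivity
  have hint : Integrable (fun k => curv x k * gap ν k / 2) momentum := by
    refine ⟨(((measurable_curv x).mul (measurable_gap hν)).div_const 2).aestronglyMeasurable, ?_⟩
    rw [hasFiniteIntegral_iff_ofReal hnn]
    exact hfatou.trans_lt ENNReal.ofReal_lt_top
  have hl : 0 < -lam := by linarith
  rw [← ofReal_integral_eq_lintegral_ofReal hint hnn,
    ENNReal.ofReal_le_ofReal_iff (by positivity), integral_div] at hfatou
  refine ⟨(hint.mul_const 2).congr (Eventually.of_forall fun k => by simp), ?_⟩
  set I := ∫ k, curv x k * gap ν k ∂momentum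
  rw [div_le_div_iff₀ (by norm_num) (by positivity)] at hfatou
  have e : 1 + 2 * lam / Real.pi * I = (Real.pi + 2 * lam * I) / Real.pi := by field_simp
  rw [e]
  refine div_nonneg ?_ hpi.le
  nlinarith

end Energy

/-! ### The canonical solution of the Riccati equation. -/

section Existence

variable {ν : ℝ → ℝ} {h lam x y k : ℝ}

/-- The weight `|wt| (1 - 4πν)` governing the scalar form of the Riccati equation. -/
def gapWt (ν : ℝ → ℝ) (x k : ℝ) : ℝ := absWt x k * gap ν k

lemma measurable_gapWt (hν : Measurable ν) (x : ℝ) : Measurable (gapWt ν x) :=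
  (measurable_absWt x).mul (measurable_gap hν)

lemma ae_gapWt_nonneg (hb : BoundedDensity ν) (x : ℝ) : ∀ᵐ k ∂momentum, 0 ≤ gapWt ν x k := by
  filter_upwards [ae_mem_momentum] with k hk
    using mul_nonneg (absWt_nonneg x k) (gap_nonneg hb hk)

lemma ae_gapWt_pos (hgap : ∀ᵐ k ∂momentum, 0 < gap ν k) (x : ℝ) :
    ∀ᵐ k ∂momentum, 0 < gapWt ν x k := by
  filter_upwards [ae_mem_momentum, hgap] with k hk h using mul_pos (absWt_pos hk) h

lemma integrable_absWt (x : ℝ) : Integrable (absWt x) momentum := by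
  refine Integrable.mono' (integrable_const 1) (measurable_absWt x).aestronglyMeasurable ?_
  filter_upwards [ae_mem_momentum] with k hk
  rw [Real.norm_of_nonneg (absWt_nonneg x k)]
  exact absWt_le_one hk

lemma integrable_gapWt (hν : Measurable ν) (hb : BoundedDensity ν) (x : ℝ) :
    Integrable (gapWt ν x) momentum := by
  refine (integrable_absWt x).mono' (measurable_gapWt hν x).aestronglyMeasurable ?_
  filter_upwards [ae_mem_momentum, ae_gapWt_nonneg hb x] with k hk h
  rw [Real.norm_of_nonneg h]
  exact mul_le_of_le_one_right (absWt_nonneg x k) (gap_le_one hb hk)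

lemma ae_freq_pos (x : ℝ) : ∀ᵐ k ∂momentum, 0 < freq x k := by
  filter_upwards [ae_mem_momentum] with k hk using freq_pos hk

lemma gapWt_div_freq_sq (ν : ℝ → ℝ) (x : ℝ) : ∀ᵐ k ∂momentum,
    gapWt ν x k / freq x k ^ 2 = 1 / (8 * Real.pi ^ 2) * (curv x k * gap ν k) := by
  filter_upwards [ae_mem_momentum] with k hk
  have := eps_pos (x := x) hk
  have := Real.pi_pos
  rw [gapWt, absWt, freq, curv]
  field_simp
  ring

lemma integrable_gapWt_div_iff : Integrable (fun k => gapWt ν x k / freq x k ^ 2) momentum ↔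
    Integrable (fun k => curv x k * gap ν k) momentum := by
  have hpi := Real.pi_pos
  rw [integrable_congr (gapWt_div_freq_sq ν x)]
  exact integrable_const_mul_iff (IsUnit.mk0 _ (by positivity)) _

/-- The link between operator and energy: the determinant at `t = 0` equals `-2λ` times the second
derivative of the energy, when the integral converges. -/
lemma det_zero_eq (ν : ℝ → ℝ) (lam x : ℝ) :
    1 + 16 * Real.pi * lam * ∫ k, gapWt ν x k / freq x k ^ 2 ∂momentum =
      1 + 2 * lam / Real.pi * ∫ k, curv x k * gap ν k ∂momentum := by
  have hpi := Real.pi_pos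
  rw [integral_congr_ae (gapWt_div_freq_sq ν x), integral_const_mul]
  field_simp
  ring

/-- The regular part of the canonical solution. -/
def solReg (ν : ℝ → ℝ) (lam x : ℝ) (P Q : Mode) : ℝ :=
  -rootKernel momentum (gapWt ν x) (freq x) (16 * Real.pi * lam) (freq x P.1) (freq x Q.1)

/-- The Dirac part of the canonical solution. -/
def solDia (ν : ℝ → ℝ) (x k : ℝ) (s t : Bool) : ℝ :=
  -(2 * freq x k / gapWt ν x k) * (if s && t then frac ν k false / frac ν k true else 1)

/-- The canonical solution of the Riccati equation. -/
def solKernel (ν : ℝ → ℝ) (lam x : ℝ) : DKernel where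
  dia k s t := (solDia ν x k s t : ℂ)
  reg P Q := (solReg ν lam x P Q : ℂ)

/-- The role of the Dirac part: applied to a function that ignores the branch, it replaces the
signed coefficient `s·freq` by `+freq`. On the branch-independent regular part only these weighted
row sums matter, and the equation becomes scalar with positive frequencies. -/
lemma solDia_sum (hb : BoundedDensity ν) (hk : k ∈ Ioo 0 Real.pi) (hg : 0 < gap ν k) (s : Bool) :
    ∑ r, solDia ν x k s r * (frac ν k r * wt x (k, r)) =
      branchSign s * freq x k - freq x k := by
  have hp : 0 < frac ν k true := lt_of_lt_of_le (by norm_num) (half_le_frac_true hb hk)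
  have hW := absWt_pos (x := x) hk
  have h1 := frac_sum (ν := ν) k
  have h2 := frac_sub (ν := ν) k
  cases s
  · simp only [Fintype.sum_bool, solDia, wt_eq hk, gapWt]
    simp
    field_simp
    rw [← h2]
    ring
  · simp only [Fintype.sum_bool, solDia, wt_eq hk, gapWt]
    simp
    field_simp
    ring

lemma solDia_comm (s t : Bool) : solDia ν x k s t = solDia ν x k t s := by
  simp only [solDia, Bool.and_comm]

lemma solDia_riccati (hb : BoundedDensity ν) (hk : k ∈ Ioo 0 Real.pi) (hg : 0 < gap ν k)
    (s t : Bool) : solDia ν x k s t * (lin x (k, s) + lin x (k, t)) - 1 / Real.pi *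
      ∑ r, solDia ν x k s r * (frac ν k r * wt x (k, r)) * solDia ν x k r t = 0 := by
  have hp : 0 < frac ν k true := lt_of_lt_of_le (by norm_num) (half_le_frac_true hb hk)
  have hW := absWt_pos (x := x) hk
  have he := eps_pos (x := x) hk
  have h1 := frac_sum (ν := ν) k
  have h2 := frac_sub (ν := ν) k
  have hpi := Real.pi_pos
  have hn : frac ν k false = frac ν k true - gap ν k := by linarith
  simp only [Fintype.sum_bool, solDia, wt_eq hk, lin_eq hk, gapWt, freq, hn]
  cases s <;> cases t <;> simp <;> field_simp <;> ring

lemma measurable_solReg (hν : Measurable ν) (lam x : ℝ) :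
    Measurable fun z : Mode × Mode => solReg ν lam x z.1 z.2 := by
  have h1 : Measurable fun z : Mode × Mode => freq x z.1.1 := (measurable_freq x).comp (by fun_prop)
  have h2 : Measurable fun z : Mode × Mode => freq x z.2.1 := (measurable_freq x).comp (by fun_prop)
  have := (measurable_rootKernel (μ := momentum) (g := 16 * Real.pi * lam)
    (measurable_gapWt hν x) (measurable_freq x)).comp (h1.prodMk h2)
  exact this.neg

/-- The determinant of the mean-field second variation stays away from zero. -/
def DetBound (ν : ℝ → ℝ) (lam x δ : ℝ) : Prop := 0 < δ ∧
  ∀ t, 0 < t → δ ≤ pertDet momentum (gapWt ν x) (freq x) (16 * Real.pi * lam) t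

lemma abs_solReg_le {δ : ℝ} (hδ : DetBound ν lam x δ) {P Q : Mode} (hP : P.1 ∈ Ioo 0 Real.pi)
    (hQ : Q.1 ∈ Ioo 0 Real.pi) :
    |solReg ν lam x P Q| ≤ |16 * Real.pi * lam| / δ / (freq x P.1 + freq x Q.1) := by
  rw [solReg, abs_neg]
  exact abs_rootKernel_le hδ.1 hδ.2 (freq_pos hP) (freq_pos hQ)

/-- This makes `1/(freq + freq)` bounded once the square roots of the weights are absorbed,
including near an endpoint where `freq` tends to zero. -/
lemma sqrt_wt_le {k q : ℝ} (hk : k ∈ Ioo 0 Real.pi) (hq : q ∈ Ioo 0 Real.pi) :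
    √(absWt x k) * √(absWt x q) ≤ freq x k + freq x q := by
  rw [← Real.sqrt_mul (absWt_nonneg x k)]
  have h1 := freq_pos (x := x) hk
  have h2 := freq_pos (x := x) hq
  refine Real.sqrt_le_iff.mpr ⟨by positivity, ?_⟩
  have := mul_le_mul (absWt_le_freq (x := x) hk) (absWt_le_freq (x := x) hq) (absWt_nonneg x q) h1.le
  nlinarith

lemma admissible_solKernel (hν : Measurable ν) (hb : BoundedDensity ν) {δ : ℝ}
    (hδ : DetBound ν lam x δ) : (solKernel ν lam x).Admissible ν x where
  measurable_dia s t := by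
    have h1 := measurable_freq x
    have h2 := measurable_gapWt hν x
    have h3 := measurable_frac hν true
    have h4 := measurable_frac hν false
    have : Measurable fun k => solDia ν x k s t := by
      unfold solDia
      refine Measurable.mul (by fun_prop) ?_
      by_cases hst : (s && t) = true
      · simp only [hst, if_true]; fun_prop
      · simp only [hst, Bool.false_eq_true, if_false]; fun_prop
    exact Complex.measurable_ofReal.comp this
  measurable_reg := Complex.measurable_ofReal.comp (measurable_solReg hν lam x)
  symm_dia k s t := by simp only [solKernel, solDia_comm]
  symm_reg P Q := by simp only [solKernel, solReg]; rw [rootKernel_comm]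
  sq_integrable := by
    rw [integrable_modes_prod_iff hν hb]
    intro s t
    have hm1 := measurable_solReg hν lam x
    have hfr := measurable_frac hν
    have hm : Measurable fun z : ℝ × ℝ => (frac ν z.1 s * frac ν z.2 t) *
        (|solReg ν lam x (z.1, s) (z.2, t)| ^ 2 * absWt x z.1 * absWt x z.2) := by
      have h1 := hm1.comp (measurable_modePair s t)
      have h2 : Measurable fun z : ℝ × ℝ => frac ν z.1 s := (hfr s).comp measurable_fst
      have h3 : Measurable fun z : ℝ × ℝ => frac ν z.2 t := (hfr t).comp measurable_snd
      have h4 : Measurable fun z : ℝ × ℝ => absWt x z.1 := (measurable_absWt x).comp measurable_fst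
      have h5 : Measurable fun z : ℝ × ℝ => absWt x z.2 := (measurable_absWt x).comp measurable_snd
      exact (h2.mul h3).mul (((h1.abs.pow_const 2).mul h4).mul h5)
    refine Integrable.congr (f := fun z : ℝ × ℝ => (frac ν z.1 s * frac ν z.2 t) *
        (|solReg ν lam x (z.1, s) (z.2, t)| ^ 2 * absWt x z.1 * absWt x z.2)) ?_ ?_
    · refine Integrable.mono' (integrable_const ((|16 * Real.pi * lam| / δ) ^ 2))
        hm.aestronglyMeasurable ?_
      filter_upwards [Measure.quasiMeasurePreserving_fst.ae ae_mem_momentum,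
        Measure.quasiMeasurePreserving_snd.ae ae_mem_momentum] with z h1 h2
      have hW1 := absWt_pos (x := x) h1
      have hW2 := absWt_pos (x := x) h2
      have f1 := frac_nonneg hb h1 s
      have f2 := frac_nonneg hb h2 t
      have hE1 := freq_pos (x := x) h1
      have hE2 := freq_pos (x := x) h2
      have hδ0 := hδ.1
      rw [Real.norm_of_nonneg (by positivity)]
      have hr := abs_solReg_le (P := (z.1, s)) (Q := (z.2, t)) hδ h1 h2
      have h3 : |solReg ν lam x (z.1, s) (z.2, t)| * (√(absWt x z.1) * √(absWt x z.2)) ≤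
          |16 * Real.pi * lam| / δ := by
        calc _ ≤ |16 * Real.pi * lam| / δ / (freq x z.1 + freq x z.2) *
              (freq x z.1 + freq x z.2) :=
            mul_le_mul hr (sqrt_wt_le h1 h2) (by positivity) (by positivity)
          _ = _ := by field_simp
      have h4 : |solReg ν lam x (z.1, s) (z.2, t)| ^ 2 * absWt x z.1 * absWt x z.2 ≤
          (|16 * Real.pi * lam| / δ) ^ 2 := by
        have := pow_le_pow_left₀ (by positivity) h3 2
        rw [mul_pow, mul_pow, Real.sq_sqrt hW1.le, Real.sq_sqrt hW2.le] at this
        linarith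
      refine le_trans ?_ h4
      exact mul_le_of_le_one_left (by positivity)
        (mul_le_one₀ (frac_le_one hb h1 s) f2 (frac_le_one hb h2 t))
    · filter_upwards [Measure.quasiMeasurePreserving_fst.ae ae_mem_momentum,
        Measure.quasiMeasurePreserving_snd.ae ae_mem_momentum] with z h1 h2
      simp only [solKernel, Complex.norm_real, Real.norm_eq_abs, wt_eq h1, wt_eq h2, abs_mul,
        abs_branchSign, one_mul, abs_of_nonneg (absWt_nonneg x _), smul_eq_mul]

/-- The regular part ignores the branch, so summing the signed weights `frac·wt` over branches
leaves `gapWt`, and `rootKernel_riccati` applies. -/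
lemma integral_solReg_comp (hν : Measurable ν) (hb : BoundedDensity ν) {δ : ℝ}
    (hδ : DetBound ν lam x δ) {P Q : Mode} (hP : P.1 ∈ Ioo 0 Real.pi)
    (hQ : Q.1 ∈ Ioo 0 Real.pi) :
    ∫ R, solReg ν lam x P R * wt x R * solReg ν lam x R Q ∂modes ν =
      16 * Real.pi * lam + (freq x P.1 + freq x Q.1) * solReg ν lam x P Q := by
  have hid := rootKernel_riccati (μ := momentum) (ω := gapWt ν x) (E := freq x)
    (g := 16 * Real.pi * lam) (measurable_gapWt hν x) (measurable_freq x)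
    (ae_gapWt_nonneg hb x) (integrable_gapWt hν hb x) (ae_freq_pos x) hδ.1 hδ.2
    (freq_pos (x := x) hP) (freq_pos (x := x) hQ)
  have hint : ∀ s, Integrable (fun k => frac ν k s • (solReg ν lam x P (k, s) * wt x (k, s) *
      solReg ν lam x (k, s) Q)) momentum := by
    intro s
    have hm : Measurable fun k => frac ν k s * (solReg ν lam x P (k, s) * absWt x k *
        solReg ν lam x (k, s) Q) := by
      have h1 : Measurable fun k => solReg ν lam x P (k, s) :=
        (measurable_solReg hν lam x).comp (f := fun k : ℝ => (P, (k, s))) (by fun_prop)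
      have h2 : Measurable fun k => solReg ν lam x (k, s) Q :=
        (measurable_solReg hν lam x).comp (f := fun k : ℝ => ((k, s), Q)) (by fun_prop)
      exact (measurable_frac hν s).mul ((h1.mul (measurable_absWt x)).mul h2)
    set A := |16 * Real.pi * lam| / δ / freq x P.1
    set B := |16 * Real.pi * lam| / δ / freq x Q.1
    have hδ0 := hδ.1
    have hEP := freq_pos (x := x) hP
    have hEQ := freq_pos (x := x) hQ
    refine Integrable.congr (f := fun k => branchSign s * (frac ν k s * (solReg ν lam x P (k, s) *
      absWt x k * solReg ν lam x (k, s) Q))) (Integrable.const_mul ?_ _) ?_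
    · refine Integrable.mono' (integrable_const (1 * (A * 1 * B))) hm.aestronglyMeasurable ?_
      filter_upwards [ae_mem_momentum] with k hk
      have hE := freq_pos (x := x) hk
      have h1 := abs_solReg_le (P := P) (Q := (k, s)) hδ hP hk
      have h2 := abs_solReg_le (P := (k, s)) (Q := Q) hδ hk hQ
      have h3 : |solReg ν lam x P (k, s)| ≤ A := by
        refine h1.trans ?_
        simp only [A]
        gcongr
        linarith
      have h4 : |solReg ν lam x (k, s) Q| ≤ B := by
        refine h2.trans ?_
        simp only [B]
        gcongr
        linarith
      rw [norm_mul, norm_mul, norm_mul, Real.norm_eq_abs, Real.norm_eq_abs, Real.norm_eq_abs,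
        Real.norm_eq_abs, abs_of_nonneg (frac_nonneg hb hk s), abs_of_nonneg (absWt_nonneg x k)]
      have := frac_le_one hb hk s
      have := absWt_le_one (x := x) hk
      have := absWt_nonneg x k
      gcongr
    · filter_upwards [ae_mem_momentum] with k hk
      rw [wt_eq hk, smul_eq_mul]
      ring
  rw [integral_modes hν hb hint]
  have e : ∀ᵐ k ∂momentum, ∑ s, frac ν k s • (solReg ν lam x P (k, s) * wt x (k, s) *
      solReg ν lam x (k, s) Q) = gapWt ν x k * rootKernel momentum (gapWt ν x) (freq x)
        (16 * Real.pi * lam) (freq x P.1) (freq x k) * rootKernel momentum (gapWt ν x) (freq x)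
        (16 * Real.pi * lam) (freq x k) (freq x Q.1) := by
    filter_upwards [ae_mem_momentum] with k hk
    simp only [Fintype.sum_bool, wt_eq hk, solReg, gapWt, smul_eq_mul, branchSign_true,
      branchSign_false]
    rw [← frac_sub]
    ring
  rw [integral_congr_ae e, solReg]
  linarith

lemma isSolution_solKernel (hν : Measurable ν) (hb : BoundedDensity ν)
    (hgap : ∀ᵐ k ∂momentum, 0 < gap ν k) {δ : ℝ} (hδ : DetBound ν lam x δ) :
    (solKernel ν lam x).IsSolution ν lam x := by
  refine ⟨admissible_solKernel hν hb hδ, ?_, ?_⟩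
  · filter_upwards [ae_mem_momentum, hgap] with k hk hg s t _ _
    have := solDia_riccati (x := x) hb hk hg s t
    simp only [DKernel.riccati, DKernel.comp, solKernel]
    rw [← Complex.ofReal_zero, ← this]
    push_cast
    ring
  · rw [ae_modes_prod_iff hν hb]
    intro s t
    filter_upwards [Measure.quasiMeasurePreserving_fst.ae ae_mem_momentum,
      Measure.quasiMeasurePreserving_snd.ae ae_mem_momentum,
      Measure.quasiMeasurePreserving_fst.ae hgap,
      Measure.quasiMeasurePreserving_snd.ae hgap] with z h1 h2 g1 g2 _ _
    have e1 := solDia_sum (x := x) hb h1 g1 s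
    have e2 := solDia_sum (x := x) hb h2 g2 t
    have e3 := integral_solReg_comp hν hb hδ (P := (z.1, s)) (Q := (z.2, t)) h1 h2
    have e4 : ∫ R, (solReg ν lam x (z.1, s) R : ℂ) * (wt x R : ℂ) * (solReg ν lam x R (z.2, t) : ℂ)
        ∂modes ν = ((∫ R, solReg ν lam x (z.1, s) R * wt x R * solReg ν lam x R (z.2, t)
        ∂modes ν : ℝ) : ℂ) := by
      rw [← integral_complex_ofReal]
      simp only [Complex.ofReal_mul]
    have e5 : ∑ r, (solDia ν x z.1 s r : ℂ) * ((frac ν z.1 r * wt x (z.1, r) : ℝ) : ℂ) *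
        (solReg ν lam x (z.1, r) (z.2, t) : ℂ) = ((branchSign s * freq x z.1 - freq x z.1 : ℝ) : ℂ)
        * (solReg ν lam x (z.1, s) (z.2, t) : ℂ) := by
      rw [← e1, Complex.ofReal_sum, Finset.sum_mul]
      refine Finset.sum_congr rfl fun r _ => ?_
      simp only [solReg]
      push_cast
      ring
    have e6 : ∑ r, (solReg ν lam x (z.1, s) (z.2, r) : ℂ) *
        ((frac ν z.2 r * wt x (z.2, r) : ℝ) : ℂ) * (solDia ν x z.2 r t : ℂ) =
        ((branchSign t * freq x z.2 - freq x z.2 : ℝ) : ℂ)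
        * (solReg ν lam x (z.1, s) (z.2, t) : ℂ) := by
      rw [← e2, Complex.ofReal_sum, Finset.sum_mul]
      refine Finset.sum_congr rfl fun r _ => ?_
      simp only [solReg, solDia_comm r t]
      push_cast
      ring
    simp only [DKernel.riccati, DKernel.comp, solKernel]
    rw [e4, e5, e6, e3, lin_eq h1, lin_eq h2]
    simp only [freq]
    have hpi : (Real.pi : ℂ) ≠ 0 := Complex.ofReal_ne_zero.mpr Real.pi_ne_zero
    push_cast
    field_simp
    ring

end Existence

/-! ### Positivity of the Hessian at the canonical solution. -/

section ExistencePos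

variable {ν : ℝ → ℝ} {h lam x y k : ℝ}

/-- The total of `u` over the branches at a momentum, weighted by the branch fractions. -/
def branchSum (ν : ℝ → ℝ) (u : Mode → ℝ) (k : ℝ) : ℝ := ∑ s, frac ν k s * u (k, s)

lemma measurable_branchSum (hν : Measurable ν) {u : Mode → ℝ} (hu : Measurable u) :
    Measurable (branchSum ν u) := by
  have h1 := measurable_frac hν
  unfold branchSum
  exact Finset.measurable_sum _ fun s _ => (h1 s).mul (hu.comp (by fun_prop))

/-- Completing squares separates the branch sum, the only quantity the regular part couples to, from
a non-negative term that controls the remaining direction. -/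
lemma hessianDia_solKernel (hb : BoundedDensity ν) (hk : k ∈ Ioo 0 Real.pi) (hg : 0 < gap ν k)
    (u : Mode → ℝ) : DKernel.hessianDia ν x (solKernel ν lam x) u k =
      2 * (freq x k * branchSum ν u k ^ 2 / gapWt ν x k) + 2 * freq x k / gapWt ν x k *
        (frac ν k true * frac ν k false * (u (k, true) + u (k, false)) ^ 2) := by
  have hp : 0 < frac ν k true := lt_of_lt_of_le (by norm_num) (half_le_frac_true hb hk)
  have hW := absWt_pos (x := x) hk
  have hE := freq_pos (x := x) hk
  have h1 := frac_sum (ν := ν) k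
  have h2 := frac_sub (ν := ν) k
  have hn : frac ν k false = (1 - gap ν k) / 2 := by linarith
  have hg' : frac ν k true = (1 + gap ν k) / 2 := by linarith
  have hg2 : 1 + gap ν k ≠ 0 := by linarith
  simp only [DKernel.hessianDia, Fintype.sum_bool, rhoStar_mul hk, solKernel, Complex.ofReal_re,
    solDia, branchSum, gapWt, hg', hn]
  simp
  field_simp
  ring

lemma integrable_frac_sq (hν : Measurable ν) (hb : BoundedDensity ν) {u : Mode → ℝ}
    (hui : Integrable (fun P => u P ^ 2 / |wt x P|) (modes ν)) (s : Bool) :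
    Integrable (fun k => frac ν k s * (u (k, s) ^ 2 / absWt x k)) momentum := by
  refine ((integrable_modes_iff hν hb).mp hui s).congr ?_
  filter_upwards [ae_mem_momentum] with k hk
  rw [wt_eq hk, abs_mul, abs_branchSign, one_mul, abs_of_nonneg (absWt_nonneg x k), smul_eq_mul]

lemma integrable_frac_abs (hν : Measurable ν) (hb : BoundedDensity ν) {u : Mode → ℝ}
    (hu : Measurable u)
    (hui : Integrable (fun P => u P ^ 2 / |wt x P|) (modes ν)) (s : Bool) :
    Integrable (fun k => frac ν k s * |u (k, s)| / √(absWt x k)) momentum := by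
  have h1 := (integrable_frac_sq hν hb hui s).add (integrable_const (1 : ℝ))
  have hm : Measurable fun k => frac ν k s * |u (k, s)| / √(absWt x k) := by
    have h1 := measurable_frac hν s
    have h2 := measurable_absWt x
    have h3 : Measurable fun k => u (k, s) := hu.comp (by fun_prop)
    fun_prop
  refine h1.mono' hm.aestronglyMeasurable ?_
  filter_upwards [ae_mem_momentum] with k hk
  have hW := absWt_pos (x := x) hk
  have f0 := frac_nonneg hb hk s
  have f1 := frac_le_one hb hk s
  rw [Real.norm_of_nonneg (by positivity), mul_div_assoc]
  simp only [Pi.add_apply]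
  have e : u (k, s) ^ 2 / absWt x k = (|u (k, s)| / √(absWt x k)) ^ 2 := by
    rw [div_pow, sq_abs, Real.sq_sqrt hW.le]
  rw [e]
  set r := |u (k, s)| / √(absWt x k)
  nlinarith [sq_nonneg (r - 1)]

lemma integrable_pair_div_freq (hν : Measurable ν) (hb : BoundedDensity ν) {u : Mode → ℝ}
    (hu : Measurable u) (hui : Integrable (fun P => u P ^ 2 / |wt x P|) (modes ν)) (s t : Bool) :
    Integrable (fun z : ℝ × ℝ => (frac ν z.1 s * |u (z.1, s)|) * (frac ν z.2 t * |u (z.2, t)|) /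
      (freq x z.1 + freq x z.2)) (momentum.prod momentum) := by
  have hm : Measurable fun z : ℝ × ℝ => (frac ν z.1 s * |u (z.1, s)|) *
      (frac ν z.2 t * |u (z.2, t)|) / (freq x z.1 + freq x z.2) := by
    have h1 : Measurable fun z : ℝ × ℝ => frac ν z.1 s := (measurable_frac hν s).comp measurable_fst
    have h2 : Measurable fun z : ℝ × ℝ => frac ν z.2 t := (measurable_frac hν t).comp measurable_snd
    have h3 : Measurable fun z : ℝ × ℝ => u (z.1, s) := hu.comp (by fun_prop)
    have h4 : Measurable fun z : ℝ × ℝ => u (z.2, t) := hu.comp (by fun_prop)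
    have h5 : Measurable fun z : ℝ × ℝ => freq x z.1 := (measurable_freq x).comp measurable_fst
    have h6 : Measurable fun z : ℝ × ℝ => freq x z.2 := (measurable_freq x).comp measurable_snd
    fun_prop
  refine ((integrable_frac_abs hν hb hu hui s).mul_prod
    (integrable_frac_abs hν hb hu hui t)).mono' hm.aestronglyMeasurable ?_
  filter_upwards [Measure.quasiMeasurePreserving_fst.ae ae_mem_momentum,
    Measure.quasiMeasurePreserving_snd.ae ae_mem_momentum] with z h1 h2
  have hW1 := absWt_pos (x := x) h1
  have hW2 := absWt_pos (x := x) h2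
  have f1 := frac_nonneg hb h1 s
  have f2 := frac_nonneg hb h2 t
  have hE1 := freq_pos (x := x) h1
  have hE2 := freq_pos (x := x) h2
  rw [Real.norm_of_nonneg (by positivity), div_mul_div_comm]
  gcongr
  exact sqrt_wt_le h1 h2

lemma integrable_branchSum_div (hν : Measurable ν) (hb : BoundedDensity ν) {u : Mode → ℝ}
    (hu : Measurable u) (hui : Integrable (fun P => u P ^ 2 / |wt x P|) (modes ν)) :
    Integrable (fun z : ℝ × ℝ => |branchSum ν u z.1| * |branchSum ν u z.2| /
      (freq x z.1 + freq x z.2)) (momentum.prod momentum) := by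
  have hβ := measurable_branchSum hν hu
  have hm : Measurable fun z : ℝ × ℝ => |branchSum ν u z.1| * |branchSum ν u z.2| /
      (freq x z.1 + freq x z.2) := by
    have h3 : Measurable fun z : ℝ × ℝ => branchSum ν u z.1 := hβ.comp measurable_fst
    have h4 : Measurable fun z : ℝ × ℝ => branchSum ν u z.2 := hβ.comp measurable_snd
    have h5 : Measurable fun z : ℝ × ℝ => freq x z.1 := (measurable_freq x).comp measurable_fst
    have h6 : Measurable fun z : ℝ × ℝ => freq x z.2 := (measurable_freq x).comp measurable_snd
    fun_prop
  have hi := integrable_finsetSum Finset.univ fun s _ => integrable_finsetSum Finset.univ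
    fun t _ => integrable_pair_div_freq hν hb hu hui s t
  refine hi.mono' hm.aestronglyMeasurable ?_
  filter_upwards [Measure.quasiMeasurePreserving_fst.ae ae_mem_momentum,
    Measure.quasiMeasurePreserving_snd.ae ae_mem_momentum] with z h1 h2
  have hE1 := freq_pos (x := x) h1
  have hE2 := freq_pos (x := x) h2
  have hbs : ∀ k ∈ Ioo 0 Real.pi, |branchSum ν u k| ≤ ∑ s, frac ν k s * |u (k, s)| := by
    intro k hk
    refine (Finset.abs_sum_le_sum_abs _ _).trans (le_of_eq (Finset.sum_congr rfl fun s _ => ?_))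
    rw [abs_mul, abs_of_nonneg (frac_nonneg hb hk s)]
  rw [Real.norm_of_nonneg (by positivity)]
  simp_rw [← Finset.sum_div, ← Finset.mul_sum, ← Finset.sum_mul]
  gcongr
  · exact (abs_nonneg _).trans (hbs _ h1)
  · exact hbs _ h1
  · exact hbs _ h2

lemma integral_solReg_form (hν : Measurable ν) (hb : BoundedDensity ν) {δ : ℝ}
    (hδ : DetBound ν lam x δ) {u : Mode → ℝ} (hu : Measurable u)
    (hui : Integrable (fun P => u P ^ 2 / |wt x P|) (modes ν)) :
    ∫ z : Mode × Mode, u z.1 * ((solKernel ν lam x).reg z.1 z.2).re * u z.2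
      ∂(modes ν).prod (modes ν) = -∫ z : ℝ × ℝ, branchSum ν u z.1 * rootKernel momentum
        (gapWt ν x) (freq x) (16 * Real.pi * lam) (freq x z.1) (freq x z.2) * branchSum ν u z.2
        ∂momentum.prod momentum := by
  simp only [solKernel, Complex.ofReal_re]
  rw [integral_modes_prod hν hb, ← integral_neg]
  · congr 1
    ext z
    simp only [Fintype.sum_bool, branchSum, solReg, smul_eq_mul]
    ring
  · intro s t
    have hm : Measurable fun z : ℝ × ℝ => (frac ν z.1 s * frac ν z.2 t) •
        (u (z.1, s) * solReg ν lam x (z.1, s) (z.2, t) * u (z.2, t)) := by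
      have h1 : Measurable fun z : ℝ × ℝ => frac ν z.1 s :=
        (measurable_frac hν s).comp measurable_fst
      have h2 : Measurable fun z : ℝ × ℝ => frac ν z.2 t :=
        (measurable_frac hν t).comp measurable_snd
      have h2' := h1.mul h2
      have h3 : Measurable fun z : ℝ × ℝ => u (z.1, s) := hu.comp (by fun_prop)
      have h4 : Measurable fun z : ℝ × ℝ => u (z.2, t) := hu.comp (by fun_prop)
      have h5 := (measurable_solReg hν lam x).comp (measurable_modePair s t)
      exact (h2'.mul ((h3.mul h5).mul h4))
    refine ((integrable_pair_div_freq hν hb hu hui s t).const_mul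
      (|16 * Real.pi * lam| / δ)).mono' hm.aestronglyMeasurable ?_
    filter_upwards [Measure.quasiMeasurePreserving_fst.ae ae_mem_momentum,
      Measure.quasiMeasurePreserving_snd.ae ae_mem_momentum] with z h1 h2
    have hr := abs_solReg_le (P := (z.1, s)) (Q := (z.2, t)) hδ h1 h2
    have f1 := frac_nonneg hb h1 s
    have f2 := frac_nonneg hb h2 t
    rw [norm_smul, norm_mul, norm_mul, norm_mul, Real.norm_of_nonneg f1, Real.norm_of_nonneg f2,
      Real.norm_eq_abs, Real.norm_eq_abs, Real.norm_eq_abs]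
    calc _ = (frac ν z.1 s * |u (z.1, s)| * (frac ν z.2 t * |u (z.2, t)|)) *
          |solReg ν lam x (z.1, s) (z.2, t)| := by ring
      _ ≤ (frac ν z.1 s * |u (z.1, s)| * (frac ν z.2 t * |u (z.2, t)|)) *
          (|16 * Real.pi * lam| / δ / (freq x z.1 + freq x z.2)) := by gcongr
      _ = _ := by ring

/-- The mean-field second variation has the stable sign. -/
def Stable (ν : ℝ → ℝ) (lam x : ℝ) : Prop :=
  0 < lam ∨ (lam < 0 ∧ Integrable (fun k => curv x k * gap ν k) momentum ∧
    0 < 1 + 2 * lam / Real.pi * ∫ k, curv x k * gap ν k ∂momentum)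

lemma Stable.detBound (hν : Measurable ν) (hb : BoundedDensity ν) (hS : Stable ν lam x) :
    ∃ δ, DetBound ν lam x δ := by
  have hpi := Real.pi_pos
  rcases hS with hl | ⟨hl, hI, hΔ⟩
  · refine ⟨1, one_pos, fun t ht => ?_⟩
    rw [pertDet, le_add_iff_nonneg_right]
    refine mul_nonneg (by positivity) (integral_nonneg_of_ae ?_)
    filter_upwards [ae_gapWt_nonneg hb x] with k hk
    simp only [Pi.zero_apply]
    positivity
  · rw [← det_zero_eq] at hΔ
    refine ⟨_, hΔ, fun t ht => ?_⟩
    exact pertDet_ge (measurable_gapWt hν x) (measurable_freq x) (ae_gapWt_nonneg hb x)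
      (integrable_gapWt hν hb x) (ae_freq_pos x) (by nlinarith) (integrable_gapWt_div_iff.mpr hI) ht

/-- Strict positivity comes from the local part. For `λ > 0` the regular part contributes with the
good sign; for `λ < 0` it is bounded by the fraction `-g ∫ gapWt/freq² < 1` of the branch-sum part.
-/
lemma hessianPosDef_solKernel (hν : Measurable ν) (hb : BoundedDensity ν)
    (hgap : ∀ᵐ k ∂momentum, 0 < gap ν k) (hS : Stable ν lam x) :
    (solKernel ν lam x).HessianPosDef ν x := by
  obtain ⟨δ, hδ⟩ := hS.detBound hν hb
  intro u hu hui hdi hne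
  have hβ := measurable_branchSum hν hu
  have hpi := Real.pi_pos
  have hdia : ∀ᵐ k ∂momentum, 0 ≤ freq x k * branchSum ν u k ^ 2 / gapWt ν x k ∧
      2 * (freq x k * branchSum ν u k ^ 2 / gapWt ν x k) ≤
        DKernel.hessianDia ν x (solKernel ν lam x) u k := by
    filter_upwards [ae_mem_momentum, hgap, ae_gapWt_pos hgap x] with k hk hg hω
    rw [hessianDia_solKernel hb hk hg]
    have h1 := freq_pos (x := x) hk
    have h2 := frac_nonneg hb hk true
    have h3 := frac_nonneg hb hk false
    refine ⟨by positivity, ?_⟩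
    rw [le_add_iff_nonneg_right]
    positivity
  have hβi : Integrable (fun k => freq x k * branchSum ν u k ^ 2 / gapWt ν x k) momentum := by
    have hm : Measurable fun k => freq x k * branchSum ν u k ^ 2 / gapWt ν x k := by
      have := measurable_freq x
      have := measurable_gapWt hν x
      fun_prop
    refine (hdi.const_mul (1 / 2)).mono' hm.aestronglyMeasurable ?_
    filter_upwards [hdia] with k hk
    rw [Real.norm_of_nonneg hk.1]
    linarith [hk.2]
  have hd0 : ∀ᵐ k ∂momentum, 0 ≤ DKernel.hessianDia ν x (solKernel ν lam x) u k := by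
    filter_upwards [hdia] with k hk
    linarith [hk.1, hk.2]
  have hpos : 0 < ∫ k, DKernel.hessianDia ν x (solKernel ν lam x) u k ∂momentum := by
    refine lt_of_le_of_ne (integral_nonneg_of_ae hd0) fun h0 => hne ?_
    rw [eq_comm, integral_eq_zero_iff_of_nonneg_ae hd0 hdi] at h0
    -- The branch sum vanishes and, if both branches are present, so does `u₊ + u₋`. The two
    -- conditions are independent because the branch fractions differ by `gap > 0`.
    have : ∀ᵐ P ∂modes ν, u P = 0 := by
      rw [ae_modes_iff hν hb]
      intro s
      filter_upwards [ae_mem_momentum, hgap, ae_gapWt_pos hgap x, h0] with k hk hg hω h0 hf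
      rw [hessianDia_solKernel hb hk hg] at h0
      have h1 := freq_pos (x := x) hk
      have hp : 0 < frac ν k true := lt_of_lt_of_le (by norm_num) (half_le_frac_true hb hk)
      have h3 := frac_nonneg hb hk false
      have e1 : 0 ≤ freq x k * branchSum ν u k ^ 2 / gapWt ν x k := by positivity
      have e2 : 0 ≤ 2 * freq x k / gapWt ν x k *
        (frac ν k true * frac ν k false * (u (k, true) + u (k, false)) ^ 2) := by positivity
      simp only [Pi.zero_apply] at h0
      have e3 : freq x k * branchSum ν u k ^ 2 / gapWt ν x k = 0 := by linarith
      have e4 : 2 * freq x k / gapWt ν x k *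
        (frac ν k true * frac ν k false * (u (k, true) + u (k, false)) ^ 2) = 0 := by linarith
      have e5 : branchSum ν u k = 0 := by
        rcases div_eq_zero_iff.mp e3 with h | h
        · rcases mul_eq_zero.mp h with h | h
          · exact absurd h h1.ne'
          · exact pow_eq_zero_iff two_ne_zero |>.mp h
        · exact absurd h hω.ne'
      have e6 : frac ν k false = 0 ∨ u (k, true) + u (k, false) = 0 := by
        rcases mul_eq_zero.mp e4 with h | h
        · have : 0 < 2 * freq x k / gapWt ν x k := by positivity
          exact absurd h this.ne'
        · rcases mul_eq_zero.mp h with h | h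
          · rcases mul_eq_zero.mp h with h | h
            · exact absurd h hp.ne'
            · exact Or.inl h
          · exact Or.inr (pow_eq_zero_iff two_ne_zero |>.mp h)
      have hsub := frac_sub (ν := ν) k
      simp only [branchSum, Fintype.sum_bool] at e5
      have e7 : u (k, true) = 0 := by
        rcases e6 with h | h
        · rw [h, zero_mul, add_zero] at e5
          exact (mul_eq_zero.mp e5).resolve_left hp.ne'
        · have h' : u (k, false) = -u (k, true) := by linarith
          rw [h'] at e5
          have : gap ν k * u (k, true) = 0 := by rw [← hsub]; linarith
          exact (mul_eq_zero.mp this).resolve_left hg.ne'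
      cases s
      · rcases e6 with h | h
        · exact absurd h hf
        · linarith
      · exact e7
    exact this
  rw [DKernel.hessianForm, integral_solReg_form hν hb hδ hu hui]
  have hle : 2 * ∫ k, freq x k * branchSum ν u k ^ 2 / gapWt ν x k ∂momentum ≤
      ∫ k, DKernel.hessianDia ν x (solKernel ν lam x) u k ∂momentum := by
    rw [← integral_const_mul]
    exact integral_mono_ae (hβi.const_mul 2) hdi (hdia.mono fun k hk => hk.2)
  rcases hS with hl | ⟨hl, hI, hΔ⟩
  · have := rootKernel_form_nonneg (μ := momentum) (g := 16 * Real.pi * lam)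
      (measurable_gapWt hν x) (measurable_freq x) (ae_freq_pos x) (by positivity) hδ.1 hδ.2
      hβ (integrable_branchSum_div hν hb hu hui)
    linarith
  · rw [← det_zero_eq] at hΔ
    have h1 := abs_rootKernel_form_le (measurable_gapWt hν x) (measurable_freq x)
      (ae_gapWt_pos hgap x) (integrable_gapWt hν hb x) (ae_freq_pos x)
      (by nlinarith : 16 * Real.pi * lam ≤ 0) (integrable_gapWt_div_iff.mpr hI) hΔ hβ hβi
    set T := ∫ z : ℝ × ℝ, branchSum ν u z.1 * rootKernel momentum
        (gapWt ν x) (freq x) (16 * Real.pi * lam) (freq x z.1) (freq x z.2) * branchSum ν u z.2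
        ∂momentum.prod momentum
    set F0 := ∫ k, gapWt ν x k / freq x k ^ 2 ∂momentum
    set A := ∫ k, freq x k * branchSum ν u k ^ 2 / gapWt ν x k ∂momentum
    have hA : 0 ≤ A := integral_nonneg_of_ae (hdia.mono fun k hk => hk.1)
    have h2 := neg_abs_le T
    have h3 : -(16 * Real.pi * lam) * F0 < 1 := by linarith
    rcases hA.eq_or_lt with h0 | h0
    · rw [← h0, mul_zero] at h1
      linarith
    · have : -(16 * Real.pi * lam) * F0 * A < 1 * A := by gcongr
      linarith

/-- In the stable case the Riccati equation has a solution with positive definite Hessian. -/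
theorem exists_solution_of_stable (hν : Measurable ν) (hb : BoundedDensity ν)
    (hgap : ∀ᵐ k ∂momentum, 0 < gap ν k) (hS : Stable ν lam x) :
    ∃ f : DKernel, f.IsSolution ν lam x ∧ f.HessianPosDef ν x := by
  obtain ⟨δ, hδ⟩ := hS.detBound hν hb
  exact ⟨_, isSolution_solKernel hν hb hgap hδ, hessianPosDef_solKernel hν hb hgap hS⟩

end ExistencePos

/-! ### Quadratic kernel equations with coefficients in a normed algebra. -/

section Commutation

variable {X : Type*} [MeasurableSpace X] {μ : Measure X}

lemma memLp_two_section {F : Type*} [NormedAddCommGroup F] [SFinite μ] {R : X → X → F}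
    (hR : MemLp (Function.uncurry R) 2 (μ.prod μ)) : ∀ᵐ k ∂μ, MemLp (R k) 2 μ := by
  have h1 : Integrable (fun z : X × X => ‖Function.uncurry R z‖ ^ 2) (μ.prod μ) :=
    (memLp_two_iff_integrable_sq_norm hR.1).mp hR
  filter_upwards [h1.prod_right_ae, hR.1.prodMk_left] with k h2 h3
  exact (memLp_two_iff_integrable_sq_norm h3).mpr h2

lemma memLp_two_swap {F : Type*} [NormedAddCommGroup F] [SFinite μ] {R : X → X → F}
    (hR : MemLp (Function.uncurry R) 2 (μ.prod μ)) :
    MemLp (Function.uncurry fun k q => R q k) 2 (μ.prod μ) :=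
  hR.comp_measurePreserving Measure.measurePreserving_swap

lemma memLp_two_mul_prod [SFinite μ] {f g : X → ℝ} (hf : MemLp f 2 μ) (hg : MemLp g 2 μ) :
    MemLp (fun z : X × X => f z.1 * g z.2) 2 (μ.prod μ) := by
  refine (memLp_two_iff_integrable_sq (hf.1.comp_fst.mul hg.1.comp_snd)).mpr ?_
  refine (((memLp_two_iff_integrable_sq hf.1).mp hf).mul_prod
    ((memLp_two_iff_integrable_sq hg.1).mp hg)).congr (Eventually.of_forall fun z => ?_)
  simp only [Pi.mul_apply]
  ring

lemma ae_fst_ae [SFinite μ] {p : X → X → Prop} (h : ∀ᵐ z ∂μ.prod μ, p z.1 z.2) :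
    ∀ᵐ z ∂μ.prod μ, ∀ᵐ r ∂μ, p z.1 r :=
  Measure.quasiMeasurePreserving_fst.ae (p := fun k => ∀ᵐ r ∂μ, p k r) (Measure.ae_ae_of_ae_prod h)

lemma ae_swap {p : X → X → Prop} [SFinite μ] (h : ∀ᵐ z ∂μ.prod μ, p z.1 z.2) :
    ∀ᵐ z ∂μ.prod μ, p z.2 z.1 :=
  Measure.measurePreserving_swap.quasiMeasurePreserving.ae (p := fun z : X × X => p z.1 z.2) h

lemma ae_snd_ae {p : X → X → Prop} [SFinite μ] (h : ∀ᵐ z ∂μ.prod μ, p z.1 z.2) :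
    ∀ᵐ z ∂μ.prod μ, ∀ᵐ r ∂μ, p r z.2 :=
  ae_swap (p := fun k _ => ∀ᵐ r ∂μ, p r k) (ae_fst_ae (p := fun q r => p r q) (ae_swap h))

variable {𝔸 : Type*} [NormedRing 𝔸]

lemma integrable_mul_mul {f g : X → 𝔸} (hf : MemLp f 2 μ) (hg : MemLp g 2 μ) (J : 𝔸) :
    Integrable (fun r => f r * J * g r) μ := by
  refine ((hf.norm.integrable_mul hg.norm).const_mul ‖J‖).mono'
    ((hf.1.mul aestronglyMeasurable_const).mul hg.1) (Eventually.of_forall fun r => ?_)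
  refine (norm_mul_le _ _).trans ?_
  have := norm_mul_le (f r) J
  have := norm_nonneg (g r)
  simp only [Pi.mul_apply]
  nlinarith

lemma integrable_triple [SFinite μ] {R : X → X → 𝔸}
    (hR : MemLp (Function.uncurry R) 2 (μ.prod μ)) {f g : X → 𝔸}
    (hf : MemLp f 2 μ) (hg : MemLp g 2 μ) (J : 𝔸) :
    Integrable (fun z : X × X => f z.1 * J * R z.1 z.2 * J * g z.2) (μ.prod μ) := by
  have h1 := memLp_two_mul_prod hf.norm hg.norm
  have h2 := (hR.norm.integrable_mul h1).const_mul (‖J‖ ^ 2)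
  refine h2.mono' ((((hf.1.comp_fst.mul aestronglyMeasurable_const).mul hR.1).mul
    aestronglyMeasurable_const).mul hg.1.comp_snd) (Eventually.of_forall fun z => ?_)
  simp only [Pi.mul_apply, Function.uncurry]
  calc ‖f z.1 * J * R z.1 z.2 * J * g z.2‖
      ≤ ‖f z.1‖ * ‖J‖ * ‖R z.1 z.2‖ * ‖J‖ * ‖g z.2‖ := by
        refine (norm_mul_le _ _).trans ?_
        gcongr
        refine (norm_mul_le _ _).trans ?_
        gcongr
        refine (norm_mul_le _ _).trans ?_
        gcongr
        exact norm_mul_le _ _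
    _ = _ := by ring

variable [NormedAlgebra ℝ 𝔸]

/-- A kernel solving a quadratic (Riccati) equation with local coefficients whose square is
scalar commutes with its square, up to the inhomogeneity. -/
theorem commutator_of_riccati [SFinite μ] {R G : X → X → 𝔸} {L L' : X → 𝔸} {J : 𝔸} {e : X → ℝ}
    (hR : MemLp (Function.uncurry R) 2 (μ.prod μ)) (hG : MemLp (Function.uncurry G) 2 (μ.prod μ))
    (hL : ∀ᵐ k ∂μ, L k * L k = e k • 1) (hL' : ∀ᵐ k ∂μ, L' k * L' k = e k • 1)
    (hJ : ∀ᵐ k ∂μ, J * L k = L' k * J)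
    (heq : ∀ᵐ z ∂μ.prod μ, ∫ r, R z.1 r * J * R r z.2 ∂μ =
      G z.1 z.2 + L z.1 * R z.1 z.2 + R z.1 z.2 * L' z.2) :
    ∀ᵐ z ∂μ.prod μ, e z.1 • R z.1 z.2 - e z.2 • R z.1 z.2 =
      (G z.1 z.2 * L' z.2 - ∫ r, G z.1 r * J * R r z.2 ∂μ) -
      (L z.1 * G z.1 z.2 - ∫ r, R z.1 r * J * G r z.2 ∂μ) := by
  have rowR := memLp_two_section hR
  have colR := memLp_two_section (memLp_two_swap hR)
  have rowG := memLp_two_section hG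
  have colG := memLp_two_section (memLp_two_swap hG)
  filter_upwards [heq, ae_fst_ae
    (p := fun a b => ∫ r, R a r * J * R r b ∂μ = G a b + L a * R a b + R a b * L' b) heq,
    ae_snd_ae (p := fun a b => ∫ r, R a r * J * R r b ∂μ = G a b + L a * R a b + R a b * L' b) 
    heq,
    Measure.quasiMeasurePreserving_fst.ae rowR, Measure.quasiMeasurePreserving_snd.ae colR,
    Measure.quasiMeasurePreserving_fst.ae rowG, Measure.quasiMeasurePreserving_snd.ae colG,
    Measure.quasiMeasurePreserving_fst.ae hL, Measure.quasiMeasurePreserving_snd.ae hL']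
    with z h0 hk hq hRk hRq hGk hGq hLk hLq
  obtain ⟨k, q⟩ := z
  simp only at h0 hk hq hRk hRq hGk hGq hLk hLq ⊢
  set R2 : X → X → 𝔸 := fun a b => ∫ r, R a r * J * R r b ∂μ with hR2
  have iT := integrable_mul_mul hRk hRq J
  have iGR := integrable_mul_mul hGk hRq J
  have iRG := integrable_mul_mul hRk hGq J
  have tri := integrable_triple hR hRk hRq J
  have e1 : ∀ᵐ r ∂μ, ∫ s, R k s * J * R s r * J * R r q ∂μ = R2 k r * J * R r q := by
    filter_upwards [colR] with r hr
    have := integral_mul_const_of_integrable (integrable_mul_mul hRk hr J) (c := J * R r q)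
    simp only [← mul_assoc] at this
    exact this
  have e2 : ∀ᵐ s ∂μ, ∫ r, R k s * J * R s r * J * R r q ∂μ = R k s * J * R2 s q := by
    filter_upwards [rowR] with s hs
    have := integral_const_mul_of_integrable (integrable_mul_mul hs hRq J) (c := R k s * J)
    simp only [← mul_assoc] at this
    exact this
  have i1 : Integrable (fun r => R2 k r * J * R r q) μ := tri.integral_prod_right.congr e1
  have i2 : Integrable (fun s => R k s * J * R2 s q) μ := tri.integral_prod_left.congr e2
  -- Associativity of the triple composition of `R`, by Fubini.
  have e3 : ∫ r, R2 k r * J * R r q ∂μ = ∫ s, R k s * J * R2 s q ∂μ := by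
    rw [← integral_congr_ae e1, ← integral_congr_ae e2]
    exact (integral_integral_swap tri).symm
  -- The composition of `R` with itself is multiplied by `L` on the left and, in `e5`, by `L'` on
  -- the right. Substituting the equation in the inner factor produces the same mixed term `R L' J
  -- R` both times, so it drops out of the difference.
  have e4 : ∀ᵐ r ∂μ, L k * (R k r * J * R r q) =
      R2 k r * J * R r q - G k r * J * R r q - R k r * L' r * J * R r q := by
    filter_upwards [hk] with r hr
    simp only [hR2]
    rw [hr]
    noncomm_ring
  have e5 : ∀ᵐ r ∂μ, (R k r * J * R r q) * L' q =
      R k r * J * R2 r q - R k r * J * G r q - R k r * L' r * J * R r q := by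
    filter_upwards [hq, hJ] with r hr hJr
    simp only [hR2]
    rw [hr, mul_assoc (R k r) (L' r) J, ← hJr]
    noncomm_ring
  -- The coefficients need not be bounded. Integrability of the mixed term is read off from `e4`,
  -- whose other terms are integrable.
  have iM : Integrable (fun r => R k r * L' r * J * R r q) μ := by
    refine ((i1.sub iGR).sub (iT.const_mul (L k))).congr ?_
    filter_upwards [e4] with r hr
    simp only [Pi.sub_apply]
    rw [hr]
    abel
  have e6 : L k * R2 k q = ∫ r, R2 k r * J * R r q ∂μ - ∫ r, G k r * J * R r q ∂μ -
      ∫ r, R k r * L' r * J * R r q ∂μ := by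
    rw [← integral_sub i1 iGR, ← integral_sub (by exact i1.sub iGR) iM, ← integral_congr_ae e4]
    exact (integral_const_mul_of_integrable iT).symm
  have e7 : R2 k q * L' q = ∫ r, R k r * J * R2 r q ∂μ - ∫ r, R k r * J * G r q ∂μ -
      ∫ r, R k r * L' r * J * R r q ∂μ := by
    rw [← integral_sub i2 iRG, ← integral_sub (by exact i2.sub iRG) iM, ← integral_congr_ae e5]
    exact (integral_mul_const_of_integrable iT).symm
  have h0' : R2 k q = G k q + L k * R k q + R k q * L' q := h0
  have e8 : L k * R2 k q - R2 k q * L' q =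
      ∫ r, R k r * J * G r q ∂μ - ∫ r, G k r * J * R r q ∂μ := by
    rw [e6, e7, e3]; abel
  have e9 : L k * R2 k q - R2 k q * L' q =
      L k * G k q - G k q * L' q + (e k • R k q - e q • R k q) := by
    have a1 : L k * (L k * R k q) = e k • R k q := by rw [← mul_assoc, hLk, smul_mul_assoc, one_mul]
    have a2 : R k q * L' q * L' q = e q • R k q := by
      rw [mul_assoc, hLq, mul_smul_comm, mul_one]
    rw [h0', ← a1, ← a2]
    noncomm_ring
  have e10 : e k • R k q - e q • R k q = (∫ r, R k r * J * G r q ∂μ - ∫ r, G k r * J * R r q ∂μ)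
      - (L k * G k q - G k q * L' q) := by
    rw [← e8, e9]; abel
  rw [e10]
  abel

/-- The square of the operator `Ψ ↦ L Ψ - ∫ R J Ψ` attached to a solution of the quadratic
equation. -/
theorem sq_apply_of_riccati [SFinite μ] {R G : X → X → 𝔸} {L L' : X → 𝔸} {J : 𝔸} {e : X → ℝ}
    (hR : MemLp (Function.uncurry R) 2 (μ.prod μ)) (hG : MemLp (Function.uncurry G) 2 (μ.prod μ))
    (hL : ∀ᵐ k ∂μ, L k * L k = e k • 1) (hJ : ∀ᵐ k ∂μ, J * L k = L' k * J)
    (heq : ∀ᵐ z ∂μ.prod μ, ∫ r, R z.1 r * J * R r z.2 ∂μ =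
      G z.1 z.2 + L z.1 * R z.1 z.2 + R z.1 z.2 * L' z.2)
    {Ψ : X → 𝔸} (hΨ : MemLp Ψ 2 μ) :
    ∀ᵐ k ∂μ, L k * (L k * Ψ k - ∫ r, R k r * J * Ψ r ∂μ) -
      ∫ r, R k r * J * (L r * Ψ r - ∫ s, R r s * J * Ψ s ∂μ) ∂μ =
      e k • Ψ k + ∫ r, G k r * J * Ψ r ∂μ := by
  have rowR := memLp_two_section hR
  have colR := memLp_two_section (memLp_two_swap hR)
  have rowG := memLp_two_section hG
  filter_upwards [Measure.ae_ae_of_ae_prod heq, rowR, rowG, hL] with k hk hRk hGk hLk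
  have iT := integrable_mul_mul hRk hΨ J
  have iG := integrable_mul_mul hGk hΨ J
  have tri := integrable_triple hR hRk hΨ J
  have e1 : ∀ᵐ r ∂μ, ∫ s, R k s * J * R s r * J * Ψ r ∂μ =
      (∫ s, R k s * J * R s r ∂μ) * J * Ψ r := by
    filter_upwards [colR] with r hr
    have := integral_mul_const_of_integrable (integrable_mul_mul hRk hr J) (c := J * Ψ r)
    simp only [← mul_assoc] at this
    exact this
  have e2 : ∀ᵐ s ∂μ, ∫ r, R k s * J * R s r * J * Ψ r ∂μ =
      R k s * J * ∫ r, R s r * J * Ψ r ∂μ := by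
    filter_upwards [rowR] with s hs
    have := integral_const_mul_of_integrable (integrable_mul_mul hs hΨ J) (c := R k s * J)
    simp only [← mul_assoc] at this
    exact this
  have i1 : Integrable (fun r => (∫ s, R k s * J * R s r ∂μ) * J * Ψ r) μ :=
    tri.integral_prod_right.congr e1
  have i2 : Integrable (fun s => R k s * J * ∫ r, R s r * J * Ψ r ∂μ) μ :=
    tri.integral_prod_left.congr e2
  have e3 : ∫ r, (∫ s, R k s * J * R s r ∂μ) * J * Ψ r ∂μ =
      ∫ s, R k s * J * ∫ r, R s r * J * Ψ r ∂μ ∂μ := by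
    rw [← integral_congr_ae e1, ← integral_congr_ae e2]
    exact (integral_integral_swap tri).symm
  have e4 : ∀ᵐ r ∂μ, R k r * J * (L r * Ψ r) = (∫ s, R k s * J * R s r ∂μ) * J * Ψ r -
      G k r * J * Ψ r - L k * (R k r * J * Ψ r) := by
    filter_upwards [hk, hJ] with r hr hJr
    rw [hr, ← mul_assoc, mul_assoc (R k r) J, hJr]
    noncomm_ring
  have i3 : Integrable (fun r => R k r * J * (L r * Ψ r)) μ :=
    ((i1.sub iG).sub (iT.const_mul (L k))).congr (e4.mono fun r hr => hr.symm)
  have e5 : ∫ r, R k r * J * (L r * Ψ r) ∂μ = ∫ r, (∫ s, R k s * J * R s r ∂μ) * J * Ψ r ∂μ -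
      ∫ r, G k r * J * Ψ r ∂μ - L k * ∫ r, R k r * J * Ψ r ∂μ := by
    rw [integral_congr_ae e4, integral_sub (by exact i1.sub iG) (iT.const_mul (L k)),
      integral_sub i1 iG, integral_const_mul_of_integrable iT]
  have e6 : ∫ r, R k r * J * (L r * Ψ r - ∫ s, R r s * J * Ψ s ∂μ) ∂μ =
      ∫ r, R k r * J * (L r * Ψ r) ∂μ - ∫ r, R k r * J * ∫ s, R r s * J * Ψ s ∂μ ∂μ := by
    rw [← integral_sub i3 i2]
    simp only [mul_sub]
  rw [e6, e5, e3, mul_sub, ← mul_assoc, hLk, smul_mul_assoc, one_mul]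
  abel

/-- The operator `Ψ ↦ L Ψ - ∫ R J Ψ` on a resolvent vector, for a kernel `R` whose commutator with
the multiplication by `e` has rank two. -/
theorem apply_resolvent_of_commutator [SFinite μ] {R : X → X → 𝔸} {L V V' B' : X → 𝔸} {J : 𝔸}
    {e : X → ℝ} {g t : ℝ} (ht : ∀ᵐ k ∂μ, e k + t ≠ 0)
    (hR : MemLp (Function.uncurry R) 2 (μ.prod μ)) (hV : MemLp V 2 μ) (hV' : MemLp V' 2 μ)
    (hB' : MemLp B' 2 μ) (hΨ : MemLp (fun k => (e k + t)⁻¹ • V k) 2 μ)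
    (hc : ∀ᵐ z ∂μ.prod μ, e z.1 • R z.1 z.2 - e z.2 • R z.1 z.2 =
      g • (V z.1 * B' z.2 - (L z.1 * V z.1 - ∫ r, R z.1 r * J * V r ∂μ) * V' z.2)) :
    ∀ᵐ k ∂μ, (e k + t) • (L k * ((e k + t)⁻¹ • V k) -
        ∫ r, R k r * J * ((e r + t)⁻¹ • V r) ∂μ) =
      (L k * V k - ∫ r, R k r * J * V r ∂μ) *
        (1 + g • ∫ r, V' r * J * ((e r + t)⁻¹ • V r) ∂μ) -
      V k * (g • ∫ r, B' r * J * ((e r + t)⁻¹ • V r) ∂μ) := by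
  filter_upwards [Measure.ae_ae_of_ae_prod hc, memLp_two_section hR, ht] with k hk hRk htk
  have iR := integrable_mul_mul hRk hΨ J
  have iV := integrable_mul_mul hRk hV J
  have iB' := integrable_mul_mul hB' hΨ J
  have iV' := integrable_mul_mul hV' hΨ J
  set B := L k * V k - ∫ r, R k r * J * V r ∂μ with hB
  -- Moving the factor `e + t` from the first argument of `R` to the second costs the rank two
  -- commutator; there it cancels the resolvent.
  have e1 : ∀ᵐ r ∂μ, (e k + t) • (R k r * J * ((e r + t)⁻¹ • V r)) = R k r * J * V r +
      (V k * (g • (B' r * J * ((e r + t)⁻¹ • V r))) -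
        B * (g • (V' r * J * ((e r + t)⁻¹ • V r)))) := by
    filter_upwards [hk, ht] with r hr htr
    have e2 : (e k + t) • R k r = (e r + t) • R k r + g • (V k * B' r - B * V' r) := by
      rw [add_smul, add_smul, ← hr]
      abel
    have e3 : V r = (e r + t) • ((e r + t)⁻¹ • V r) := by rw [smul_smul, mul_inv_cancel₀ htr, one_smul]
    set Y := (e r + t)⁻¹ • V r
    rw [← smul_mul_assoc, ← smul_mul_assoc, e2, e3]
    simp only [add_mul, smul_mul_assoc, mul_smul_comm, sub_mul, smul_sub, mul_assoc]
  have e4 := integral_congr_ae e1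
  have j1 : Integrable (fun r => V k * (g • (B' r * J * ((e r + t)⁻¹ • V r)))) μ :=
    (iB'.smul g).const_mul (V k)
  have j2 : Integrable (fun r => B * (g • (V' r * J * ((e r + t)⁻¹ • V r)))) μ :=
    (iV'.smul g).const_mul B
  rw [integral_smul, integral_add iV (by exact j1.sub j2), integral_sub j1 j2,
    integral_const_mul_of_integrable (by exact iB'.smul g),
    integral_const_mul_of_integrable (by exact iV'.smul g), integral_smul, integral_smul] at e4
  rw [smul_sub, e4, mul_smul_comm, smul_smul, mul_inv_cancel₀ htk, one_smul, mul_add, mul_one, hB]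
  abel

end Commutation

/-! ### Branch matrices and the matrix form of the Riccati equation. -/

section BranchMatrices

/-- Matrices indexed by the two branches. -/
def BranchMat : Type := Matrix Bool Bool ℂ

namespace BranchMat

/-- Any submultiplicative norm would do; a type distinct from `Matrix` allows one to be fixed as an
instance. -/
instance : NormedRing BranchMat := Matrix.linftyOpNormedRing (n := Bool) (α := ℂ)

instance : NormedAlgebra ℝ BranchMat := Matrix.linftyOpNormedAlgebra (n := Bool) (α := ℂ)

instance : FiniteDimensional ℝ BranchMat := inferInstanceAs (FiniteDimensional ℝ (Matrix Bool Bool ℂ))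

/-- The branch matrix with given entries. -/
def mk (f : Bool → Bool → ℂ) : BranchMat := Matrix.of f

variable {X : Type*} [MeasurableSpace X] {μ : Measure X}

lemma mk_apply (f : Bool → Bool → ℂ) (s t : Bool) : mk f s t = f s t := rfl

lemma ext {A B : BranchMat} (h : ∀ s t, A s t = B s t) : A = B := Matrix.ext h

lemma mul_apply (A B : BranchMat) (s t : Bool) :
    (A * B) s t = A s true * B true t + A s false * B false t := by
  refine (Matrix.mul_apply (M := (A : Matrix Bool Bool ℂ)) (N := B)).trans (Fintype.sum_bool _)

lemma add_apply (A B : BranchMat) (s t : Bool) : (A + B) s t = A s t + B s t := rfl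

lemma sub_apply (A B : BranchMat) (s t : Bool) : (A - B) s t = A s t - B s t := rfl

lemma neg_apply (A : BranchMat) (s t : Bool) : (-A) s t = -A s t := rfl

lemma smul_apply (a : ℝ) (A : BranchMat) (s t : Bool) : (a • A) s t = a * A s t := by
  rw [← Complex.real_smul]; rfl

lemma one_apply (s t : Bool) : (1 : BranchMat) s t = if s = t then 1 else 0 :=
  Matrix.one_apply

/-- An entry of a branch matrix, as a linear map. -/
def entry (s t : Bool) : BranchMat →L[ℝ] ℂ :=
  LinearMap.toContinuousLinearMap
    { toFun := fun A => A s t, map_add' := fun _ _ => rfl, map_smul' := fun _ _ => rfl }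

/-- The branch matrix with one given entry. -/
def single (s t : Bool) : ℂ →L[ℝ] BranchMat :=
  LinearMap.toContinuousLinearMap
    { toFun := fun a => mk fun s' t' => if s' = s ∧ t' = t then a else 0
      map_add' := fun a b => ext fun s' t' => by
        simp only [mk_apply, add_apply]; split_ifs <;> simp
      map_smul' := fun a b => ext fun s' t' => by
        simp only [mk_apply, smul_apply, RingHom.id_apply]; split_ifs <;> simp }

lemma single_apply (s t : Bool) (a : ℂ) (s' t' : Bool) :
    single s t a s' t' = if s' = s ∧ t' = t then a else 0 := rfl

lemma sum_single (A : BranchMat) : single true true (A true true) +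
    single true false (A true false) + single false true (A false true) +
    single false false (A false false) = A := by
  refine ext fun s t => ?_
  rw [add_apply, add_apply, add_apply, single_apply, single_apply, single_apply, single_apply]
  cases s <;> cases t <;> simp

lemma memLp_iff {M : X → BranchMat} : MemLp M 2 μ ↔ ∀ s t, MemLp (fun r => M r s t) 2 μ := by
  constructor
  · intro h s t
    exact (entry s t).comp_memLp' h
  · intro h
    have h1 := ((((single true true).comp_memLp' (h true true)).add
      ((single true false).comp_memLp' (h true false))).add
      ((single false true).comp_memLp' (h false true))).add
      ((single false false).comp_memLp' (h false false))
    exact (memLp_congr_ae (Eventually.of_forall fun r => sum_single (M r))).mp h1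

lemma integral_apply {M : X → BranchMat} (hM : Integrable M μ) (s t : Bool) :
    (∫ r, M r ∂μ) s t = ∫ r, M r s t ∂μ :=
  ((entry s t).integral_comp_comm hM).symm

lemma integrable_apply {M : X → BranchMat} (hM : Integrable M μ) (s t : Bool) :
    Integrable (fun r => M r s t) μ :=
  (entry s t).integrable_comp hM

end BranchMat

variable {ν : ℝ → ℝ} {lam x k : ℝ}

/-- The amplitude `√(frac · |wt|)` of a branch. -/
def amp (ν : ℝ → ℝ) (x k : ℝ) (s : Bool) : ℝ := √(frac ν k s * absWt x k)

lemma amp_nonneg (s : Bool) : 0 ≤ amp ν x k s := Real.sqrt_nonneg _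

lemma amp_sq (hb : BoundedDensity ν) (hk : k ∈ Ioo 0 Real.pi) (s : Bool) :
    amp ν x k s ^ 2 = frac ν k s * absWt x k :=
  Real.sq_sqrt (mul_nonneg (frac_nonneg hb hk s) (absWt_nonneg x k))

lemma amp_sub (hb : BoundedDensity ν) (hk : k ∈ Ioo 0 Real.pi) :
    amp ν x k true ^ 2 - amp ν x k false ^ 2 = gapWt ν x k := by
  rw [amp_sq hb hk, amp_sq hb hk, gapWt, ← frac_sub]
  ring

lemma amp_ne_zero_iff (hb : BoundedDensity ν) (hk : k ∈ Ioo 0 Real.pi) (s : Bool) :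
    amp ν x k s ≠ 0 ↔ frac ν k s ≠ 0 := by
  rw [← pow_ne_zero_iff two_ne_zero, amp_sq hb hk, mul_ne_zero_iff]
  exact and_iff_left (absWt_pos hk).ne'

lemma amp_true_pos (hb : BoundedDensity ν) (hk : k ∈ Ioo 0 Real.pi) : 0 < amp ν x k true :=
  Real.sqrt_pos.mpr (mul_pos (lt_of_lt_of_le (by norm_num) (half_le_frac_true hb hk)) (absWt_pos hk))

lemma measurable_amp (hν : Measurable ν) (x : ℝ) (s : Bool) :
    Measurable fun k => amp ν x k s :=
  ((measurable_frac hν s).mul (measurable_absWt x)).sqrt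

lemma amp_le_one (hb : BoundedDensity ν) (hk : k ∈ Ioo 0 Real.pi) (s : Bool) :
    amp ν x k s ≤ 1 := by
  refine Real.sqrt_le_one.mpr ?_
  have h1 := frac_nonneg hb hk s
  have h2 := frac_le_one hb hk s
  have h3 := absWt_nonneg x k
  have h4 := absWt_le_one (x := x) hk
  nlinarith

lemma memLp_amp (hν : Measurable ν) (hb : BoundedDensity ν) (x : ℝ) (s : Bool) :
    MemLp (fun k => amp ν x k s) 2 momentum := by
  refine MemLp.of_bound (measurable_amp hν x s).aestronglyMeasurable 1 ?_
  filter_upwards [ae_mem_momentum] with k hk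
  rw [Real.norm_of_nonneg (amp_nonneg s)]
  exact amp_le_one hb hk s

lemma memLp_ofReal {X : Type*} [MeasurableSpace X] {μ : Measure X} {f : X → ℝ}
    (hf : MemLp f 2 μ) : MemLp (fun k => (f k : ℂ)) 2 μ := hf.ofReal

namespace DKernel

/-- The regular part, with the square roots of the weights absorbed. -/
def regMat (f : DKernel) (ν : ℝ → ℝ) (x k q : ℝ) : BranchMat :=
  .mk fun s t => amp ν x k s * f.reg (k, s) (q, t) * amp ν x q t

/-- The linear coefficient of the Riccati equation completed by the Dirac part. -/
def diaMat (f : DKernel) (ν : ℝ → ℝ) (x k : ℝ) : BranchMat :=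
  .mk fun s t => (if s = t then (branchSign s * freq x k : ℂ) else 0) -
    amp ν x k s * f.dia k s t * amp ν x k t * branchSign t

/-- The transpose of `diaMat`. -/
def diaMat' (f : DKernel) (ν : ℝ → ℝ) (x k : ℝ) : BranchMat := .mk fun s t => f.diaMat ν x k t s

end DKernel

/-- The signs of the branches. -/
def signMat : BranchMat := .mk fun s t => if s = t then (branchSign s : ℂ) else 0

/-- The amplitudes, as a column. -/
def ampCol (ν : ℝ → ℝ) (x k : ℝ) : BranchMat := .mk fun s t => if t then (amp ν x k s : ℂ) else 0

/-- The amplitudes, as a row. -/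
def ampRow (ν : ℝ → ℝ) (x k : ℝ) : BranchMat := .mk fun s t => if s then (amp ν x k t : ℂ) else 0

lemma memLp_ampCol (hν : Measurable ν) (hb : BoundedDensity ν) (x : ℝ) :
    MemLp (ampCol ν x) 2 momentum := by
  refine BranchMat.memLp_iff.mpr fun s t => ?_
  cases t
  · exact MemLp.zero
  · exact memLp_ofReal (memLp_amp hν hb x s)

lemma memLp_ampRow (hν : Measurable ν) (hb : BoundedDensity ν) (x : ℝ) :
    MemLp (ampRow ν x) 2 momentum := by
  refine BranchMat.memLp_iff.mpr fun s t => ?_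
  cases s
  · exact MemLp.zero
  · exact memLp_ofReal (memLp_amp hν hb x t)

lemma measurable_amp_fst (hν : Measurable ν) (x : ℝ) (s : Bool) :
    Measurable fun z : ℝ × ℝ => amp ν x z.1 s := (measurable_amp hν x s).comp measurable_fst

lemma measurable_amp_snd (hν : Measurable ν) (x : ℝ) (s : Bool) :
    Measurable fun z : ℝ × ℝ => amp ν x z.2 s := (measurable_amp hν x s).comp measurable_snd

namespace DKernel

variable {f : DKernel}

lemma Admissible.measurable_entry (hν : Measurable ν) (hf : f.Admissible ν x) (s t : Bool) :
    Measurable fun z : ℝ × ℝ => f.regMat ν x z.1 z.2 s t := by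
  have h1 := hf.measurable_reg.comp (measurable_modePair s t)
  have h2 := (Complex.measurable_ofReal.comp (measurable_amp_fst hν x s))
  have h3 := (Complex.measurable_ofReal.comp (measurable_amp_snd hν x t))
  exact (h2.mul h1).mul h3

lemma Admissible.memLp_regMat (hν : Measurable ν) (hb : BoundedDensity ν)
    (hf : f.Admissible ν x) :
    MemLp (Function.uncurry (f.regMat ν x)) 2 (momentum.prod momentum) := by
  refine BranchMat.memLp_iff.mpr fun s t => ?_
  refine (memLp_two_iff_integrable_sq_norm
    (hf.measurable_entry hν s t).aestronglyMeasurable).mpr ?_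
  refine ((integrable_modes_prod_iff hν hb).mp hf.sq_integrable s t).congr ?_
  filter_upwards [Measure.quasiMeasurePreserving_fst.ae ae_mem_momentum,
    Measure.quasiMeasurePreserving_snd.ae ae_mem_momentum] with z h1 h2
  have e : ‖f.regMat ν x z.1 z.2 s t‖ = amp ν x z.1 s * ‖f.reg (z.1, s) (z.2, t)‖ *
      amp ν x z.2 t := by
    rw [regMat, BranchMat.mk_apply, norm_mul, norm_mul, Complex.norm_real, Complex.norm_real,
      Real.norm_of_nonneg (amp_nonneg s), Real.norm_of_nonneg (amp_nonneg t)]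
  rw [wt_eq h1, wt_eq h2, abs_mul, abs_mul, abs_branchSign, abs_branchSign,
    abs_of_nonneg (absWt_nonneg x _), abs_of_nonneg (absWt_nonneg x _)]
  change _ = ‖f.regMat ν x z.1 z.2 s t‖ ^ 2
  rw [e, mul_pow, mul_pow, amp_sq hb h1, amp_sq hb h2, smul_eq_mul]
  ring

/-- With `J` the signs and `M` the symmetric matrix of the Dirac part, `L = Jω - MJ`. Hence `JL = ω
- JMJ` is symmetric, that is, equal to `LᵀJ`. -/
lemma signMat_mul_diaMat (hf : f.Admissible ν x) (k : ℝ) :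
    signMat * f.diaMat ν x k = f.diaMat' ν x k * signMat := by
  refine BranchMat.ext fun s t => ?_
  simp only [BranchMat.mul_apply, signMat, diaMat, diaMat', BranchMat.mk_apply]
  have := hf.symm_dia k true false
  cases s <;> cases t <;> simp [this] <;> ring

/-- Completing the square: with `L = Jω - MJ`, the coefficient of the Dirac function in the equation
is `ω(JM + MJ) = MJM`, which is what is left of `L² = ω²`. The amplitudes in `M` make the entries of
absent branches vanish, so the equation is only needed where both branches occur. -/
lemma IsSolution.diaMat_sq (hb : BoundedDensity ν) (hf : f.IsSolution ν lam x) :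
    ∀ᵐ k ∂momentum, f.diaMat ν x k * f.diaMat ν x k = (freq x k ^ 2) • (1 : BranchMat) := by
  filter_upwards [hf.2.1, ae_mem_momentum] with k h hk
  refine BranchMat.ext fun s t => ?_
  have key : (amp ν x k s : ℂ) * amp ν x k t * (f.dia k s t * (freq x k * (branchSign s +
      branchSign t) : ℂ)) = amp ν x k s * amp ν x k t * (∑ r : Bool, f.dia k s r *
        (amp ν x k r ^ 2 * branchSign r) * f.dia k r t) := by
    by_cases hs : frac ν k s = 0
    · have : amp ν x k s = 0 := by simp [amp, hs]
      simp [this]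
    by_cases ht : frac ν k t = 0
    · have : amp ν x k t = 0 := by simp [amp, ht]
      simp [this]
    have h1 := h s t hs ht
    have hpi : (Real.pi : ℂ) ≠ 0 := by exact_mod_cast Real.pi_ne_zero
    have e : ∀ r, (amp ν x k r : ℂ) ^ 2 = frac ν k r * absWt x k := fun r => by
      exact_mod_cast amp_sq hb hk r
    simp only [riccati, comp, lin_eq hk, wt_eq hk] at h1
    congr 1
    simp only [e, freq, Fintype.sum_bool] at h1 ⊢
    push_cast at h1 ⊢
    field_simp at h1
    linear_combination h1
  rw [BranchMat.mul_apply, BranchMat.smul_apply, BranchMat.one_apply]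
  simp only [diaMat, BranchMat.mk_apply, Fintype.sum_bool] at key ⊢
  cases s <;> cases t <;> simp only [branchSign_true, branchSign_false, Complex.ofReal_neg,
    Complex.ofReal_one, reduceCtorEq, if_true, if_false, Complex.ofReal_pow] at key ⊢
  · linear_combination key
  · linear_combination -key
  · linear_combination key
  · linear_combination -key

/-- The cross terms between Dirac and regular parts are absorbed into the linear coefficients: `L`
acts on the left and its transpose on the right. The inhomogeneity becomes the rank one kernel of
the amplitudes. -/
lemma IsSolution.riccati_regMat (hν : Measurable ν) (hb : BoundedDensity ν)
    (hf : f.IsSolution ν lam x) : ∀ᵐ z ∂momentum.prod momentum,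
      ∫ r, f.regMat ν x z.1 r * signMat * f.regMat ν x r z.2 ∂momentum =
      (16 * Real.pi * lam) • (ampCol ν x z.1 * ampRow ν x z.2) +
        f.diaMat ν x z.1 * f.regMat ν x z.1 z.2 + f.regMat ν x z.1 z.2 * f.diaMat' ν x z.2 := by
  have hR := hf.1.memLp_regMat hν hb
  have hE := (ae_modes_prod_iff hν hb).mp hf.2.2
  have hE' : ∀ᵐ z ∂momentum.prod momentum, ∀ s t, frac ν z.1 s ≠ 0 → frac ν z.2 t ≠ 0 →
      (riccati ν lam x f).reg (z.1, s) (z.2, t) = 0 := by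
    simp only [eventually_all]
    exact hE
  filter_upwards [hE', Measure.quasiMeasurePreserving_fst.ae ae_mem_momentum,
    Measure.quasiMeasurePreserving_snd.ae ae_mem_momentum,
    Measure.quasiMeasurePreserving_fst.ae (memLp_two_section hR),
    Measure.quasiMeasurePreserving_snd.ae (memLp_two_section (memLp_two_swap hR))]
    with ⟨k, q⟩ hz hk hq hRk hRq
  simp only at hz hk hq hRk hRq ⊢
  refine BranchMat.ext fun s t => ?_
  rw [BranchMat.integral_apply (integrable_mul_mul hRk hRq signMat)]
  by_cases hs : frac ν k s = 0
  · have h0 : amp ν x k s = 0 := by simp [amp, hs]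
    simp only [BranchMat.mul_apply, BranchMat.add_apply, BranchMat.smul_apply, signMat, regMat,
      diaMat, diaMat', ampCol, ampRow, BranchMat.mk_apply, h0]
    cases s <;> simp [h0]
  by_cases ht : frac ν q t = 0
  · have h0 : amp ν x q t = 0 := by simp [amp, ht]
    simp only [BranchMat.mul_apply, BranchMat.add_apply, BranchMat.smul_apply, signMat, regMat,
      diaMat, diaMat', ampCol, ampRow, BranchMat.mk_apply, h0]
    cases t <;> simp [h0]
  have h1 := hz s t hs ht
  have cs := (amp_ne_zero_iff (x := x) hb hk s).mpr hs
  have ct := (amp_ne_zero_iff (x := x) hb hq t).mpr ht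
  have cs' : (amp ν x k s : ℂ) ≠ 0 := by exact_mod_cast cs
  have ct' : (amp ν x q t : ℂ) ≠ 0 := by exact_mod_cast ct
  have hpi : (Real.pi : ℂ) ≠ 0 := by exact_mod_cast Real.pi_ne_zero
  have ek : ∀ r, (amp ν x k r : ℂ) ^ 2 = frac ν k r * absWt x k := fun r => by
    exact_mod_cast amp_sq hb hk r
  have eq : ∀ r, (amp ν x q r : ℂ) ^ 2 = frac ν q r * absWt x q := fun r => by
    exact_mod_cast amp_sq hb hq r
  have hint : ∀ r : Bool, ∀ᵐ p ∂momentum, frac ν p r •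
      (f.reg (k, s) (p, r) * ((wt x (p, r) : ℝ) : ℂ) * f.reg (p, r) (q, t)) =
      ((amp ν x k s : ℂ) * amp ν x q t)⁻¹ * (branchSign r *
        (f.regMat ν x k p s r * f.regMat ν x p q r t)) := by
    intro r
    filter_upwards [ae_mem_momentum] with p hp
    have ep : (amp ν x p r : ℂ) ^ 2 = frac ν p r * absWt x p := by
      exact_mod_cast amp_sq hb hp r
    rw [wt_eq hp, Complex.real_smul]
    simp only [regMat, BranchMat.mk_apply]
    field_simp
    rw [ep]
    push_cast
    ring
  have hi : ∀ r : Bool, Integrable (fun p => frac ν p r •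
      (f.reg (k, s) (p, r) * ((wt x (p, r) : ℝ) : ℂ) * f.reg (p, r) (q, t))) momentum := by
    intro r
    refine Integrable.congr ?_ ((hint r).mono fun p hp => hp.symm)
    exact (((BranchMat.memLp_iff.mp hRk s r).integrable_mul
      (BranchMat.memLp_iff.mp hRq r t)).const_mul _).const_mul _
  have hI : (amp ν x k s : ℂ) * amp ν x q t *
      (∫ R, f.reg (k, s) R * ((wt x R : ℝ) : ℂ) * f.reg R (q, t) ∂modes ν) =
      ∫ r, (f.regMat ν x k r * signMat * f.regMat ν x r q) s t ∂momentum := by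
    rw [integral_modes hν hb hi, ← integral_const_mul]
    refine integral_congr_ae ?_
    filter_upwards [hint true, hint false] with p h2 h3
    rw [Fintype.sum_bool, h2, h3]
    simp only [BranchMat.mul_apply, signMat, BranchMat.mk_apply]
    field_simp
    simp
    ring
  rw [← hI]
  have h2 : (comp ν x f f).reg (k, s) (q, t) = Real.pi * (((16 * lam : ℝ) : ℂ) +
      f.reg (k, s) (q, t) * ((lin x (k, s) + lin x (q, t) : ℝ) : ℂ)) := by
    simp only [riccati, Complex.ofReal_div, Complex.ofReal_one] at h1
    field_simp at h1
    linear_combination -h1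
  simp only [comp, lin_eq hk, lin_eq hq, wt_eq hk, wt_eq hq] at h2
  set I := ∫ R, f.reg (k, s) R * ((wt x R : ℝ) : ℂ) * f.reg R (q, t) ∂modes ν
  have ek1 := ek true
  have ek2 := ek false
  have eq1 := eq true
  have eq2 := eq false
  simp only [BranchMat.mul_apply, BranchMat.add_apply, BranchMat.smul_apply, regMat,
    diaMat, diaMat', ampCol, ampRow, BranchMat.mk_apply, freq, Fintype.sum_bool,
    hf.1.symm_dia q t] at h2 ⊢
  push_cast at h2 ⊢
  have key : (amp ν x k s : ℂ) * amp ν x q t * I = amp ν x k s * amp ν x q t * (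
      Real.pi * (16 * lam + f.reg (k, s) (q, t) *
        (branchSign s * (2 * eps x k) + branchSign t * (2 * eps x q)))
      - (f.dia k s true * (amp ν x k true ^ 2 * branchSign true) * f.reg (k, true) (q, t) +
        f.dia k s false * (amp ν x k false ^ 2 * branchSign false) * f.reg (k, false) (q, t))
      - (f.reg (k, s) (q, true) * (amp ν x q true ^ 2 * branchSign true) * f.dia q true t +
        f.reg (k, s) (q, false) * (amp ν x q false ^ 2 * branchSign false) * f.dia q false t)) := by
    rw [ek1, ek2, eq1, eq2]
    linear_combination (amp ν x k s : ℂ) * amp ν x q t * h2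
  rw [key]
  cases s <;> cases t <;> simp only [branchSign_true, branchSign_false, Complex.ofReal_neg,
    Complex.ofReal_one, reduceCtorEq, if_true, if_false] <;> ring

end DKernel

end BranchMatrices

/-! ### The operator attached to a solution and its commutator. -/

section SolutionOperator

variable {ν : ℝ → ℝ} {lam x k : ℝ} {f : DKernel}

instance : NeBot (ae momentum) := by
  refine ae_neBot.mpr fun h => ?_
  have : momentum (Ioo 0 Real.pi) = 0 := by rw [h]; simp
  rw [momentum, Measure.restrict_apply_self, Real.volume_Ioo] at this
  simp only [sub_zero, ENNReal.ofReal_eq_zero] at this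
  linarith [Real.pi_pos]

lemma freq_le (x k : ℝ) : freq x k ≤ 2 * Real.pi * (1 + |x|) := by
  have := eps_le x k
  have := Real.pi_pos
  unfold freq
  gcongr

namespace DKernel

/-- The image of the amplitude column under the operator `Ψ ↦ L Ψ - ∫ R J Ψ`. -/
def ampImage (f : DKernel) (ν : ℝ → ℝ) (x k : ℝ) : BranchMat :=
  f.diaMat ν x k * ampCol ν x k - ∫ r, f.regMat ν x k r * signMat * ampCol ν x r ∂momentum

/-- The transpose of `ampImage`. -/
def ampImage' (f : DKernel) (ν : ℝ → ℝ) (x k : ℝ) : BranchMat :=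
  ampRow ν x k * f.diaMat' ν x k - ∫ r, ampRow ν x r * signMat * f.regMat ν x r k ∂momentum

lemma memLp_ampCol_mul_ampRow (hν : Measurable ν) (hb : BoundedDensity ν) (x g : ℝ) :
    MemLp (Function.uncurry fun k q => g • (ampCol ν x k * ampRow ν x q)) 2
      (momentum.prod momentum) := by
  refine MemLp.const_smul (f := fun z : ℝ × ℝ => ampCol ν x z.1 * ampRow ν x z.2) ?_ g
  refine BranchMat.memLp_iff.mpr fun s t => ?_
  have h := memLp_ofReal (memLp_two_mul_prod (memLp_amp hν hb x s) (memLp_amp hν hb x t))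
  refine (memLp_congr_ae (Eventually.of_forall fun z => ?_)).mp h
  simp [BranchMat.mul_apply, ampCol, ampRow, BranchMat.mk_apply]

/-- Vectors are stored as matrices with a single non-zero column, so that the results on a normed
algebra apply to them; the image keeps this shape. -/
lemma ampImage_false (hν : Measurable ν) (hb : BoundedDensity ν) (hf : f.Admissible ν x) :
    ∀ᵐ k ∂momentum, ∀ s, f.ampImage ν x k s false = 0 := by
  filter_upwards [memLp_two_section (hf.memLp_regMat hν hb)] with k hk s
  rw [ampImage, BranchMat.sub_apply,
    BranchMat.integral_apply (integrable_mul_mul hk (memLp_ampCol hν hb x) signMat)]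
  simp [BranchMat.mul_apply, ampCol, BranchMat.mk_apply]

lemma ampImage'_false (hν : Measurable ν) (hb : BoundedDensity ν) (hf : f.Admissible ν x) :
    ∀ᵐ k ∂momentum, ∀ s, f.ampImage' ν x k false s = 0 := by
  filter_upwards [memLp_two_section (memLp_two_swap (hf.memLp_regMat hν hb))] with k hk s
  rw [ampImage', BranchMat.sub_apply,
    BranchMat.integral_apply (integrable_mul_mul (memLp_ampRow hν hb x) hk signMat)]
  simp [BranchMat.mul_apply, ampRow, BranchMat.mk_apply]

/-- For a solution, the commutator of the regular part with `freq²` has rank two. -/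
lemma IsSolution.commutator (hν : Measurable ν) (hb : BoundedDensity ν)
    (hf : f.IsSolution ν lam x) : ∀ᵐ z ∂momentum.prod momentum,
      freq x z.1 ^ 2 • f.regMat ν x z.1 z.2 - freq x z.2 ^ 2 • f.regMat ν x z.1 z.2 =
      (16 * Real.pi * lam) • (ampCol ν x z.1 * f.ampImage' ν x z.2 -
        f.ampImage ν x z.1 * ampRow ν x z.2) := by
  have hR := hf.1.memLp_regMat hν hb
  have hV := memLp_ampCol hν hb x
  have hV' := memLp_ampRow hν hb x
  have hL' : ∀ᵐ k ∂momentum, f.diaMat' ν x k * f.diaMat' ν x k =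
      (freq x k ^ 2) • (1 : BranchMat) := by
    filter_upwards [hf.diaMat_sq hb] with k hk
    refine BranchMat.ext fun s t => ?_
    have h1 : (f.diaMat ν x k * f.diaMat ν x k) t s = ((freq x k ^ 2) • (1 : BranchMat)) t s := by
      rw [hk]
    rw [BranchMat.smul_apply, BranchMat.one_apply, BranchMat.mul_apply] at h1 ⊢
    simp only [diaMat', BranchMat.mk_apply, eq_comm (a := s)]
    rw [← h1]
    ring
  have := commutator_of_riccati hR (memLp_ampCol_mul_ampRow hν hb x (16 * Real.pi * lam))
    (hf.diaMat_sq hb) hL' (Eventually.of_forall fun k => signMat_mul_diaMat hf.1 k)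
    (hf.riccati_regMat hν hb)
  filter_upwards [this, Measure.quasiMeasurePreserving_fst.ae (memLp_two_section hR),
    Measure.quasiMeasurePreserving_snd.ae (memLp_two_section (memLp_two_swap hR))]
    with z hz hk hq
  rw [hz, ampImage', ampImage]
  have i1 := integrable_mul_mul hV' hq signMat
  have i2 := integrable_mul_mul hk hV signMat
  have e1 : ∫ r, (16 * Real.pi * lam) • (ampCol ν x z.1 * ampRow ν x r) * signMat *
      f.regMat ν x r z.2 ∂momentum = (16 * Real.pi * lam) • (ampCol ν x z.1 *
        ∫ r, ampRow ν x r * signMat * f.regMat ν x r z.2 ∂momentum) := by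
    rw [← integral_const_mul_of_integrable i1, ← integral_smul]
    simp only [smul_mul_assoc, mul_assoc]
  have e2 : ∫ r, f.regMat ν x z.1 r * signMat * ((16 * Real.pi * lam) •
      (ampCol ν x r * ampRow ν x z.2)) ∂momentum = (16 * Real.pi * lam) •
        ((∫ r, f.regMat ν x z.1 r * signMat * ampCol ν x r ∂momentum) * ampRow ν x z.2) := by
    rw [← integral_mul_const_of_integrable i2, ← integral_smul]
    simp only [mul_smul_comm, mul_assoc]
  rw [e1, e2]
  simp only [mul_sub, sub_mul, smul_sub, smul_mul_assoc, mul_smul_comm, mul_assoc]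

/-- The Dirac part is only measurable, so the definition gives no bound. Instead the commutator
relation is solved for `ampImage'` at one fixed momentum `k`: there the amplitude on the branch `+`
is non-zero, and all other terms are square integrable in the second variable. -/
lemma IsSolution.memLp_ampImage' (hν : Measurable ν) (hb : BoundedDensity ν) (hlam : lam ≠ 0)
    (hf : f.IsSolution ν lam x) : MemLp (f.ampImage' ν x) 2 momentum := by
  have hR := hf.1.memLp_regMat hν hb
  obtain ⟨k, hk, hc, hRk⟩ := (ae_mem_momentum.and ((Measure.ae_ae_of_ae_prod
    (hf.commutator hν hb)).and (memLp_two_section hR))).exists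
  refine BranchMat.memLp_iff.mpr fun s t => ?_
  cases s
  · refine MemLp.ae_eq ?_ (MemLp.zero (ε := ℂ))
    filter_upwards [ampImage'_false hν hb hf.1] with q hq
    exact (hq t).symm
  have hg : ((16 * Real.pi * lam : ℝ) : ℂ) ≠ 0 := by
    exact_mod_cast mul_ne_zero (by positivity) hlam
  have ha : (amp ν x k true : ℂ) ≠ 0 := by exact_mod_cast (amp_true_pos hb hk).ne'
  have hRt := BranchMat.memLp_iff.mp hRk true t
  have hRe : MemLp (fun q => ((freq x q ^ 2 : ℝ) : ℂ) * f.regMat ν x k q true t) 2 momentum := by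
    refine MemLp.of_le_mul (c := (2 * Real.pi * (1 + |x|)) ^ 2) hRt ?_ (Eventually.of_forall
      fun q => ?_)
    · exact (Complex.measurable_ofReal.comp ((measurable_freq x).pow_const 2)).aestronglyMeasurable.mul
        hRt.1
    · rw [norm_mul, Complex.norm_real, Real.norm_of_nonneg (by positivity)]
      have := freq_le x q
      have := freq_nonneg x q
      gcongr
  have h1 : MemLp (fun q => (amp ν x k true : ℂ)⁻¹ * (((16 * Real.pi * lam : ℝ) : ℂ)⁻¹ *
      (((freq x k ^ 2 : ℝ) : ℂ) * f.regMat ν x k q true t -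
      ((freq x q ^ 2 : ℝ) : ℂ) * f.regMat ν x k q true t) +
      f.ampImage ν x k true true * (amp ν x q t : ℂ))) 2 momentum :=
    ((((hRt.const_mul _).sub hRe).const_mul _).add
      ((memLp_ofReal (memLp_amp hν hb x t)).const_mul _)).const_mul _
  refine h1.ae_eq ?_
  filter_upwards [hc] with q hq
  have h2 := congrArg (fun A : BranchMat => A true t) hq
  simp only [BranchMat.sub_apply, BranchMat.smul_apply, BranchMat.mul_apply] at h2
  rw [h2]
  simp only [ampCol, ampRow, BranchMat.mk_apply]
  field_simp
  simp

end DKernel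

end SolutionOperator

/-! ### The Hessian form in terms of the completed coefficients. -/

section QuadraticForm

variable {ν : ℝ → ℝ} {lam x k : ℝ} {f : DKernel}

namespace DKernel

/-- The local part of the Hessian form at a momentum, in terms of `ψ = amp · α`. -/
def localForm (f : DKernel) (ν : ℝ → ℝ) (x : ℝ) (ψ : Bool → ℝ → ℝ) (k : ℝ) : ℝ :=
  ∑ s, ∑ t, branchSign s * ψ s k * (f.diaMat ν x k s t).re * ψ t k

/-- The nonlocal part of the Hessian form at two momenta, in terms of `ψ = amp · α`. -/
def nonlocalForm (f : DKernel) (ν : ℝ → ℝ) (x : ℝ) (ψ : Bool → ℝ → ℝ) (z : ℝ × ℝ) : ℝ :=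
  ∑ s, ∑ t, branchSign s * ψ s z.1 * (f.regMat ν x z.1 z.2 s t).re * (branchSign t * ψ t z.2)

lemma measurable_diaMat (hν : Measurable ν) (hf : f.Admissible ν x) (s t : Bool) :
    Measurable fun k => f.diaMat ν x k s t := by
  have h1 := hf.measurable_dia s t
  have h2 := Complex.measurable_ofReal.comp (measurable_amp hν x s)
  have h3 := Complex.measurable_ofReal.comp (measurable_amp hν x t)
  have h4 := Complex.measurable_ofReal.comp (measurable_freq x)
  have h5 : Measurable fun k => if s = t then (branchSign s * freq x k : ℂ) else 0 := by
    split_ifs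
    · exact h4.const_mul _
    · exact measurable_const
  exact h5.sub (((h2.mul h1).mul h3).mul_const _)

/-- In the variable `u = wt·α`, the multiplication part `2·freq/absWt` and the Dirac part merge into
the single matrix `diaMat`, paired with the signs of the branches. -/
lemma hessianDia_eq (hb : BoundedDensity ν) (hk : k ∈ Ioo 0 Real.pi) (α : Bool → ℝ → ℝ) :
    hessianDia ν x f (fun P => branchSign P.2 * absWt x P.1 * α P.2 P.1) k =
      2 * f.localForm ν x (fun s k => amp ν x k s * α s k) k := by
  have hW := absWt_pos (x := x) hk
  have hE := freq_pos (x := x) hk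
  have e1 := amp_sq (x := x) hb hk true
  have e2 := amp_sq (x := x) hb hk false
  have f1 : frac ν k true = amp ν x k true ^ 2 / absWt x k := by field_simp; linarith
  have f2 : frac ν k false = amp ν x k false ^ 2 / absWt x k := by field_simp; linarith
  simp only [hessianDia, localForm, Fintype.sum_bool, rhoStar_mul hk, diaMat, BranchMat.mk_apply,
    f1, f2]
  simp
  field_simp
  ring

lemma integrable_nonlocalForm (hν : Measurable ν) (hb : BoundedDensity ν)
    (hf : f.Admissible ν x) {ψ : Bool → ℝ → ℝ} (hψ : ∀ s, MemLp (ψ s) 2 momentum) (s t : Bool) :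
    Integrable (fun z : ℝ × ℝ => branchSign s * ψ s z.1 * (f.regMat ν x z.1 z.2 s t).re *
      (branchSign t * ψ t z.2)) (momentum.prod momentum) := by
  have h1 := BranchMat.memLp_iff.mp (hf.memLp_regMat hν hb) s t
  have h2 : MemLp (fun z : ℝ × ℝ => (f.regMat ν x z.1 z.2 s t).re) 2 (momentum.prod momentum) :=
    h1.re
  refine ((h2.integrable_mul (memLp_two_mul_prod (hψ s) (hψ t))).const_mul
    (branchSign s * branchSign t)).congr (Eventually.of_forall fun z => ?_)
  simp only [Pi.mul_apply]
  ring

lemma integral_reg_form (hν : Measurable ν) (hb : BoundedDensity ν) (hf : f.Admissible ν x)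
    {α : Bool → ℝ → ℝ} (hψ : ∀ s, MemLp (fun k => amp ν x k s * α s k) 2 momentum) :
    ∫ z : Mode × Mode, branchSign z.1.2 * absWt x z.1.1 * α z.1.2 z.1.1 * (f.reg z.1 z.2).re *
      (branchSign z.2.2 * absWt x z.2.1 * α z.2.2 z.2.1) ∂(modes ν).prod (modes ν) =
    ∫ z, f.nonlocalForm ν x (fun s k => amp ν x k s * α s k) z ∂momentum.prod momentum := by
  have key : ∀ s t : Bool, (fun z : ℝ × ℝ => branchSign s * (amp ν x z.1 s * α s z.1) *
      (f.regMat ν x z.1 z.2 s t).re * (branchSign t * (amp ν x z.2 t * α t z.2)))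
      =ᵐ[momentum.prod momentum] fun z : ℝ × ℝ => (frac ν z.1 s * frac ν z.2 t) •
      (branchSign s * absWt x z.1 * α s z.1 * (f.reg (z.1, s) (z.2, t)).re *
      (branchSign t * absWt x z.2 * α t z.2)) := by
    intro s t
    filter_upwards [Measure.quasiMeasurePreserving_fst.ae ae_mem_momentum,
      Measure.quasiMeasurePreserving_snd.ae ae_mem_momentum] with z h1 h2
    have e : (f.regMat ν x z.1 z.2 s t).re =
        amp ν x z.1 s * (f.reg (z.1, s) (z.2, t)).re * amp ν x z.2 t := by
      simp [regMat, BranchMat.mk_apply]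
    have e1 := amp_sq (x := x) hb h1 s
    have e2 := amp_sq (x := x) hb h2 t
    rw [e, smul_eq_mul]
    calc _ = branchSign s * branchSign t * α s z.1 * α t z.2 * (f.reg (z.1, s) (z.2, t)).re *
          (amp ν x z.1 s ^ 2 * amp ν x z.2 t ^ 2) := by ring
      _ = _ := by rw [e1, e2]; ring
  have hi := fun s t => integrable_nonlocalForm hν hb hf hψ s t
  rw [integral_modes_prod hν hb fun s t => (hi s t).congr (key s t)]
  refine integral_congr_ae ?_
  filter_upwards [key true true, key true false, key false true, key false false]
    with z h1 h2 h3 h4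
  simp only [nonlocalForm, Fintype.sum_bool, h1, h2, h3, h4]

/-- Positivity of the Hessian, in terms of the completed local part and the regular part. -/
lemma HessianPosDef.form_pos (hν : Measurable ν) (hb : BoundedDensity ν) (hf : f.Admissible ν x)
    (hp : f.HessianPosDef ν x) {α : Bool → ℝ → ℝ} (hα : ∀ s, Measurable (α s))
    (hψ : ∀ s, MemLp (fun k => amp ν x k s * α s k) 2 momentum)
    (hL : Integrable (f.localForm ν x fun s k => amp ν x k s * α s k) momentum)
    (hne : ¬ ∀ s, ∀ᵐ k ∂momentum, amp ν x k s * α s k = 0) :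
    0 < ∫ k, f.localForm ν x (fun s k => amp ν x k s * α s k) k ∂momentum -
      ∫ z, f.nonlocalForm ν x (fun s k => amp ν x k s * α s k) z ∂momentum.prod momentum := by
  have hdia : (fun k => hessianDia ν x f (fun P => branchSign P.2 * absWt x P.1 * α P.2 P.1) k)
      =ᵐ[momentum] fun k => 2 * f.localForm ν x (fun s k => amp ν x k s * α s k) k := by
    filter_upwards [ae_mem_momentum] with k hk using hessianDia_eq hb hk α
  have hu : Measurable fun P : Mode => branchSign P.2 * absWt x P.1 * α P.2 P.1 :=
    measurable_from_prod_countable_left fun s =>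
      ((measurable_absWt x).const_mul (branchSign s)).mul (hα s)
  have h := hp _ hu ?_ ((hL.const_mul 2).congr hdia.symm) ?_
  · rw [hessianForm, integral_congr_ae hdia, integral_const_mul, integral_reg_form hν hb hf hψ] at h
    linarith
  · rw [integrable_modes_iff hν hb]
    intro s
    refine ((memLp_two_iff_integrable_sq (hψ s).1).mp (hψ s)).congr ?_
    filter_upwards [ae_mem_momentum] with k hk
    have hW := absWt_pos (x := x) hk
    rw [mul_pow, amp_sq hb hk, wt_eq hk, abs_mul, abs_branchSign, abs_of_pos hW, one_mul,
      smul_eq_mul, mul_pow, mul_pow, branchSign_sq]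
    field_simp
  · intro h0
    refine hne fun s => ?_
    have h1 := (ae_modes_iff hν hb).mp h0 s
    filter_upwards [h1, ae_mem_momentum] with k hk hk'
    by_cases hs : frac ν k s = 0
    · simp [amp, hs]
    · have h2 := hk hs
      have hW := (absWt_pos (x := x) hk').ne'
      have hb' : branchSign s ≠ 0 := by cases s <;> simp
      simp only [Pi.zero_apply, mul_eq_zero, hW, hb', false_or] at h2
      rw [h2, mul_zero]

end DKernel

end QuadraticForm

/-! ### A negative eigenvalue of the squared operator excludes positivity. -/

section Instability

variable {ν : ℝ → ℝ} {lam x t : ℝ} {f : DKernel}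

lemma integrable_gapWt_resolvent (hν : Measurable ν) (hb : BoundedDensity ν) (x : ℝ) (ht : 0 < t) :
    Integrable (fun k => gapWt ν x k / (freq x k ^ 2 + t)) momentum := by
  have hm : Measurable fun k => gapWt ν x k / (freq x k ^ 2 + t) := by
    have := measurable_gapWt hν x
    have := measurable_freq x
    fun_prop
  refine ((integrable_gapWt hν hb x).div_const t).mono' hm.aestronglyMeasurable ?_
  filter_upwards [ae_gapWt_nonneg hb x] with k hk
  have := sq_nonneg (freq x k)
  rw [Real.norm_of_nonneg (by positivity)]
  gcongr
  linarith

/-- The resolvent vector `(freq² + t)⁻¹ amp`. -/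
def resAmp (ν : ℝ → ℝ) (x t : ℝ) (s : Bool) (k : ℝ) : ℝ := amp ν x k s * (freq x k ^ 2 + t)⁻¹

lemma memLp_resAmp (hν : Measurable ν) (hb : BoundedDensity ν) (x : ℝ) (ht : 0 < t) (s : Bool) :
    MemLp (resAmp ν x t s) 2 momentum := by
  refine MemLp.of_le_mul (c := t⁻¹) (memLp_amp hν hb x s) ?_ (Eventually.of_forall fun k => ?_)
  · have h1 := measurable_amp hν x s
    have h2 := measurable_freq x
    exact (h1.mul ((h2.pow_const 2).add_const t).inv).aestronglyMeasurable
  · have := sq_nonneg (freq x k)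
    rw [resAmp, norm_mul, mul_comm, norm_inv, Real.norm_of_nonneg (by positivity)]
    gcongr
    linarith

lemma resAmp_sub (hb : BoundedDensity ν) (x t : ℝ) :
    ∀ᵐ k ∂momentum, amp ν x k true * resAmp ν x t true k - amp ν x k false * resAmp ν x t false k =
      gapWt ν x k / (freq x k ^ 2 + t) := by
  filter_upwards [ae_mem_momentum] with k hk
  rw [← amp_sub hb hk, resAmp, resAmp]
  ring

namespace DKernel

/-- If the perturbation determinant vanishes at a negative energy `-t`, the Riccati equation has no
solution with positive definite Hessian. -/
lemma IsSolution.not_hessianPosDef (hν : Measurable ν) (hb : BoundedDensity ν) (hlam : lam ≠ 0)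
    (ht : 0 < t)
    (hD : 1 + 16 * Real.pi * lam * ∫ k, gapWt ν x k / (freq x k ^ 2 + t) ∂momentum = 0)
    (hf : f.IsSolution ν lam x) : ¬ f.HessianPosDef ν x := by
  intro hp
  obtain ⟨g, hg⟩ : ∃ g, g = 16 * Real.pi * lam := ⟨_, rfl⟩
  rw [← hg] at hD
  have hR := hf.1.memLp_regMat hν hb
  have hV := memLp_ampCol hν hb x
  have hV' := memLp_ampRow hν hb x
  have hB' := hf.memLp_ampImage' hν hb hlam
  have hcomm := hf.commutator hν hb
  have het : ∀ k, 0 < freq x k ^ 2 + t := fun k => by positivity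
  -- The eigenvector of the rank one perturbation at `-t`, present because the determinant vanishes
  -- there.
  obtain ⟨Ψ, hΨd⟩ : ∃ Ψ : ℝ → BranchMat, Ψ = fun k => (freq x k ^ 2 + t)⁻¹ • ampCol ν x k :=
    ⟨_, rfl⟩
  have hΨk : ∀ k, (freq x k ^ 2 + t)⁻¹ • ampCol ν x k = Ψ k := fun k => by rw [hΨd]
  have Ψt : ∀ k s, Ψ k s true = resAmp ν x t s k := by
    intro k s
    rw [← hΨk, BranchMat.smul_apply]
    simp only [ampCol, BranchMat.mk_apply, if_true, resAmp]
    push_cast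
    ring
  have Ψf : ∀ k s, Ψ k s false = 0 := by
    intro k s
    rw [← hΨk, BranchMat.smul_apply]
    simp [ampCol, BranchMat.mk_apply]
  have hΨ : MemLp Ψ 2 momentum := by
    refine BranchMat.memLp_iff.mpr fun s t' => ?_
    cases t'
    · simp only [Ψf]
      exact MemLp.zero
    · simp only [Ψt]
      exact memLp_ofReal (memLp_resAmp hν hb x ht s)
  have hA := apply_resolvent_of_commutator (J := signMat) (L := f.diaMat ν x)
    (Eventually.of_forall fun k => (het k).ne') hR hV hV' hB' (by rw [← hΨd]; exact hΨ) hcomm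
  have hS := sq_apply_of_riccati hR (memLp_ampCol_mul_ampRow hν hb x (16 * Real.pi * lam))
    (hf.diaMat_sq hb) (Eventually.of_forall fun k => signMat_mul_diaMat hf.1 k)
    (hf.riccati_regMat hν hb) hΨ
  rw [← hg] at hA hS
  simp only [hΨk] at hA
  have iV' := integrable_mul_mul hV' hΨ signMat
  have iB' := integrable_mul_mul hB' hΨ signMat
  obtain ⟨D, hDd⟩ : ∃ D : BranchMat, D = 1 + g • ∫ r, ampRow ν x r * signMat * Ψ r ∂momentum :=
    ⟨_, rfl⟩
  obtain ⟨C, hCd⟩ : ∃ C : BranchMat, C = g • ∫ r, f.ampImage' ν x r * signMat * Ψ r ∂momentum :=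
    ⟨_, rfl⟩
  rw [← hDd, ← hCd] at hA
  -- Only the first row of `D` acts on a one-column matrix, and its relevant entry is the
  -- perturbation determinant, zero by `hD`.
  have Dt : ∀ s, D true s = 0 := by
    intro s
    rw [hDd, BranchMat.add_apply, BranchMat.smul_apply, BranchMat.integral_apply iV',
      BranchMat.one_apply]
    cases s
    · simp [BranchMat.mul_apply, Ψf]
    · rw [if_pos rfl]
      have e : ∫ r, (ampRow ν x r * signMat * Ψ r) true true ∂momentum =
          ((∫ k, gapWt ν x k / (freq x k ^ 2 + t) ∂momentum : ℝ) : ℂ) := by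
        rw [← integral_complex_ofReal]
        refine integral_congr_ae ?_
        filter_upwards [resAmp_sub hb x t] with r hr
        rw [← hr]
        simp [BranchMat.mul_apply, ampRow, signMat, BranchMat.mk_apply, Ψt]
        ring
      rw [e]
      exact_mod_cast hD
  have mulD : ∀ A : BranchMat, (∀ s, A s false = 0) → A * D = 0 := by
    intro A hA'
    refine BranchMat.ext fun s s' => ?_
    rw [BranchMat.mul_apply, Dt, hA', mul_zero, zero_mul, add_zero]
    rfl
  have hVD : ∀ k, ampCol ν x k * D = 0 := fun k => mulD _ fun s => by
    simp [ampCol, BranchMat.mk_apply]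
  have Cft : C false true = 0 := by
    rw [hCd, BranchMat.smul_apply, BranchMat.integral_apply iB']
    have : ∫ r, (f.ampImage' ν x r * signMat * Ψ r) false true ∂momentum = 0 := by
      refine integral_eq_zero_of_ae ?_
      filter_upwards [ampImage'_false hν hb hf.1] with r hr
      simp [BranchMat.mul_apply, hr]
    rw [this, mul_zero]
  -- With the determinant gone, the resolvent formula shows that `Ψ` is an eigenvector of `T`
  -- itself: `C` acts on it through its single entry `c`.
  have hT : ∀ᵐ k ∂momentum, f.diaMat ν x k * Ψ k - ∫ r, f.regMat ν x k r * signMat * Ψ r ∂momentum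
      = -(Ψ k * C) := by
    filter_upwards [hA, ampImage_false hν hb hf.1] with k hk hk'
    have h1 : (f.diaMat ν x k * ampCol ν x k -
        ∫ r, f.regMat ν x k r * signMat * ampCol ν x r ∂momentum) * D = 0 := mulD _ hk'
    rw [h1, zero_sub] at hk
    have h2 := congrArg (fun A : BranchMat => (freq x k ^ 2 + t)⁻¹ • A) hk
    simp only [smul_smul, inv_mul_cancel₀ (het k).ne', one_smul, smul_neg] at h2
    rw [h2, ← smul_mul_assoc, hΨk]
  obtain ⟨c, hc⟩ : ∃ c, c = C true true := ⟨_, rfl⟩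
  -- Apply `T` twice. The formula for `T²` gives `freq²·Ψ - V = -tΨ`, and the eigenvector relation
  -- gives `c²Ψ`; one momentum with non-zero amplitude suffices to compare.
  have hc2 : c ^ 2 = -t := by
    obtain ⟨k, hk, hS, hT', hRk⟩ := (ae_mem_momentum.and (hS.and (hT.and
      (memLp_two_section hR)))).exists
    have h1 : ∫ r, f.regMat ν x k r * signMat * (f.diaMat ν x r * Ψ r -
        ∫ s, f.regMat ν x r s * signMat * Ψ s ∂momentum) ∂momentum =
        -((∫ r, f.regMat ν x k r * signMat * Ψ r ∂momentum) * C) := by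
      rw [← integral_mul_const_of_integrable (integrable_mul_mul hRk hΨ signMat), ← integral_neg]
      refine integral_congr_ae ?_
      filter_upwards [hT] with r hr
      rw [hr, mul_neg, mul_assoc (f.regMat ν x k r * signMat)]
    have h2 : ∫ r, g • (ampCol ν x k * ampRow ν x r) * signMat * Ψ r ∂momentum =
        -ampCol ν x k := by
      have e : ∫ r, g • (ampCol ν x k * ampRow ν x r) * signMat * Ψ r ∂momentum =
          ampCol ν x k * (g • ∫ r, ampRow ν x r * signMat * Ψ r ∂momentum) := by
        rw [mul_smul_comm, ← integral_const_mul_of_integrable iV', ← integral_smul]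
        simp only [smul_mul_assoc, mul_assoc]
      have e2 : g • ∫ r, ampRow ν x r * signMat * Ψ r ∂momentum = D - 1 := by rw [hDd]; abel
      rw [e, e2, mul_sub, hVD, mul_one, zero_sub]
    rw [h1, h2, hT', mul_neg, sub_neg_eq_add, ← mul_assoc, neg_add_eq_sub,
      ← neg_sub, ← sub_mul, hT', neg_mul, neg_neg, mul_assoc] at hS
    have h3 : ampCol ν x k = (freq x k ^ 2 + t) • Ψ k := by
      rw [← hΨk, smul_smul, mul_inv_cancel₀ (het k).ne', one_smul]
    have h4 := congrArg (fun A : BranchMat => A true true) hS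
    rw [h3] at h4
    simp only [BranchMat.add_apply, BranchMat.neg_apply, BranchMat.smul_apply,
      BranchMat.mul_apply, Cft, Ψf] at h4
    have h5 : Ψ k true true ≠ 0 := by
      rw [Ψt, resAmp]
      exact_mod_cast mul_ne_zero (amp_true_pos hb hk).ne' (inv_ne_zero (het k).ne')
    refine mul_left_cancel₀ h5 ?_
    push_cast at h4
    rw [hc]
    linear_combination h4
  have hcre : c.re = 0 := by
    have h1 := congrArg Complex.re hc2
    have h2 := congrArg Complex.im hc2
    simp [pow_two] at h1 h2
    by_contra h
    have h3 : c.im = 0 := by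
      have : c.re * c.im = 0 := by linarith
      exact (mul_eq_zero.mp this).resolve_left h
    rw [h3] at h1
    nlinarith [mul_self_pos.mpr h]
  have hψ : ∀ s, MemLp (fun k => amp ν x k s * (freq x k ^ 2 + t)⁻¹) 2 momentum :=
    memLp_resAmp hν hb x ht
  have hi := fun s s' => integrable_nonlocalForm hν hb hf.1 hψ s s'
  have hN : Integrable (f.nonlocalForm ν x fun s k => amp ν x k s * (freq x k ^ 2 + t)⁻¹)
      (momentum.prod momentum) :=
    integrable_finsetSum _ fun s _ => integrable_finsetSum _ fun s' _ => hi s s'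
  -- `Ψ` is real and `c` imaginary, so the real part of `TΨ` vanishes. The local form therefore
  -- equals the integrated nonlocal one, which also supplies its integrability.
  have hloc : ∀ᵐ k ∂momentum, f.localForm ν x (fun s k => amp ν x k s * (freq x k ^ 2 + t)⁻¹) k =
      ∫ r, f.nonlocalForm ν x (fun s k => amp ν x k s * (freq x k ^ 2 + t)⁻¹) (k, r)
        ∂momentum := by
    filter_upwards [hT, memLp_two_section hR] with k hk hRk
    have iR := integrable_mul_mul hRk hΨ signMat
    have h1 : ∀ s, ∑ s', (f.diaMat ν x k s s').re * resAmp ν x t s' k -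
        ∫ r, ∑ s', (f.regMat ν x k r s s').re * (branchSign s' * resAmp ν x t s' r) ∂momentum = 0 := by
      intro s
      have h2 := congrArg (fun A : BranchMat => (A s true).re) hk
      simp only [BranchMat.sub_apply, BranchMat.neg_apply, BranchMat.integral_apply iR,
        Complex.sub_re, Complex.neg_re] at h2
      rw [← RCLike.re_eq_complex_re, ← integral_re (BranchMat.integrable_apply iR s true)] at h2
      simp only [BranchMat.mul_apply, Ψt, Ψf, Cft, ← hc, signMat, BranchMat.mk_apply,
        RCLike.re_eq_complex_re] at h2
      simp [hcre] at h2
      simp only [Fintype.sum_bool]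
      simp
      rw [← h2]
    have h2 : ∀ s s', Integrable (fun r => (f.regMat ν x k r s s').re *
        (branchSign s' * resAmp ν x t s' r)) momentum := fun s s' =>
      (BranchMat.memLp_iff.mp hRk s s').re.integrable_mul ((hψ s').const_mul (branchSign s'))
    have h3 : ∫ r, f.nonlocalForm ν x (fun s k => amp ν x k s * (freq x k ^ 2 + t)⁻¹) (k, r)
        ∂momentum = ∑ s, branchSign s * resAmp ν x t s k *
        ∫ r, ∑ s', (f.regMat ν x k r s s').re * (branchSign s' * resAmp ν x t s' r) ∂momentum := by
      simp_rw [← integral_const_mul]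
      rw [← integral_finsetSum _ fun s _ => (integrable_finsetSum _ fun s' _ => h2 s s').const_mul _]
      simp only [nonlocalForm, Finset.mul_sum, resAmp, mul_assoc]
    rw [h3, localForm]
    refine Finset.sum_congr rfl fun s _ => ?_
    rw [← sub_eq_zero.mp (h1 s), Finset.mul_sum]
    exact Finset.sum_congr rfl fun s' _ => mul_assoc _ _ _
  have h0 : ∫ k, f.localForm ν x (fun s k => amp ν x k s * (freq x k ^ 2 + t)⁻¹) k ∂momentum =
      ∫ z, f.nonlocalForm ν x (fun s k => amp ν x k s * (freq x k ^ 2 + t)⁻¹) z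
        ∂momentum.prod momentum := by
    rw [integral_prod _ hN]
    exact integral_congr_ae hloc
  have hpos := hp.form_pos hν hb hf.1 (α := fun _ k => (freq x k ^ 2 + t)⁻¹)
    (fun s => ((measurable_freq x).pow_const 2 |>.add_const t).inv) hψ
    (hN.integral_prod_left.congr (hloc.mono fun k hk => hk.symm)) ?_
  · linarith
  · intro h
    obtain ⟨k, hk, h1⟩ := (ae_mem_momentum.and (h true)).exists
    exact mul_ne_zero (amp_true_pos hb hk).ne' (inv_ne_zero (het k).ne') h1

end DKernel

end Instability

/-! ### From an unstable second variation to a zero of the determinant. -/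

section Instability

variable {ν : ℝ → ℝ} {h lam x t : ℝ} {f : DKernel}

/-- Fatou's lemma as `t ↓ 0`. It lets a divergent integral at `t = 0` be treated like one that is
too large. -/
lemma integrable_of_resolvent_le (hν : Measurable ν) (hb : BoundedDensity ν) {M : ℝ} (hM : 0 ≤ M)
    (hF : ∀ t, 0 < t → ∫ k, gapWt ν x k / (freq x k ^ 2 + t) ∂momentum ≤ M) :
    Integrable (fun k => gapWt ν x k / freq x k ^ 2) momentum ∧
      ∫ k, gapWt ν x k / freq x k ^ 2 ∂momentum ≤ M := by
  have hm : ∀ t, Measurable fun k => gapWt ν x k / (freq x k ^ 2 + t) := fun t => by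
    have := measurable_gapWt hν x
    have := measurable_freq x
    fun_prop
  have hm0 : Measurable fun k => gapWt ν x k / freq x k ^ 2 := by simpa using hm 0
  have h0 : ∀ t, 0 ≤ t → ∀ᵐ k ∂momentum, 0 ≤ gapWt ν x k / (freq x k ^ 2 + t) := fun t ht => by
    filter_upwards [ae_gapWt_nonneg hb x] with k hk
    have := sq_nonneg (freq x k)
    positivity
  have h0' : ∀ᵐ k ∂momentum, 0 ≤ gapWt ν x k / freq x k ^ 2 := by simpa using h0 0 le_rfl
  have hfatou : ∫⁻ k, ENNReal.ofReal (gapWt ν x k / freq x k ^ 2) ∂momentum ≤ ENNReal.ofReal M := by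
    calc _ = ∫⁻ k, liminf (fun t => ENNReal.ofReal (gapWt ν x k / (freq x k ^ 2 + t)))
          (𝓝[>] 0) ∂momentum := by
          refine lintegral_congr_ae ?_
          filter_upwards [ae_freq_pos x] with k hk
          have hc : ContinuousAt (fun t => ENNReal.ofReal (gapWt ν x k / (freq x k ^ 2 + t))) 0 := by
            refine ENNReal.continuous_ofReal.continuousAt.comp
              (continuousAt_const.div (by fun_prop) ?_)
            positivity
          have := (hc.tendsto.mono_left (nhdsWithin_le_nhds (s := Ioi 0))).liminf_eq
          simp only [add_zero] at this
          exact this.symm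
      _ ≤ liminf (fun t => ∫⁻ k, ENNReal.ofReal (gapWt ν x k / (freq x k ^ 2 + t)) ∂momentum)
          (𝓝[>] 0) := lintegral_liminf_le' fun t => (hm t).ennreal_ofReal.aemeasurable
      _ ≤ ENNReal.ofReal M := by
          refine Filter.liminf_le_of_frequently_le' (Eventually.frequently ?_)
          filter_upwards [self_mem_nhdsWithin] with t (ht : 0 < t)
          rw [← ofReal_integral_eq_lintegral_ofReal (integrable_gapWt_resolvent hν hb x ht)
            (h0 t ht.le)]
          exact ENNReal.ofReal_le_ofReal (hF t ht)
  have hI : Integrable (fun k => gapWt ν x k / freq x k ^ 2) momentum := by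
    refine ⟨hm0.aestronglyMeasurable, ?_⟩
    rw [hasFiniteIntegral_iff_ofReal h0']
    exact hfatou.trans_lt ENNReal.ofReal_lt_top
  refine ⟨hI, ?_⟩
  rw [← ofReal_integral_eq_lintegral_ofReal hI h0'] at hfatou
  exact (ENNReal.ofReal_le_ofReal_iff hM).mp hfatou

lemma continuousOn_resolvent (hν : Measurable ν) (hb : BoundedDensity ν) (x : ℝ) :
    ContinuousOn (fun t => ∫ k, gapWt ν x k / (freq x k ^ 2 + t) ∂momentum) (Ioi 0) := by
  intro t (ht : 0 < t)
  refine ContinuousAt.continuousWithinAt ?_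
  refine continuousAt_of_dominated (bound := fun k => gapWt ν x k / (t / 2)) ?_ ?_
    ((integrable_gapWt hν hb x).div_const _) ?_
  · refine Eventually.of_forall fun t => Measurable.aestronglyMeasurable ?_
    have := measurable_gapWt hν x
    have := measurable_freq x
    fun_prop
  · filter_upwards [lt_mem_nhds (half_lt_self ht)] with s hs
    filter_upwards [ae_gapWt_nonneg hb x] with k hk
    have := sq_nonneg (freq x k)
    have : 0 < s := (half_pos ht).trans hs
    rw [Real.norm_of_nonneg (by positivity)]
    gcongr
    linarith
  · filter_upwards with k
    exact continuousAt_const.div (by fun_prop) (by positivity)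

/-- If the second variation has the unstable sign, the perturbation determinant has a zero. -/
lemma exists_resolvent_zero (hν : Measurable ν) (hb : BoundedDensity ν) (hlam : lam < 0)
    (hS : ¬ (Integrable (fun k => curv x k * gap ν k) momentum ∧
      0 ≤ 1 + 2 * lam / Real.pi * ∫ k, curv x k * gap ν k ∂momentum)) :
    ∃ t, 0 < t ∧
      1 + 16 * Real.pi * lam * ∫ k, gapWt ν x k / (freq x k ^ 2 + t) ∂momentum = 0 := by
  obtain ⟨G, hG⟩ : ∃ G, G = -(16 * Real.pi * lam) := ⟨_, rfl⟩
  have hG0 : 0 < G := by rw [hG]; nlinarith [Real.pi_pos]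
  set F : ℝ → ℝ := fun t => ∫ k, gapWt ν x k / (freq x k ^ 2 + t) ∂momentum with hF
  -- If `F` never exceeded `1/G`, the limit at `t = 0` would make the second variation finite with
  -- the stable sign.
  have h1 : ∃ t, 0 < t ∧ 1 / G < F t := by
    by_contra! hcon
    obtain ⟨hI, hle⟩ := integrable_of_resolvent_le hν hb (by positivity) hcon
    refine hS ⟨integrable_gapWt_div_iff.mp hI, ?_⟩
    rw [← det_zero_eq, show 16 * Real.pi * lam = -G by rw [hG]; ring]
    rw [le_div_iff₀ hG0] at hle
    linarith
  obtain ⟨t1, ht1, h1⟩ := h1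
  set m := ∫ k, gapWt ν x k ∂momentum with hm
  have hm0 : 0 ≤ m := integral_nonneg_of_ae (ae_gapWt_nonneg hb x)
  -- Large enough that `F t2 ≤ m/t2 ≤ 1/G`. The intermediate value theorem then finds the zero
  -- between `t1` and `t2`.
  obtain ⟨t2, ht2⟩ : ∃ t2, t2 = t1 + G * m := ⟨_, rfl⟩
  have h12 : t1 ≤ t2 := by rw [ht2]; nlinarith
  have ht2' : 0 < t2 := by linarith
  have h2 : F t2 ≤ 1 / G := by
    have : F t2 ≤ m / t2 := by
      rw [hm, ← integral_div]
      refine integral_mono_ae (integrable_gapWt_resolvent hν hb x ht2')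
        ((integrable_gapWt hν hb x).div_const _) ?_
      filter_upwards [ae_gapWt_nonneg hb x] with k hk
      have := sq_nonneg (freq x k)
      gcongr
      linarith
    refine this.trans ?_
    rw [div_le_div_iff₀ ht2' hG0]
    nlinarith
  have hcont : ContinuousOn F (Icc t1 t2) :=
    (continuousOn_resolvent hν hb x).mono fun t ht => ht1.trans_le ht.1
  obtain ⟨t, ht, hFt⟩ := intermediate_value_Icc' h12 hcont ⟨h2, h1.le⟩
  refine ⟨t, ht1.trans_le ht.1, ?_⟩
  change 1 + 16 * Real.pi * lam * F t = 0
  rw [hFt, show 16 * Real.pi * lam = -G by rw [hG]; ring]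
  field_simp
  ring

lemma second_variation_eq_zero {I : ℝ} (hlam : lam ≠ 0) (h0 : 1 + 2 * lam / Real.pi * I = 0) :
    -(1 / Real.pi) * I - 1 / (2 * lam) = 0 := by
  have hpi := Real.pi_pos
  have : -(1 / Real.pi) * I - 1 / (2 * lam) = -(1 + 2 * lam / Real.pi * I) / (2 * lam) := by
    field_simp
    ring
  rw [this, h0]
  simp

/-- A solution with positive definite Hessian forces stability. -/
theorem stable_of_solution (hν : Measurable ν) (hb : BoundedDensity ν) (hlam : lam < 0)
    (hnondeg : ¬ HasDerivAt (deriv (energy ν h lam)) 0 x)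
    (hf : f.IsSolution ν lam x) (hp : f.HessianPosDef ν x) :
    Integrable (fun k => curv x k * gap ν k) momentum ∧
      0 < 1 + 2 * lam / Real.pi * ∫ k, curv x k * gap ν k ∂momentum := by
  by_cases hS : Integrable (fun k => curv x k * gap ν k) momentum ∧
      0 ≤ 1 + 2 * lam / Real.pi * ∫ k, curv x k * gap ν k ∂momentum
  -- A vanishing determinant would make the second derivative of the energy exist and be zero:
  -- nondegeneracy excludes the marginal case.
  · refine ⟨hS.1, lt_of_le_of_ne hS.2 fun h0 => hnondeg ?_⟩
    refine (hasDerivAt_deriv_energy hν hb h lam hS.1).congr_deriv ?_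
    exact second_variation_eq_zero hlam.ne h0.symm
  · obtain ⟨t, ht, hD⟩ := exists_resolvent_zero hν hb hlam hS
    exact absurd hp (hf.not_hessianPosDef hν hb hlam.ne ht hD)

end Instability

/-! ### The equivalence. -/

/-- Existence of a solution with positive definite Hessian is equivalent to stability. -/
theorem exists_solution_iff {ν : ℝ → ℝ} {h lam x : ℝ} (hν : Measurable ν) (hb : BoundedDensity ν)
    (hgap : ∀ᵐ k ∂momentum, 0 < gap ν k) (hlam : lam ≠ 0) (hx : MeanField ν h lam x)
    (hnondeg : ¬ HasDerivAt (deriv (energy ν h lam)) 0 x) :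
    (∃ f : DKernel, f.IsSolution ν lam x ∧ f.HessianPosDef ν x) ↔
      ((0 ≤ lam ∧ IsLocalMax (energy ν h lam) x) ∨
        (lam < 0 ∧ IsLocalMin (energy ν h lam) x)) := by
  rcases hlam.lt_or_gt with hl | hl
  · constructor
    · rintro ⟨f, hf, hp⟩
      obtain ⟨hI, hΔ⟩ := stable_of_solution hν hb hl hnondeg hf hp
      exact Or.inr ⟨hl, isLocalMin_energy hν hb hl hx hI hΔ⟩
    · rintro (⟨h0, -⟩ | ⟨-, hmin⟩)
      · exact absurd h0 hl.not_ge
      · obtain ⟨hI, h0⟩ := integrable_of_isLocalMin hν hb hl hx hmin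
        refine exists_solution_of_stable hν hb hgap (Or.inr ⟨hl, hI, lt_of_le_of_ne h0 fun h1 =>
          hnondeg ?_⟩)
        refine (hasDerivAt_deriv_energy hν hb h lam hI).congr_deriv ?_
        exact second_variation_eq_zero hl.ne h1.symm
  -- At positive coupling both sides always hold, the maximum being global by concavity of the
  -- energy.
  · refine ⟨fun _ => Or.inl ⟨hl.le, ?_⟩, fun _ => exists_solution_of_stable hν hb hgap (Or.inl hl)⟩
    exact Eventually.of_forall (energy_le_of_meanField hν hb hl hx)

/-! ### Uniqueness for the scalar Riccati equation. -/

section ScalarUniqueness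

open ComplexConjugate

variable {X : Type*} [MeasurableSpace X] {μ : Measure X}

lemma sq_norm_integral_mul_le {f g : X → ℂ} (hf : MemLp f 2 μ) (hg : MemLp g 2 μ) :
    ‖∫ r, f r * g r ∂μ‖ ^ 2 ≤ (∫ r, ‖f r‖ ^ 2 ∂μ) * ∫ r, ‖g r‖ ^ 2 ∂μ := by
  have h2 : (2 : ENNReal) = ENNReal.ofReal 2 := by norm_num
  have h1 := integral_mul_norm_le_Lp_mul_Lq Real.HolderConjugate.two_two
    (h2 ▸ hf : MemLp f (ENNReal.ofReal 2) μ) (h2 ▸ hg : MemLp g (ENNReal.ofReal 2) μ)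
  simp only [Real.rpow_two, ← Real.sqrt_eq_rpow] at h1
  have h3 : ‖∫ r, f r * g r ∂μ‖ ≤ √(∫ r, ‖f r‖ ^ 2 ∂μ) * √(∫ r, ‖g r‖ ^ 2 ∂μ) := by
    refine (norm_integral_le_integral_norm _).trans ?_
    simpa only [norm_mul] using h1
  have h4 : 0 ≤ ∫ r, ‖f r‖ ^ 2 ∂μ := integral_nonneg fun r => by positivity
  have h5 : 0 ≤ ∫ r, ‖g r‖ ^ 2 ∂μ := integral_nonneg fun r => by positivity
  calc _ ≤ (√(∫ r, ‖f r‖ ^ 2 ∂μ) * √(∫ r, ‖g r‖ ^ 2 ∂μ)) ^ 2 := by gcongr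
    _ = _ := by rw [mul_pow, Real.sq_sqrt h4, Real.sq_sqrt h5]

variable {E θ : X → ℝ}

lemma memLp_bdd_mul (hE : Measurable E) {M : ℝ} (hEM : ∀ᵐ k ∂μ, |E k| ≤ M) {ψ : X → ℂ}
    (hψ : MemLp ψ 2 μ) : MemLp (fun k => (E k : ℂ) * ψ k) 2 μ := by
  refine MemLp.of_le_mul (c := M) hψ
    ((Complex.measurable_ofReal.comp hE).aestronglyMeasurable.mul hψ.1) ?_
  filter_upwards [hEM] with k hk
  rw [norm_mul, Complex.norm_real, Real.norm_eq_abs]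
  gcongr

lemma memLp_kernel_mul (hθ : Measurable θ) {M : ℝ} (hM : ∀ᵐ k ∂μ, |θ k| ≤ M) [SFinite μ] {Y : X → X → ℂ}
    (hY : MemLp (Function.uncurry Y) 2 (μ.prod μ)) :
    MemLp (Function.uncurry fun k q => (θ k : ℂ) * Y k q) 2 (μ.prod μ) := by
  have hθ' : Measurable fun z : X × X => θ z.1 := hθ.comp measurable_fst
  exact memLp_bdd_mul hθ' (Measure.quasiMeasurePreserving_fst.ae hM) hY

variable [SFinite μ]

/-- Square integrable kernels are closed under composition. -/
lemma memLp_two_comp {R S : X → X → ℂ} (hRm : Measurable (Function.uncurry R))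
    (hSm : Measurable (Function.uncurry S)) (hR : MemLp (Function.uncurry R) 2 (μ.prod μ))
    (hS : MemLp (Function.uncurry S) 2 (μ.prod μ)) :
    MemLp (Function.uncurry fun k q => ∫ r, R k r * S r q ∂μ) 2 (μ.prod μ) := by
  have hm : StronglyMeasurable (Function.uncurry fun k q => ∫ r, R k r * S r q ∂μ) := by
    have h1 : Measurable fun w : (X × X) × X => R w.1.1 w.2 :=
      hRm.comp (measurable_fst.fst.prodMk measurable_snd)
    have h2 : Measurable fun w : (X × X) × X => S w.2 w.1.2 :=
      hSm.comp (measurable_snd.prodMk measurable_fst.snd)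
    exact (h1.mul h2).stronglyMeasurable.integral_prod_right'
  refine (memLp_two_iff_integrable_sq_norm hm.aestronglyMeasurable).mpr ?_
  have iR := (memLp_two_iff_integrable_sq_norm hR.1).mp hR
  have iS := (memLp_two_iff_integrable_sq_norm (memLp_two_swap hS).1).mp (memLp_two_swap hS)
  refine (iR.integral_prod_left.mul_prod iS.integral_prod_left).mono'
    (hm.norm.pow 2).aestronglyMeasurable ?_
  filter_upwards [Measure.quasiMeasurePreserving_fst.ae (memLp_two_section hR),
    Measure.quasiMeasurePreserving_snd.ae (memLp_two_section (memLp_two_swap hS))] with z h1 h2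
  rw [Real.norm_of_nonneg (by positivity)]
  exact sq_norm_integral_mul_le h1 h2

/-- The quadratic form `∫ E θ |ψ|² - ∬ ψ̄ θ R θ ψ` at a complex function splits into the forms at
its real and imaginary parts. -/
lemma re_form_eq {R : X → X → ℂ}
    (hR : MemLp (Function.uncurry R) 2 (μ.prod μ)) (hsymm : ∀ k q, R k q = R q k)
    (hE : Measurable E) {M : ℝ} (hEM : ∀ k, |E k| ≤ M) (hθ : Measurable θ)
    (hθ1 : ∀ᵐ k ∂μ, |θ k| ≤ 1) {ψ : X → ℂ} (hψ : MemLp ψ 2 μ) :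
    (∫ k, conj (ψ k) * θ k * (E k * ψ k - ∫ r, R k r * (θ r * ψ r) ∂μ) ∂μ).re =
      ((∫ k, E k * θ k * (ψ k).re ^ 2 ∂μ) - ∫ z, (ψ z.1).re * θ z.1 * (R z.1 z.2).re *
        (θ z.2 * (ψ z.2).re) ∂μ.prod μ) +
      ((∫ k, E k * θ k * (ψ k).im ^ 2 ∂μ) - ∫ z, (ψ z.1).im * θ z.1 * (R z.1 z.2).re *
        (θ z.2 * (ψ z.2).im) ∂μ.prod μ) := by
  have hχ := memLp_bdd_mul hθ hθ1 hψ
  have hEψ := memLp_bdd_mul hE (Eventually.of_forall hEM) hψ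
  set χ : X → ℂ := fun k => θ k * ψ k with hχd
  have hre : MemLp (fun k => (χ k).re) 2 μ := hχ.re
  have him : MemLp (fun k => (χ k).im) 2 μ := hχ.im
  have hψre : MemLp (fun k => (ψ k).re) 2 μ := hψ.re
  have hψim : MemLp (fun k => (ψ k).im) 2 μ := hψ.im
  have hEre : MemLp (fun k => ((E k : ℂ) * ψ k).re) 2 μ := hEψ.re
  have hEim : MemLp (fun k => ((E k : ℂ) * ψ k).im) 2 μ := hEψ.im
  have hRre : MemLp (fun z : X × X => (R z.1 z.2).re) 2 (μ.prod μ) := hR.re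
  have hRim : MemLp (fun z : X × X => (R z.1 z.2).im) 2 (μ.prod μ) := hR.im
  have i1 := hRre.integrable_mul (memLp_two_mul_prod hre hre)
  have i2 := hRre.integrable_mul (memLp_two_mul_prod him him)
  have i3 := hRim.integrable_mul (memLp_two_mul_prod hre him)
  have i4 := hRim.integrable_mul (memLp_two_mul_prod him hre)
  -- As `R` is symmetric rather than Hermitian, its imaginary part pairs with an antisymmetric
  -- function and drops out of the real part.
  have e3 : ∫ z, ((fun z : X × X => (R z.1 z.2).im) * fun z : X × X => (χ z.1).re * (χ z.2).im) z ∂μ.prod μ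
      = ∫ z, ((fun z : X × X => (R z.1 z.2).im) * fun z : X × X => (χ z.1).im * (χ z.2).re) z
        ∂μ.prod μ := by
    rw [← integral_prod_swap]
    refine integral_congr_ae (Eventually.of_forall fun z => ?_)
    simp only [Pi.mul_apply, Prod.fst_swap, Prod.snd_swap, hsymm z.2 z.1]
    ring
  have iR : Integrable (fun z : X × X => conj (χ z.1) * (R z.1 z.2 * χ z.2)) (μ.prod μ) := by
    have hc : MemLp (fun k => conj (χ k)) 2 μ := hχ.star
    have h1 := integrable_triple (J := (1 : ℂ)) hR hc hχ
    refine h1.congr (Eventually.of_forall fun z => ?_)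
    simp only [mul_one, mul_assoc]
  have iE : Integrable (fun k => conj (χ k) * (E k * ψ k)) μ := by
    have hc : MemLp (fun k => conj (χ k)) 2 μ := hχ.star
    exact hc.integrable_mul hEψ
  have hLHS : ∫ k, conj (ψ k) * θ k * (E k * ψ k - ∫ r, R k r * (θ r * ψ r) ∂μ) ∂μ =
      ∫ k, conj (χ k) * (E k * ψ k) ∂μ - ∫ z, conj (χ z.1) * (R z.1 z.2 * χ z.2) ∂μ.prod μ := by
    rw [integral_prod _ iR, ← integral_sub iE iR.integral_prod_left]
    refine integral_congr_ae (Eventually.of_forall fun k => ?_)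
    simp only [integral_const_mul, hχd, map_mul, Complex.conj_ofReal]
    ring
  have hRe : ∫ z, (conj (χ z.1) * (R z.1 z.2 * χ z.2)).re ∂μ.prod μ =
      (∫ z, (χ z.1).re * (R z.1 z.2).re * (χ z.2).re ∂μ.prod μ) +
      ∫ z, (χ z.1).im * (R z.1 z.2).re * (χ z.2).im ∂μ.prod μ := by
    have h1 : ∀ z : X × X, (conj (χ z.1) * (R z.1 z.2 * χ z.2)).re =
        (((fun z : X × X => (R z.1 z.2).re) * fun z : X × X => (χ z.1).re * (χ z.2).re) z +
        ((fun z : X × X => (R z.1 z.2).re) * fun z : X × X => (χ z.1).im * (χ z.2).im) z) -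
        (((fun z : X × X => (R z.1 z.2).im) * fun z : X × X => (χ z.1).re * (χ z.2).im) z -
        ((fun z : X × X => (R z.1 z.2).im) * fun z : X × X => (χ z.1).im * (χ z.2).re) z) := by
      intro z
      simp only [Complex.mul_re, Complex.mul_im, Complex.conj_re, Complex.conj_im, Pi.mul_apply]
      ring
    simp only [h1]
    rw [integral_sub (by exact i1.add i2) (by exact i3.sub i4), integral_sub i3 i4, e3, sub_self,
      sub_zero, integral_add i1 i2]
    simp only [Pi.mul_apply]
    congr 1 <;> refine integral_congr_ae (Eventually.of_forall fun z => ?_) <;> simp only <;> ring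
  have hEe : ∫ k, (conj (χ k) * (E k * ψ k)).re ∂μ = (∫ k, E k * θ k * (ψ k).re ^ 2 ∂μ) +
      ∫ k, E k * θ k * (ψ k).im ^ 2 ∂μ := by
    have j1 : Integrable (fun k => E k * θ k * (ψ k).re ^ 2) μ := by
      refine (hre.integrable_mul hEre).congr (Eventually.of_forall fun k => ?_)
      simp [hχd]
      ring
    have j2 : Integrable (fun k => E k * θ k * (ψ k).im ^ 2) μ := by
      refine (him.integrable_mul hEim).congr (Eventually.of_forall fun k => ?_)
      simp [hχd]
      ring
    rw [← integral_add j1 j2]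
    refine integral_congr_ae (Eventually.of_forall fun k => ?_)
    simp [hχd]
    ring
  rw [hLHS, Complex.sub_re]
  have e1 : (∫ k, conj (χ k) * (E k * ψ k) ∂μ).re = ∫ k, (conj (χ k) * (E k * ψ k)).re ∂μ :=
    (integral_re iE).symm
  have e2 : (∫ z, conj (χ z.1) * (R z.1 z.2 * χ z.2) ∂μ.prod μ).re =
      ∫ z, (conj (χ z.1) * (R z.1 z.2 * χ z.2)).re ∂μ.prod μ := (integral_re iR).symm
  rw [e1, e2, hRe, hEe]
  have e5 : ∀ z : X × X, (χ z.1).re * (R z.1 z.2).re * (χ z.2).re =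
      (ψ z.1).re * θ z.1 * (R z.1 z.2).re * (θ z.2 * (ψ z.2).re) := by
    intro z; simp only [hχd, Complex.re_ofReal_mul]; ring
  have e6 : ∀ z : X × X, (χ z.1).im * (R z.1 z.2).re * (χ z.2).im =
      (ψ z.1).im * θ z.1 * (R z.1 z.2).re * (θ z.2 * (ψ z.2).im) := by
    intro z; simp only [hχd, Complex.im_ofReal_mul]; ring
  simp only [e5, e6]
  ring

/-- The positivity of the quadratic form of a complex kernel on real functions. -/
def RealFormPos (μ : Measure X) (E θ : X → ℝ) (R : X → X → ℂ) : Prop :=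
  ∀ ψ : X → ℝ, Measurable ψ → MemLp ψ 2 μ → ¬ ψ =ᵐ[μ] 0 →
    0 < ∫ k, E k * θ k * ψ k ^ 2 ∂μ - ∫ z, ψ z.1 * θ z.1 * (R z.1 z.2).re *
      (θ z.2 * ψ z.2) ∂μ.prod μ

/-- Apply the hypothesis to the real and imaginary parts of `ψ`. It is strict and excludes the zero
function, which is therefore treated apart. -/
lemma re_form_nonneg {R : X → X → ℂ}
    (hR : MemLp (Function.uncurry R) 2 (μ.prod μ)) (hsymm : ∀ k q, R k q = R q k)
    (hE : Measurable E) {M : ℝ} (hEM : ∀ k, |E k| ≤ M) (hθ : Measurable θ)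
    (hθ1 : ∀ᵐ k ∂μ, |θ k| ≤ 1) (hpos : RealFormPos μ E θ R) {ψ : X → ℂ} (hψm : Measurable ψ)
    (hψ : MemLp ψ 2 μ) :
    0 ≤ (∫ k, conj (ψ k) * θ k * (E k * ψ k - ∫ r, R k r * (θ r * ψ r) ∂μ) ∂μ).re ∧
    ((∫ k, conj (ψ k) * θ k * (E k * ψ k - ∫ r, R k r * (θ r * ψ r) ∂μ) ∂μ).re = 0 →
      ψ =ᵐ[μ] 0) := by
  rw [re_form_eq hR hsymm hE hEM hθ hθ1 hψ]
  have key : ∀ φ : X → ℝ, Measurable φ → MemLp φ 2 μ →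
      0 ≤ ∫ k, E k * θ k * φ k ^ 2 ∂μ - ∫ z, φ z.1 * θ z.1 * (R z.1 z.2).re *
        (θ z.2 * φ z.2) ∂μ.prod μ := by
    intro φ h1 h2
    by_cases h0 : φ =ᵐ[μ] 0
    · have e1 : ∫ k, E k * θ k * φ k ^ 2 ∂μ = 0 := integral_eq_zero_of_ae (by
        filter_upwards [h0] with k hk
        simp [hk])
      have e2 : ∫ z, φ z.1 * θ z.1 * (R z.1 z.2).re * (θ z.2 * φ z.2) ∂μ.prod μ = 0 :=
        integral_eq_zero_of_ae (by
          filter_upwards [Measure.quasiMeasurePreserving_fst.ae h0] with z hz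
          simp [hz])
      rw [e1, e2, sub_zero]
    · exact (hpos φ h1 h2 h0).le
  have m1 : Measurable fun k => (ψ k).re := Complex.measurable_re.comp hψm
  have m2 : Measurable fun k => (ψ k).im := Complex.measurable_im.comp hψm
  have l1 : MemLp (fun k => (ψ k).re) 2 μ := hψ.re
  have l2 : MemLp (fun k => (ψ k).im) 2 μ := hψ.im
  have k1 := key _ m1 l1
  have k2 := key _ m2 l2
  refine ⟨add_nonneg k1 k2, fun h0 => ?_⟩
  have h1 : (fun k => (ψ k).re) =ᵐ[μ] 0 := by
    by_contra h
    have := hpos _ m1 l1 h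
    linarith
  have h2 : (fun k => (ψ k).im) =ᵐ[μ] 0 := by
    by_contra h
    have := hpos _ m2 l2 h
    linarith
  filter_upwards [h1, h2] with k hk1 hk2
  exact Complex.ext hk1 hk2

lemma integrable_form_kernel {R Y : X → X → ℂ} (hRm : Measurable (Function.uncurry R))
    (hR : MemLp (Function.uncurry R) 2 (μ.prod μ)) (hYm : Measurable (Function.uncurry Y))
    (hY : MemLp (Function.uncurry Y) 2 (μ.prod μ)) (hE : Measurable E) {M : ℝ}
    (hEM : ∀ k, |E k| ≤ M) (hθ : Measurable θ) (hθ1 : ∀ᵐ k ∂μ, |θ k| ≤ 1) :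
    Integrable (fun z : X × X => (θ z.2 : ℂ) * (conj (Y z.1 z.2) * θ z.1 *
      (E z.1 * Y z.1 z.2 - ∫ r, R z.1 r * (θ r * Y r z.2) ∂μ))) (μ.prod μ) := by
  have h1 := memLp_kernel_mul hθ hθ1 hY
  have hm1 : Measurable (Function.uncurry fun k q => (θ k : ℂ) * Y k q) :=
    (Complex.measurable_ofReal.comp (hθ.comp measurable_fst)).mul hYm
  have h2 := memLp_two_comp hRm hm1 hR h1
  have h3 := memLp_kernel_mul hE (Eventually.of_forall hEM) hY
  have h4 : MemLp (fun z : X × X => conj ((θ z.1 : ℂ) * Y z.1 z.2)) 2 (μ.prod μ) := h1.star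
  have hθ' : Measurable fun z : X × X => θ z.2 := hθ.comp measurable_snd
  have h5 := memLp_bdd_mul hθ' (Measure.quasiMeasurePreserving_snd.ae hθ1) h4
  refine (h5.integrable_mul (h3.sub h2)).congr (Eventually.of_forall fun z => ?_)
  simp only [Pi.mul_apply, Pi.sub_apply, Function.uncurry, map_mul, Complex.conj_ofReal]
  ring

/-- The scalar Riccati equation has at most one symmetric square integrable solution for which the
completed quadratic form is positive. -/
theorem scalar_riccati_unique {R R' G : X → X → ℂ} (hRm : Measurable (Function.uncurry R))
    (hR : MemLp (Function.uncurry R) 2 (μ.prod μ)) (hsymm : ∀ k q, R k q = R q k)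
    (hRm' : Measurable (Function.uncurry R'))
    (hR' : MemLp (Function.uncurry R') 2 (μ.prod μ)) (hsymm' : ∀ k q, R' k q = R' q k)
    (hE : Measurable E) {M : ℝ} (hEM : ∀ k, |E k| ≤ M) (hθ : Measurable θ)
    (hθ1 : ∀ᵐ k ∂μ, |θ k| ≤ 1) (hθ0 : ∀ᵐ k ∂μ, 0 < θ k)
    (heq : ∀ᵐ z ∂μ.prod μ, ∫ r, R z.1 r * (θ r * R r z.2) ∂μ =
      G z.1 z.2 + (E z.1 + E z.2) * R z.1 z.2)
    (heq' : ∀ᵐ z ∂μ.prod μ, ∫ r, R' z.1 r * (θ r * R' r z.2) ∂μ =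
      G z.1 z.2 + (E z.1 + E z.2) * R' z.1 z.2)
    (hpos : RealFormPos μ E θ R) (hpos' : RealFormPos μ E θ R') :
    ∀ᵐ z ∂μ.prod μ, R z.1 z.2 = R' z.1 z.2 := by
  obtain ⟨Y, hYd⟩ : ∃ Y : X → X → ℂ, Y = fun k q => R k q - R' k q := ⟨_, rfl⟩
  have hYm : Measurable (Function.uncurry Y) := by rw [hYd]; exact hRm.sub hRm'
  have hY : MemLp (Function.uncurry Y) 2 (μ.prod μ) := by rw [hYd]; exact hR.sub hR'
  have hYs : ∀ k q, Y k q = Y q k := by intro k q; rw [hYd]; simp only [hsymm k q, hsymm' k q]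
  have i1 := integrable_form_kernel hRm hR hYm hY hE hEM hθ hθ1
  have i2 := integrable_form_kernel hRm' hR' hYm hY hE hEM hθ hθ1
  -- The form of the kernel `S` at each column of the difference `Y`. The argument is a trace
  -- identity: `Y` solves `(E - Rθ)Y + Y(E - θR') = 0`, and pairing with `θ Ȳ θ` gives two
  -- non-negative quantities with sum zero.
  set T : (X → X → ℂ) → X → ℂ := fun S q =>
    ∫ k, conj (Y k q) * θ k * (E k * Y k q - ∫ r, S k r * (θ r * Y r q) ∂μ) ∂μ with hT
  have hYq : ∀ᵐ q ∂μ, MemLp (fun k => Y k q) 2 μ := memLp_two_section (memLp_two_swap hY)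
  have hYqm : ∀ q, Measurable fun k => Y k q := fun q => hYm.comp measurable_prodMk_right
  have n1 : ∀ᵐ q ∂μ, 0 ≤ (T R q).re ∧ ((T R q).re = 0 → (fun k => Y k q) =ᵐ[μ] 0) := by
    filter_upwards [hYq] with q hq
    exact re_form_nonneg hR hsymm hE hEM hθ hθ1 hpos (hYqm q) hq
  have n2 : ∀ᵐ q ∂μ, 0 ≤ (T R' q).re := by
    filter_upwards [hYq] with q hq
    exact (re_form_nonneg hR' hsymm' hE hEM hθ hθ1 hpos' (hYqm q) hq).1
  have j1 : Integrable (fun q => (θ q : ℂ) * T R q) μ := by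
    have := i1.integral_prod_right
    simp only [integral_const_mul] at this
    exact this
  have j2 : Integrable (fun q => (θ q : ℂ) * T R' q) μ := by
    have := i2.integral_prod_right
    simp only [integral_const_mul] at this
    exact this
  have s1 : ∫ q, (θ q : ℂ) * T R q ∂μ = ∫ z : X × X, (θ z.2 : ℂ) * (conj (Y z.1 z.2) * θ z.1 *
      (E z.1 * Y z.1 z.2 - ∫ r, R z.1 r * (θ r * Y r z.2) ∂μ)) ∂μ.prod μ := by
    rw [integral_prod_symm _ i1]
    simp only [integral_const_mul, hT]
  have s2 : ∫ q, (θ q : ℂ) * T R' q ∂μ = ∫ z : X × X, (θ z.1 : ℂ) * (conj (Y z.2 z.1) * θ z.2 *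
      (E z.2 * Y z.2 z.1 - ∫ r, R' z.2 r * (θ r * Y r z.1) ∂μ)) ∂μ.prod μ := by
    rw [integral_prod _ (by exact i2.swap)]
    simp only [integral_const_mul, hT]
  -- The Sylvester equation at a point. By symmetry of `Y` and `R'`, exchanging the variables turns
  -- the term with `R'` into the right multiplication; the two mixed compositions of `R` and `R'`
  -- cancel.
  have hzero : ∀ᵐ z ∂μ.prod μ, (θ z.2 : ℂ) * (conj (Y z.1 z.2) * θ z.1 *
      (E z.1 * Y z.1 z.2 - ∫ r, R z.1 r * (θ r * Y r z.2) ∂μ)) + (θ z.1 : ℂ) *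
      (conj (Y z.2 z.1) * θ z.2 * (E z.2 * Y z.2 z.1 - ∫ r, R' z.2 r * (θ r * Y r z.1) ∂μ)) = 0 := by
    filter_upwards [heq, heq', Measure.quasiMeasurePreserving_fst.ae (memLp_two_section hR),
      Measure.quasiMeasurePreserving_fst.ae (memLp_two_section hR'),
      Measure.quasiMeasurePreserving_snd.ae (memLp_two_section (memLp_two_swap hR)),
      Measure.quasiMeasurePreserving_snd.ae (memLp_two_section (memLp_two_swap hR'))]
      with ⟨k, q⟩ h h' hk hk' hq hq'
    simp only at h h' hk hk' hq hq' ⊢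
    have a1 : Integrable (fun r => R k r * (θ r * R r q)) μ := hk.integrable_mul (memLp_bdd_mul hθ hθ1 hq)
    have a2 : Integrable (fun r => R k r * (θ r * R' r q)) μ := hk.integrable_mul (memLp_bdd_mul hθ hθ1 hq')
    have a3 : Integrable (fun r => R' k r * (θ r * R' r q)) μ := hk'.integrable_mul (memLp_bdd_mul hθ hθ1 hq')
    have b1 : ∫ r, R k r * (θ r * Y r q) ∂μ = ∫ r, R k r * (θ r * R r q) ∂μ -
        ∫ r, R k r * (θ r * R' r q) ∂μ := by
      rw [← integral_sub a1 a2, hYd]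
      simp only [mul_sub]
    have b2 : ∫ r, R' q r * (θ r * Y r k) ∂μ = ∫ r, R k r * (θ r * R' r q) ∂μ -
        ∫ r, R' k r * (θ r * R' r q) ∂μ := by
      rw [← integral_sub a2 a3, hYd]
      refine integral_congr_ae (Eventually.of_forall fun r => ?_)
      simp only [hsymm' q r, hsymm r k, hsymm' r k]
      ring
    rw [b1, b2, h, h', hYs q k, hYd]
    ring
  have hsum : ∫ q, ((θ q : ℂ) * T R q).re + ((θ q : ℂ) * T R' q).re ∂μ = 0 := by
    have e1 : ∫ q, (θ q : ℂ) * T R q ∂μ + ∫ q, (θ q : ℂ) * T R' q ∂μ = 0 := by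
      rw [s1, s2, ← integral_add i1 (by exact i2.swap)]
      exact integral_eq_zero_of_ae hzero
    have j1' : Integrable (fun q => ((θ q : ℂ) * T R q).re) μ := j1.re
    have j2' : Integrable (fun q => ((θ q : ℂ) * T R' q).re) μ := j2.re
    rw [integral_add j1' j2']
    have c1 : ∫ q, ((θ q : ℂ) * T R q).re ∂μ = (∫ q, (θ q : ℂ) * T R q ∂μ).re := integral_re j1
    have c2 : ∫ q, ((θ q : ℂ) * T R' q).re ∂μ = (∫ q, (θ q : ℂ) * T R' q ∂μ).re := integral_re j2
    rw [c1, c2, ← Complex.add_re, e1, Complex.zero_re]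
  rw [integral_eq_zero_iff_of_nonneg_ae ?_ (by exact j1.re.add j2.re)] at hsum
  · have hY0 : ∀ᵐ q ∂μ, ∀ᵐ k ∂μ, R q k = R' q k := by
      filter_upwards [n1, n2, hθ0, hsum] with q h1 h2 h3 h4
      simp only [Pi.zero_apply, Complex.re_ofReal_mul] at h4
      have h5 : (T R q).re = 0 := by
        have t1 := mul_nonneg h3.le h1.1
        have t2 := mul_nonneg h3.le h2
        have : θ q * (T R q).re = 0 := by linarith
        exact (mul_eq_zero.mp this).resolve_left h3.ne'
      filter_upwards [h1.2 h5] with k hk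
      rw [hYs, hYd] at hk
      exact sub_eq_zero.mp hk
    have hms : MeasurableSet {z : X × X | R z.1 z.2 = R' z.1 z.2} := measurableSet_eq_fun hRm hRm'
    exact (Measure.ae_prod_iff_ae_ae hms).mpr hY0
  · filter_upwards [n1, n2, hθ0] with q h1 h2 h3
    simp only [Pi.zero_apply, Complex.re_ofReal_mul]
    exact add_nonneg (mul_nonneg h3.le h1.1) (mul_nonneg h3.le h2)

end ScalarUniqueness

/-! ### Localization: signs of the local part. -/

section Localization

/-- A square integrable kernel is negligible on small squares, relative to a function bounded away
from zero. -/
lemma exists_setIntegral_le {μ : Measure ℝ} [IsFiniteMeasure μ] [NullSingletonClass μ] {h : ℝ → ℝ}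
    {K : ℝ × ℝ → ℝ} (hK : MemLp K 2 (μ.prod μ)) {S : Set ℝ} (hS : MeasurableSet S) (hS0 : μ S ≠ 0)
    {c : ℝ} (hc : 0 < c) (hhc : ∀ k ∈ S, h k ≤ -c) (hi : IntegrableOn h S μ) :
    ∃ A ⊆ S, MeasurableSet A ∧ μ A ≠ 0 ∧
      ∫ k in A, h k ∂μ - ∫ z in A ×ˢ A, K z ∂μ.prod μ ≤ 0 := by
  obtain ⟨k0, -, hk0⟩ := exists_mem_forall_mem_nhdsWithin_pos_measure hS0
  -- The sets shrink to a point while keeping positive measure. The squares `A n ×ˢ A n` shrink to a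
  -- null set, so the integral of `K²` over them falls below `c²`.
  set A : ℕ → Set ℝ := fun n => S ∩ Metric.ball k0 (1 / ((n : ℝ) + 1)) with hA
  have hAm : ∀ n, MeasurableSet (A n) := fun n => hS.inter Metric.isOpen_ball.measurableSet
  have hA0 : ∀ n, μ (A n) ≠ 0 := fun n => (hk0 _ (inter_mem self_mem_nhdsWithin
    (mem_nhdsWithin_of_mem_nhds (Metric.ball_mem_nhds k0 (by positivity))))).ne'
  have hanti : Antitone fun n => A n ×ˢ A n := by
    intro m n hmn
    have : A n ⊆ A m := inter_subset_inter_right S (Metric.ball_subset_ball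
      (one_div_le_one_div_of_le (by positivity) (by exact_mod_cast Nat.succ_le_succ hmn)))
    exact prod_mono this this
  have hK2 := hK.integrable_sq
  have hlim := tendsto_setIntegral_of_antitone (fun n => (hAm n).prod (hAm n)) hanti
    ⟨0, hK2.integrableOn (s := A 0 ×ˢ A 0)⟩
  have hnull : ∫ z in ⋂ n, A n ×ˢ A n, K z ^ 2 ∂μ.prod μ = 0 := by
    refine setIntegral_measure_zero _ (measure_mono_null (t := {k0} ×ˢ univ) ?_ ?_)
    · intro z hz
      refine ⟨?_, mem_univ _⟩
      rw [mem_singleton_iff, ← dist_le_zero]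
      refine le_of_forall_pos_le_add fun ε hε => ?_
      obtain ⟨n, hn⟩ := exists_nat_one_div_lt hε
      have := ((mem_iInter.mp hz n).1.2 : z.1 ∈ Metric.ball k0 _)
      rw [Metric.mem_ball] at this
      linarith
    · rw [Measure.prod_prod, measure_singleton, zero_mul]
  rw [hnull] at hlim
  obtain ⟨n, hn⟩ := (hlim.eventually (gt_mem_nhds (by positivity : (0 : ℝ) < c ^ 2))).exists
  refine ⟨A n, inter_subset_left, hAm n, hA0 n, ?_⟩
  set m := μ.real (A n) with hm
  have hm0 : 0 < m := ENNReal.toReal_pos (hA0 n) (measure_ne_top _ _)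
  have h1 : ∫ k in A n, h k ∂μ ≤ -c * m := by
    have : ∫ k in A n, h k ∂μ ≤ ∫ k in A n, -c ∂μ :=
      setIntegral_mono_on (hi.mono_set inter_subset_left) (integrable_const _) (hAm n)
        fun k hk => hhc k hk.1
    rw [setIntegral_const, smul_eq_mul, ← hm] at this
    linarith
  -- Young's inequality with weights balanced so that each term contributes at most `c·m/2`, against
  -- the gain `c·m` from `h`.
  have h2 : -∫ z in A n ×ˢ A n, K z ∂μ.prod μ ≤
      ∫ z in A n ×ˢ A n, (c / (2 * m) + m / (2 * c) * K z ^ 2) ∂μ.prod μ := by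
    rw [← integral_neg]
    refine integral_mono (hK.integrable one_le_two).integrableOn.neg
      ((integrable_const _).add (hK2.integrableOn.const_mul _)) fun z => ?_
    have : c / (2 * m) + m / (2 * c) * K z ^ 2 + K z = (c + m * K z) ^ 2 / (2 * c * m) := by
      field_simp
      ring
    have h3 : 0 ≤ (c + m * K z) ^ 2 / (2 * c * m) := by positivity
    simp only
    linarith
  rw [integral_add (integrable_const _) (hK2.integrableOn.const_mul _), integral_const_mul,
    setIntegral_const, Measure.real, Measure.prod_prod, ENNReal.toReal_mul, smul_eq_mul] at h2
  change -_ ≤ m * m * _ + _ at h2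
  have h4 : m * m * (c / (2 * m)) = c * m / 2 := by field_simp
  have h5 : m / (2 * c) * ∫ z in A n ×ˢ A n, K z ^ 2 ∂μ.prod μ ≤ m / (2 * c) * c ^ 2 := by gcongr
  have h6 : m / (2 * c) * c ^ 2 = c * m / 2 := by field_simp
  linarith

variable {ν : ℝ → ℝ} {x : ℝ} {f : DKernel}

namespace DKernel

/-- Positivity of the Hessian forces the signs of the diagonal of the local part. -/
lemma HessianPosDef.diag_nonneg (hν : Measurable ν) (hb : BoundedDensity ν)
    (hf : f.Admissible ν x) (hp : f.HessianPosDef ν x) (s : Bool) :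
    ∀ᵐ k ∂momentum, 0 ≤ branchSign s * (f.diaMat ν x k s s).re := by
  by_contra hcon
  obtain ⟨h, hh⟩ : ∃ h : ℝ → ℝ, h = fun k => branchSign s * (f.diaMat ν x k s s).re := ⟨_, rfl⟩
  have hm : Measurable h := by
    rw [hh]
    exact (Complex.measurable_re.comp (measurable_diaMat hν hf s s)).const_mul _
  -- The lower cutoff makes `h` bounded, hence integrable, on each set; the upper one keeps it away
  -- from zero.
  obtain ⟨S, hSd⟩ : ∃ S : ℕ → Set ℝ, S = fun n : ℕ =>
    {k | k ∈ Ioo 0 Real.pi ∧ h k ≤ -(1 / ((n : ℝ) + 1)) ∧ -(n : ℝ) ≤ h k} := ⟨_, rfl⟩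
  have hSm : ∀ n, MeasurableSet (S n) := fun n => by
    rw [hSd]
    exact measurableSet_Ioo.inter ((measurableSet_le hm measurable_const).inter
      (measurableSet_le measurable_const hm))
  have hS : ∃ n, momentum (S n) ≠ 0 := by
    by_contra! hall
    refine hcon ?_
    have h1 : momentum (⋃ n, S n) = 0 := measure_iUnion_null hall
    filter_upwards [measure_eq_zero_iff_ae_notMem.mp h1, ae_mem_momentum] with k hk hk'
    by_contra! hneg
    have hneg' : h k < 0 := by rw [hh]; exact hneg
    obtain ⟨n1, hn1⟩ := exists_nat_one_div_lt (neg_pos.mpr hneg')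
    obtain ⟨n2, hn2⟩ := exists_nat_ge (-h k)
    refine hk (mem_iUnion.mpr ⟨max n1 n2, ?_⟩)
    rw [hSd]
    refine ⟨hk', ?_, ?_⟩
    · have : 1 / (((max n1 n2 : ℕ) : ℝ) + 1) ≤ 1 / ((n1 : ℝ) + 1) :=
        one_div_le_one_div_of_le (by positivity) (by
          have : (n1 : ℝ) ≤ (max n1 n2 : ℕ) := by exact_mod_cast le_max_left _ _
          linarith)
      linarith
    · have : (n2 : ℝ) ≤ (max n1 n2 : ℕ) := by exact_mod_cast le_max_right _ _
      linarith
  obtain ⟨n, hn⟩ := hS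
  have hK : MemLp (fun z : ℝ × ℝ => (f.regMat ν x z.1 z.2 s s).re) 2 (momentum.prod momentum) :=
    (BranchMat.memLp_iff.mp (hf.memLp_regMat hν hb) s s).re
  have hi : IntegrableOn h (S n) momentum := by
    refine Measure.integrableOn_of_bounded (M := n) (measure_ne_top _ _)
      hm.aestronglyMeasurable ?_
    refine (ae_restrict_iff' (hSm n)).mpr (Eventually.of_forall fun k hk => ?_)
    rw [hSd] at hk
    obtain ⟨-, h1, h2⟩ := hk
    rw [Real.norm_eq_abs, abs_le]
    have h3 : 0 ≤ 1 / ((n : ℝ) + 1) := by positivity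
    have h4 : (0 : ℝ) ≤ n := by positivity
    exact ⟨h2, by linarith⟩
  obtain ⟨A, hAS, hAm, hA0, hle⟩ := exists_setIntegral_le hK (hSm n) hn
    (by positivity : 0 < 1 / ((n : ℝ) + 1)) (fun k hk => by rw [hSd] at hk; exact hk.2.1) hi
  -- Where the amplitude vanishes, the signed diagonal entry is `freq ≥ 0`. So the amplitude is
  -- non-zero on `A`, and its inverse there may serve as test function.
  have hamp : ∀ k ∈ A, amp ν x k s ≠ 0 := by
    intro k hk h0
    have h1 := hAS hk
    rw [hSd] at h1
    have h2 : h k < 0 := lt_of_le_of_lt h1.2.1 (by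
      have : (0 : ℝ) < 1 / ((n : ℝ) + 1) := by positivity
      linarith)
    have h3 : h k = freq x k := by
      rw [hh]
      simp only [diaMat, BranchMat.mk_apply, h0]
      cases s <;> simp
    linarith [freq_nonneg x k]
  set α : Bool → ℝ → ℝ := fun s' => if s' = s then A.indicator fun k => (amp ν x k s)⁻¹ else 0
    with hα
  have hψs : ∀ k, amp ν x k s * α s k = A.indicator 1 k := by
    intro k
    simp only [hα, if_true]
    by_cases hk : k ∈ A
    · rw [indicator_of_mem hk, indicator_of_mem hk, mul_inv_cancel₀ (hamp k hk), Pi.one_apply]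
    · rw [indicator_of_notMem hk, indicator_of_notMem hk, mul_zero]
  have hψn : ∀ s', s' ≠ s → ∀ k, amp ν x k s' * α s' k = 0 := by
    intro s' hs k
    simp only [hα, if_neg hs, Pi.zero_apply, mul_zero]
  have hψ : ∀ s' k, amp ν x k s' * α s' k = if s' = s then A.indicator 1 k else 0 := by
    intro s' k
    split_ifs with hs
    · rw [hs]; exact hψs k
    · exact hψn s' hs k
  have hloc : f.localForm ν x (fun s' k => amp ν x k s' * α s' k) = A.indicator h := by
    ext k
    simp only [localForm, hψ, hh]
    by_cases hk : k ∈ A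
    · simp only [indicator_of_mem hk, Pi.one_apply]
      cases s <;> simp
    · simp [indicator_of_notMem hk]
  have hnon : f.nonlocalForm ν x (fun s' k => amp ν x k s' * α s' k) =
      (A ×ˢ A).indicator fun z => (f.regMat ν x z.1 z.2 s s).re := by
    ext z
    simp only [nonlocalForm, hψ]
    by_cases hk : z.1 ∈ A
    · by_cases hq : z.2 ∈ A
      · rw [indicator_of_mem (s := A ×ˢ A) ⟨hk, hq⟩]
        simp only [indicator_of_mem hk, indicator_of_mem hq, Pi.one_apply]
        cases s <;> simp
      · rw [indicator_of_notMem (s := A ×ˢ A) fun h => hq h.2]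
        simp [indicator_of_notMem hq]
    · rw [indicator_of_notMem (s := A ×ˢ A) fun h => hk h.1]
      simp [indicator_of_notMem hk]
  have hpos := hp.form_pos hν hb hf (α := α) ?_ ?_ ?_ ?_
  · rw [hloc, hnon, integral_indicator hAm, integral_indicator (hAm.prod hAm)] at hpos
    exact absurd hle (not_le.mpr hpos)
  · intro s'
    simp only [hα]
    split_ifs
    · exact (measurable_amp hν x s).inv.indicator hAm
    · exact measurable_const
  · intro s'
    simp only [hψ]
    split_ifs
    · exact (memLp_const (1 : ℝ)).indicator hAm
    · exact MemLp.zero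
  · rw [hloc, integrable_indicator_iff hAm]
    exact hi.mono_set hAS
  · intro hall
    refine hA0 (measure_eq_zero_iff_ae_notMem.mpr ?_)
    filter_upwards [hall s] with k hk hkA
    rw [hψs, indicator_of_mem hkA] at hk
    exact one_ne_zero hk

end DKernel

end Localization

/-! ### Independence of the branch. -/

section BranchIndependence

variable {ν : ℝ → ℝ} {lam x k : ℝ} {f : DKernel}

lemma freq_sq_sub (x k q : ℝ) :
    freq x k ^ 2 - freq x q ^ 2 = 8 * Real.pi ^ 2 * x * (Real.cos k - Real.cos q) := by
  rw [freq, freq, mul_pow _ (eps x k), mul_pow _ (eps x q), eps_sq_eq, eps_sq_eq]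
  have h1 := Real.sin_sq_add_cos_sq k
  have h2 := Real.sin_sq_add_cos_sq q
  linear_combination (4 * Real.pi ^ 2) * (h1 - h2)

/-- Here `x ≠ 0` is essential: at `x = 0` the dispersion is flat and the commutator with `freq²`
carries no information. -/
lemma freq_sq_ne (hx : x ≠ 0) {q : ℝ} (hk : k ∈ Ioo 0 Real.pi) (hq : q ∈ Ioo 0 Real.pi)
    (hne : k ≠ q) : freq x k ^ 2 - freq x q ^ 2 ≠ 0 := by
  rw [freq_sq_sub]
  have hpi := Real.pi_ne_zero
  refine mul_ne_zero (by positivity) (sub_ne_zero.mpr fun h => hne ?_)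
  exact Real.injOn_cos (Ioo_subset_Icc_self hk) (Ioo_subset_Icc_self hq) h

/-- The function `amp(q) / (freq(k)² - freq(q)²)` is not integrable near `q = k`. -/
lemma not_integrable_amp_div (hb : BoundedDensity ν) (hx : x ≠ 0) (hk : k ∈ Ioo 0 Real.pi) :
    ¬ Integrable (fun q => amp ν x q true / (freq x k ^ 2 - freq x q ^ 2)) momentum := by
  intro hi
  have hi' : IntervalIntegrable (fun q => amp ν x q true / (freq x k ^ 2 - freq x q ^ 2)) volume
      0 Real.pi := by
    rw [intervalIntegrable_iff_integrableOn_Ioo_of_le Real.pi_pos.le]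
    exact hi
  refine not_intervalIntegrable_of_sub_inv_isBigO_punctured (c := k) ?_ Real.pi_pos.ne ?_ hi'
  swap
  · rw [uIcc_of_le Real.pi_pos.le]
    exact Ioo_subset_Icc_self hk
  have hsk := sin_pos_of_mem hk
  obtain ⟨m, hm⟩ : ∃ m, m = √(1 / 2 * ((Real.sin k / 2) ^ 2 / (2 * (1 + |x|)))) := ⟨_, rfl⟩
  have hm0 : 0 < m := by rw [hm]; positivity
  refine Asymptotics.IsBigO.of_bound (8 * Real.pi ^ 2 * |x| / m) ?_
  have h1 : ∀ᶠ q in 𝓝 k, Real.sin k / 2 < Real.sin q :=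
    Real.continuous_sin.continuousAt.eventually (lt_mem_nhds (half_lt_self hsk))
  filter_upwards [nhdsWithin_le_nhds h1, nhdsWithin_le_nhds (isOpen_Ioo.mem_nhds hk),
    self_mem_nhdsWithin] with q hq hqm hne
  have hne' : k ≠ q := fun h => hne h.symm
  have ha : m ≤ amp ν x q true := by
    rw [hm, amp]
    refine Real.sqrt_le_sqrt (mul_le_mul (half_le_frac_true hb hqm) ?_ (by positivity) ?_)
    · rw [absWt]
      have := eps_pos (x := x) hqm
      have := eps_le x q
      gcongr
    · linarith [half_le_frac_true hb hqm]
  have hd := abs_pos.mpr (freq_sq_ne hx hk hqm hne')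
  have hle : |freq x k ^ 2 - freq x q ^ 2| ≤ 8 * Real.pi ^ 2 * |x| * |q - k| := by
    rw [freq_sq_sub, abs_mul, abs_mul, abs_of_pos (by positivity : 0 < 8 * Real.pi ^ 2),
      abs_sub_comm q k]
    exact mul_le_mul_of_nonneg_left (Real.abs_cos_sub_cos_le k q) (by positivity)
  have hqk : 0 < |q - k| := abs_pos.mpr (sub_ne_zero.mpr hne)
  rw [norm_inv, norm_div, Real.norm_of_nonneg (amp_nonneg true), Real.norm_eq_abs,
    Real.norm_eq_abs,
    div_mul_div_comm, le_div_iff₀ (by positivity), inv_mul_le_iff₀ hqk]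
  calc m * |freq x k ^ 2 - freq x q ^ 2|
      ≤ amp ν x q true * (8 * Real.pi ^ 2 * |x| * |q - k|) := by
        have := amp_nonneg (ν := ν) (x := x) (k := q) true
        gcongr
    _ = _ := by ring

/-- Otherwise `φ` would have a singularity of type `1/(k - q)` at `q = k`, which is not integrable.
-/
lemma eq_zero_of_freq_mul (hb : BoundedDensity ν) (hx : x ≠ 0) (hk : k ∈ Ioo 0 Real.pi)
    {φ : ℝ → ℂ} (hφ : Integrable φ momentum) {c : ℂ}
    (h : ∀ᵐ q ∂momentum, ((freq x k ^ 2 - freq x q ^ 2 : ℝ) : ℂ) * φ q = c * amp ν x q true) :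
    c = 0 := by
  by_contra hc
  refine not_integrable_amp_div hb hx hk ?_
  have h1 : Integrable (fun q => (c⁻¹ * φ q).re) momentum := (hφ.const_mul c⁻¹).re
  refine h1.congr ?_
  filter_upwards [h, ae_mem_momentum, compl_mem_ae_iff.mpr (measure_singleton k)] with q hq hqm hne
  have hne' : k ≠ q := fun h => hne h.symm
  have hd := freq_sq_ne hx hk hqm hne'
  have hd' : ((freq x k ^ 2 - freq x q ^ 2 : ℝ) : ℂ) ≠ 0 := by exact_mod_cast hd
  have e : c⁻¹ * φ q = ((amp ν x q true / (freq x k ^ 2 - freq x q ^ 2) : ℝ) : ℂ) := by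
    rw [Complex.ofReal_div]
    field_simp
    linear_combination hq
  rw [e, Complex.ofReal_re]

namespace DKernel

/-- The regular part depends on the branches only through the amplitudes. -/
def BranchFree (f : DKernel) (ν : ℝ → ℝ) (x : ℝ) : Prop :=
  ∀ᵐ z ∂momentum.prod momentum, ∀ s t,
    (amp ν x z.1 true : ℂ) * amp ν x z.2 true * f.regMat ν x z.1 z.2 s t =
      amp ν x z.1 s * amp ν x z.2 t * f.regMat ν x z.1 z.2 true true

lemma regMat_comm (hf : f.Admissible ν x) (k q : ℝ) (s t : Bool) :
    f.regMat ν x k q s t = f.regMat ν x q k t s := by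
  simp only [regMat, BranchMat.mk_apply, hf.symm_reg (k, s) (q, t)]
  ring

lemma IsSolution.commutator_apply (hν : Measurable ν) (hb : BoundedDensity ν)
    (hf : f.IsSolution ν lam x) : ∀ᵐ z ∂momentum.prod momentum, ∀ s t,
      ((freq x z.1 ^ 2 - freq x z.2 ^ 2 : ℝ) : ℂ) * f.regMat ν x z.1 z.2 s t =
      ((16 * Real.pi * lam : ℝ) : ℂ) * (amp ν x z.1 s * f.ampImage' ν x z.2 true t -
        f.ampImage ν x z.1 s true * amp ν x z.2 t) := by
  filter_upwards [hf.commutator hν hb] with z hz s t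
  have h := congrArg (fun A : BranchMat => A s t) hz
  simp only [BranchMat.sub_apply, BranchMat.smul_apply, BranchMat.mul_apply] at h
  simp [ampCol, ampRow, BranchMat.mk_apply] at h
  push_cast at h ⊢
  linear_combination h

/-- Combining the two rows of the commutator relation with amplitude coefficients removes the term
in `ampImage'`. What remains is a constant times `amp ν x q true`, with an integrable row of `R` on
the other side, so the constant is zero. -/
lemma IsSolution.ampImage_branch (hν : Measurable ν) (hb : BoundedDensity ν) (hlam : lam ≠ 0)
    (hx : x ≠ 0) (hf : f.IsSolution ν lam x) : ∀ᵐ k ∂momentum,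
      f.ampImage ν x k false true * amp ν x k true = f.ampImage ν x k true true * amp ν x k false := by
  filter_upwards [Measure.ae_ae_of_ae_prod (hf.commutator_apply hν hb),
    memLp_two_section (hf.1.memLp_regMat hν hb), ae_mem_momentum] with k hk hR hkm
  have hR' := BranchMat.memLp_iff.mp hR
  have hφ : Integrable (fun q => (amp ν x k false : ℂ) * f.regMat ν x k q true true -
      amp ν x k true * f.regMat ν x k q false true) momentum :=
    (((hR' true true).integrable one_le_two).const_mul _).sub
      (((hR' false true).integrable one_le_two).const_mul _)
  have h0 := eq_zero_of_freq_mul hb hx hkm hφ (c := ((16 * Real.pi * lam : ℝ) : ℂ) *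
    (f.ampImage ν x k false true * amp ν x k true -
      f.ampImage ν x k true true * amp ν x k false)) (by
    filter_upwards [hk] with q hq
    linear_combination (amp ν x k false : ℂ) * hq true true - (amp ν x k true : ℂ) * hq false true)
  have hg : ((16 * Real.pi * lam : ℝ) : ℂ) ≠ 0 := by
    exact_mod_cast mul_ne_zero (by positivity) hlam
  exact sub_eq_zero.mp ((mul_eq_zero.mp h0).resolve_left hg)

/-- Both terms of the commutator are now proportional to `amp` in the first variable, and `freq²`
separates distinct momenta, so `R` inherits this. The second variable follows by symmetry. -/
lemma IsSolution.branchFree (hν : Measurable ν) (hb : BoundedDensity ν) (hlam : lam ≠ 0)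
    (hx : x ≠ 0) (hf : f.IsSolution ν lam x) : f.BranchFree ν x := by
  have hd : ∀ᵐ z : ℝ × ℝ ∂momentum.prod momentum, z.1 ≠ z.2 := by
    refine (Measure.ae_prod_iff_ae_ae ?_).mpr (Eventually.of_forall fun k => ?_)
    · exact (measurableSet_eq_fun measurable_fst measurable_snd).compl
    · filter_upwards [compl_mem_ae_iff.mpr (measure_singleton (μ := momentum) k)] with q hq h
      exact hq h.symm
  have h1 : ∀ᵐ z ∂momentum.prod momentum, ∀ t,
      (amp ν x z.1 true : ℂ) * f.regMat ν x z.1 z.2 false t =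
        amp ν x z.1 false * f.regMat ν x z.1 z.2 true t := by
    filter_upwards [hf.commutator_apply hν hb, hd,
      Measure.quasiMeasurePreserving_fst.ae (hf.ampImage_branch hν hb hlam hx),
      Measure.quasiMeasurePreserving_fst.ae ae_mem_momentum,
      Measure.quasiMeasurePreserving_snd.ae ae_mem_momentum] with z hz hne hB hk hq t
    have hd' : ((freq x z.1 ^ 2 - freq x z.2 ^ 2 : ℝ) : ℂ) ≠ 0 := by
      exact_mod_cast freq_sq_ne hx hk hq hne
    refine mul_left_cancel₀ hd' ?_
    linear_combination (amp ν x z.1 true : ℂ) * hz false t - (amp ν x z.1 false : ℂ) * hz true t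
      - ((16 * Real.pi * lam : ℝ) : ℂ) * amp ν x z.2 t * hB
  filter_upwards [h1, ae_swap (p := fun k q => ∀ t, (amp ν x k true : ℂ) *
    f.regMat ν x k q false t = amp ν x k false * f.regMat ν x k q true t) h1] with z h2 h3 s t
  have h4 : (amp ν x z.2 true : ℂ) * f.regMat ν x z.1 z.2 true false =
      amp ν x z.2 false * f.regMat ν x z.1 z.2 true true := by
    rw [regMat_comm hf.1 z.1 z.2 true false, regMat_comm hf.1 z.1 z.2 true true]
    exact h3 true
  cases s <;> cases t
  · linear_combination (amp ν x z.2 true : ℂ) * h2 false + (amp ν x z.1 false : ℂ) * h4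
  · linear_combination (amp ν x z.2 true : ℂ) * h2 true
  · linear_combination (amp ν x z.1 true : ℂ) * h4
  · ring

lemma BranchFree.row (hb : BoundedDensity ν) (hf : f.BranchFree ν x) :
    ∀ᵐ z ∂momentum.prod momentum, (amp ν x z.1 true : ℂ) * f.regMat ν x z.1 z.2 false true =
        amp ν x z.1 false * f.regMat ν x z.1 z.2 true true ∧
      (amp ν x z.2 true : ℂ) * f.regMat ν x z.1 z.2 true false =
        amp ν x z.2 false * f.regMat ν x z.1 z.2 true true := by
  filter_upwards [hf, Measure.quasiMeasurePreserving_fst.ae ae_mem_momentum,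
      Measure.quasiMeasurePreserving_snd.ae ae_mem_momentum] with z hz hk hq
  have hk' : (amp ν x z.1 true : ℂ) ≠ 0 := by exact_mod_cast (amp_true_pos hb hk).ne'
  have hq' : (amp ν x z.2 true : ℂ) ≠ 0 := by exact_mod_cast (amp_true_pos hb hq).ne'
  constructor
  · refine mul_left_cancel₀ hq' ?_
    linear_combination hz false true
  · refine mul_left_cancel₀ hk' ?_
    linear_combination hz true false

/-- The amplitude vector is an eigenvector of the completed local part. -/
lemma IsSolution.diaMat_amp (hν : Measurable ν) (hb : BoundedDensity ν) (hlam : lam ≠ 0)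
    (hx : x ≠ 0) (hf : f.IsSolution ν lam x) : ∀ᵐ k ∂momentum,
      (f.diaMat ν x k false true * amp ν x k true + f.diaMat ν x k false false * amp ν x k false) *
        amp ν x k true =
      (f.diaMat ν x k true true * amp ν x k true + f.diaMat ν x k true false * amp ν x k false) *
        amp ν x k false := by
  filter_upwards [hf.ampImage_branch hν hb hlam hx, memLp_two_section (hf.1.memLp_regMat hν hb),
    Measure.ae_ae_of_ae_prod (hf.branchFree hν hb hlam hx), ae_mem_momentum] with k hB hR hF hk
  have iR := integrable_mul_mul hR (memLp_ampCol hν hb x) signMat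
  -- The nonlocal part of `ampImage` is a multiple of the amplitude vector by branch-freeness, as is
  -- `ampImage`; hence so is the local part.
  have e : (∫ r, (f.regMat ν x k r * signMat * ampCol ν x r) false true ∂momentum) *
      amp ν x k true =
      (∫ r, (f.regMat ν x k r * signMat * ampCol ν x r) true true ∂momentum) *
      amp ν x k false := by
    rw [← integral_mul_const, ← integral_mul_const]
    refine integral_congr_ae ?_
    filter_upwards [hF, ae_mem_momentum] with q hq hqm
    have hq' : (amp ν x q true : ℂ) ≠ 0 := by exact_mod_cast (amp_true_pos hb hqm).ne'
    have hk' : (amp ν x k true : ℂ) ≠ 0 := by exact_mod_cast (amp_true_pos hb hk).ne'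
    have h1 : ∀ t, f.regMat ν x k q false t * amp ν x k true =
        f.regMat ν x k q true t * amp ν x k false := by
      intro t
      have a1 := hq false t
      have a2 := hq true t
      refine mul_left_cancel₀ hk' (mul_left_cancel₀ hq' ?_)
      linear_combination (amp ν x k true : ℂ) * a1 - (amp ν x k false : ℂ) * a2
    simp [BranchMat.mul_apply, signMat, ampCol, BranchMat.mk_apply]
    linear_combination (amp ν x q true : ℂ) * h1 true - (amp ν x q false : ℂ) * h1 false
  simp only [ampImage, BranchMat.sub_apply, BranchMat.integral_apply iR, sub_mul, e] at hB
  simp [BranchMat.mul_apply, ampCol, BranchMat.mk_apply] at hB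
  linear_combination hB

lemma branchFree_of_zero (hν0 : ν =ᵐ[momentum] 0) : f.BranchFree ν x := by
  have h0 : ∀ᵐ k ∂momentum, amp ν x k false = 0 := by
    filter_upwards [hν0] with k hk
    simp [amp, frac, hk]
  filter_upwards [Measure.quasiMeasurePreserving_fst.ae h0,
    Measure.quasiMeasurePreserving_snd.ae h0] with z h1 h2 s t
  cases s <;> cases t <;> simp [regMat, BranchMat.mk_apply, h1, h2]

lemma diaMat_amp_of_zero (hν0 : ν =ᵐ[momentum] 0) : ∀ᵐ k ∂momentum,
      (f.diaMat ν x k false true * amp ν x k true + f.diaMat ν x k false false * amp ν x k false) *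
        amp ν x k true =
      (f.diaMat ν x k true true * amp ν x k true + f.diaMat ν x k true false * amp ν x k false) *
        amp ν x k false := by
  filter_upwards [hν0] with k hk
  have : amp ν x k false = 0 := by simp [amp, frac, hk]
  simp [diaMat, BranchMat.mk_apply, this]

end DKernel

end BranchIndependence

/-! ### Determination of the local part. -/

section Uniqueness

lemma ofReal_sq_cases {a : ℂ} {E : ℝ} (h : a ^ 2 = (E : ℂ) ^ 2) : a = E ∨ a = -E :=
  sq_eq_sq_iff_eq_or_eq_neg.mp h

/-- The local part is determined by its square, its eigenvector and its signs. -/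
lemma local_part_unique {a b d : ℂ} {v w E : ℝ} (hw : 0 ≤ w) (hvw : w < v) (hE : 0 < E)
    (h1 : a ^ 2 - b ^ 2 = (E : ℂ) ^ 2) (h2 : d ^ 2 - b ^ 2 = (E : ℂ) ^ 2) (h3 : b * (a + d) = 0)
    (h4 : -b * ((v : ℂ) ^ 2 + (w : ℂ) ^ 2) = (a - d) * (v * w)) (ha : 0 ≤ a.re) (hd : d.re ≤ 0)
    (h0 : w = 0 → d = -E) :
    ((v : ℂ) ^ 2 - (w : ℂ) ^ 2) * a = E * ((v : ℂ) ^ 2 + (w : ℂ) ^ 2) ∧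
      ((v : ℂ) ^ 2 - (w : ℂ) ^ 2) * b = -2 * E * v * w ∧ d = -a := by
  have hv : 0 < v := hw.trans_lt hvw
  have hvc : (v : ℂ) ≠ 0 := by exact_mod_cast hv.ne'
  -- With `b = 0`, both `a` and `d` are `±E`. If `w > 0` the eigenvector forces `a = d`, against the
  -- signs; if `w = 0` the value of `d` is given and the sign fixes `a`.
  by_cases hb : b = 0
  · subst hb
    simp only [neg_zero, zero_mul, ne_eq, OfNat.ofNat_ne_zero, not_false_eq_true, zero_pow,
      sub_zero, mul_zero] at h1 h2 h4 ⊢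
    rcases hw.eq_or_lt with hw0 | hw0
    · have hd' := h0 hw0.symm
      rcases ofReal_sq_cases h1 with h | h
      · rw [← hw0, h, hd']
        simp
        ring
      · rw [h] at ha
        simp at ha
        linarith
    · exfalso
      have hwc : (w : ℂ) ≠ 0 := by exact_mod_cast hw0.ne'
      have had : a = d := by
        rw [eq_comm, mul_eq_zero] at h4
        rcases h4 with h | h
        · exact sub_eq_zero.mp h
        · exact absurd h (mul_ne_zero hvc hwc)
      rw [← had] at hd
      rcases ofReal_sq_cases h1 with h | h
      · rw [h] at hd; simp at hd; linarith
      · rw [h] at ha; simp at ha; linarith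
  · have hda : d = -a := by
      have := (mul_eq_zero.mp h3).resolve_left hb
      linear_combination this
    subst hda
    have hS : ((v : ℂ) ^ 2 + (w : ℂ) ^ 2) ≠ 0 := by
      have : 0 < v ^ 2 + w ^ 2 := by positivity
      exact_mod_cast this.ne'
    have hw0 : w ≠ 0 := by
      rintro rfl
      simp only [Complex.ofReal_zero, mul_zero] at h4
      exact hb (by simpa using (mul_eq_zero.mp h4).resolve_right hS)
    have hwp : 0 < w := lt_of_le_of_ne hw hw0.symm
    have hwc : (w : ℂ) ≠ 0 := by exact_mod_cast hw0
    have hω : 0 < v ^ 2 - w ^ 2 := by nlinarith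
    have hωc : ((v : ℂ) ^ 2 - (w : ℂ) ^ 2) ≠ 0 := by exact_mod_cast hω.ne'
    -- Eliminating `b` between the eigenvector relation and `h1` determines `a²`; the sign of the
    -- real part then selects the root.
    have h5 : (((v : ℂ) ^ 2 - (w : ℂ) ^ 2) * a) ^ 2 =
        ((E * (v ^ 2 + w ^ 2) : ℝ) : ℂ) ^ 2 := by
      push_cast
      have e : (-b * ((v : ℂ) ^ 2 + (w : ℂ) ^ 2)) ^ 2 = ((a - -a) * (v * w)) ^ 2 := by rw [h4]
      linear_combination ((v : ℂ) ^ 2 + (w : ℂ) ^ 2) ^ 2 * h1 + e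
    have hre : (((v : ℂ) ^ 2 - (w : ℂ) ^ 2) * a).re = (v ^ 2 - w ^ 2) * a.re := by
      have : ((v : ℂ) ^ 2 - (w : ℂ) ^ 2) = ((v ^ 2 - w ^ 2 : ℝ) : ℂ) := by push_cast; rfl
      rw [this, Complex.re_ofReal_mul]
    have h6 : ((v : ℂ) ^ 2 - (w : ℂ) ^ 2) * a = E * ((v : ℂ) ^ 2 + (w : ℂ) ^ 2) := by
      rcases ofReal_sq_cases h5 with h | h
      · rw [h]; push_cast; ring
      · exfalso
        rw [h] at hre
        have e : (-((E * (v ^ 2 + w ^ 2) : ℝ) : ℂ)).re = -(E * (v ^ 2 + w ^ 2)) := by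
          rw [Complex.neg_re, Complex.ofReal_re]
        rw [e] at hre
        have t1 : 0 < E * (v ^ 2 + w ^ 2) := by positivity
        have t2 := mul_nonneg hω.le ha
        linarith
    refine ⟨h6, ?_, rfl⟩
    refine mul_left_cancel₀ hS ?_
    linear_combination (-((v : ℂ) ^ 2 - (w : ℂ) ^ 2)) * h4 - 2 * v * w * h6

variable {ν : ℝ → ℝ} {lam x k : ℝ} {f g : DKernel}

lemma amp_false_lt (hb : BoundedDensity ν) (hk : k ∈ Ioo 0 Real.pi) (hg : 0 < gap ν k) :
    amp ν x k false < amp ν x k true := by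
  have h1 := amp_sub (x := x) hb hk
  have h2 : 0 < gapWt ν x k := mul_pos (absWt_pos hk) hg
  exact lt_of_pow_lt_pow_left₀ 2 (amp_nonneg true) (by linarith)

namespace DKernel

/-- The hypotheses on a solution from which uniqueness is derived. -/
structure Rigid (f : DKernel) (ν : ℝ → ℝ) (lam x : ℝ) : Prop where
  isSolution : f.IsSolution ν lam x
  posDef : f.HessianPosDef ν x
  branchFree : f.BranchFree ν x
  diaMat_amp : ∀ᵐ k ∂momentum,
    (f.diaMat ν x k false true * amp ν x k true + f.diaMat ν x k false false * amp ν x k false) *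
      amp ν x k true =
    (f.diaMat ν x k true true * amp ν x k true + f.diaMat ν x k true false * amp ν x k false) *
      amp ν x k false

lemma IsSolution.rigid (hν : Measurable ν) (hb : BoundedDensity ν) (hlam : lam ≠ 0)
    (hx : x ≠ 0 ∨ ν =ᵐ[momentum] 0) (hf : f.IsSolution ν lam x) (hp : f.HessianPosDef ν x) :
    f.Rigid ν lam x := by
  rcases hx with hx | hx
  · exact ⟨hf, hp, hf.branchFree hν hb hlam hx, hf.diaMat_amp hν hb hlam hx⟩
  · exact ⟨hf, hp, branchFree_of_zero hx, diaMat_amp_of_zero hx⟩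

/-- The local part of a solution is explicit. -/
lemma Rigid.diaMat_eq (hν : Measurable ν) (hb : BoundedDensity ν)
    (hgap : ∀ᵐ k ∂momentum, 0 < gap ν k) (hf : f.Rigid ν lam x) : ∀ᵐ k ∂momentum,
      (gapWt ν x k : ℂ) * f.diaMat ν x k true true =
        freq x k * ((amp ν x k true : ℂ) ^ 2 + (amp ν x k false : ℂ) ^ 2) ∧
      (gapWt ν x k : ℂ) * f.diaMat ν x k true false =
        -2 * freq x k * amp ν x k true * amp ν x k false ∧
      f.diaMat ν x k false true = -f.diaMat ν x k true false ∧
      f.diaMat ν x k false false = -f.diaMat ν x k true true := by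
  filter_upwards [hf.isSolution.diaMat_sq hb, hf.diaMat_amp, ae_mem_momentum, hgap,
    hf.posDef.diag_nonneg hν hb hf.isSolution.1 true,
    hf.posDef.diag_nonneg hν hb hf.isSolution.1 false] with k hsq hamp hk hg ht hff
  have hlt := amp_false_lt (x := x) hb hk hg
  have hsub : (gapWt ν x k : ℂ) = (amp ν x k true : ℂ) ^ 2 - (amp ν x k false : ℂ) ^ 2 := by
    rw [← amp_sub hb hk]
    push_cast
    rfl
  have hft : f.diaMat ν x k false true = -f.diaMat ν x k true false := by
    have := hf.isSolution.1.symm_dia k true false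
    simp [diaMat, BranchMat.mk_apply, this]
    ring
  have e1 := congrArg (fun A : BranchMat => A true true) hsq
  have e2 := congrArg (fun A : BranchMat => A false false) hsq
  have e3 := congrArg (fun A : BranchMat => A true false) hsq
  simp only [BranchMat.mul_apply, BranchMat.smul_apply, BranchMat.one_apply, hft] at e1 e2 e3
  simp at e1 e2 e3
  rw [hft] at hamp
  simp only [branchSign_true, branchSign_false, one_mul, neg_mul, Left.nonneg_neg_iff] at ht hff
  -- Without the branch `-` there is no eigenvector information on this entry; only the signed
  -- frequency survives in it.
  have h0 : amp ν x k false = 0 → f.diaMat ν x k false false = -freq x k := by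
    intro h
    simp [diaMat, BranchMat.mk_apply, h]
  obtain ⟨r1, r2, r3⟩ := local_part_unique (a := f.diaMat ν x k true true)
    (b := f.diaMat ν x k true false) (d := f.diaMat ν x k false false) (amp_nonneg false) hlt
    (freq_pos (x := x) hk) (by linear_combination e1) (by linear_combination e2)
    (by linear_combination e3) (by linear_combination hamp) ht hff h0
  rw [hsub]
  exact ⟨r1, r2, hft, r3⟩

end DKernel

end Uniqueness

/-! ### Reduction to the scalar equation and uniqueness. -/

section Uniqueness

variable {ν : ℝ → ℝ} {lam x k : ℝ} {f g : DKernel}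

/-- The ratio of `gapWt` to the squared amplitude of the branch `+`. -/
def gapRatio (ν : ℝ → ℝ) (x k : ℝ) : ℝ := gapWt ν x k / amp ν x k true ^ 2

lemma measurable_gapRatio (hν : Measurable ν) (x : ℝ) : Measurable (gapRatio ν x) :=
  (measurable_gapWt hν x).div ((measurable_amp hν x true).pow_const 2)

lemma gapRatio_eq (hb : BoundedDensity ν) (hk : k ∈ Ioo 0 Real.pi) :
    gapRatio ν x k * amp ν x k true ^ 2 = amp ν x k true ^ 2 - amp ν x k false ^ 2 := by
  have := amp_true_pos (x := x) hb hk
  rw [gapRatio, amp_sub hb hk]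
  field_simp

lemma ae_gapRatio_pos (hb : BoundedDensity ν) (hgap : ∀ᵐ k ∂momentum, 0 < gap ν k) (x : ℝ) :
    ∀ᵐ k ∂momentum, 0 < gapRatio ν x k := by
  filter_upwards [ae_gapWt_pos hgap x, ae_mem_momentum] with k h hk
  have := amp_true_pos (x := x) hb hk
  unfold gapRatio
  positivity

lemma ae_abs_gapRatio_le (hb : BoundedDensity ν) (hgap : ∀ᵐ k ∂momentum, 0 < gap ν k) (x : ℝ) :
    ∀ᵐ k ∂momentum, |gapRatio ν x k| ≤ 1 := by
  filter_upwards [ae_gapRatio_pos hb hgap x, ae_mem_momentum] with k h hk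
  have h1 := amp_true_pos (x := x) hb hk
  rw [abs_of_pos h, gapRatio, ← amp_sub hb hk, div_le_one (by positivity)]
  linarith [sq_nonneg (amp ν x k false)]

namespace DKernel

/-- The regular part on the branch `+` solves a scalar Riccati equation. -/
lemma Rigid.scalar_riccati (hν : Measurable ν) (hb : BoundedDensity ν)
    (hgap : ∀ᵐ k ∂momentum, 0 < gap ν k) (hf : f.Rigid ν lam x) :
    ∀ᵐ z ∂momentum.prod momentum, ∫ r, f.regMat ν x z.1 r true true *
        (gapRatio ν x r * f.regMat ν x r z.2 true true) ∂momentum =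
      ((16 * Real.pi * lam : ℝ) : ℂ) * (amp ν x z.1 true * amp ν x z.2 true) +
        (freq x z.1 + freq x z.2) * f.regMat ν x z.1 z.2 true true := by
  have hR := hf.isSolution.1.memLp_regMat hν hb
  have hrow := hf.branchFree.row hb
  have hloc : ∀ᵐ k ∂momentum, f.diaMat ν x k true true * amp ν x k true +
      f.diaMat ν x k true false * amp ν x k false = freq x k * amp ν x k true := by
    filter_upwards [hf.diaMat_eq hν hb hgap, ae_gapWt_pos hgap x, ae_mem_momentum] with k hk hω hkm
    have hω' : (gapWt ν x k : ℂ) ≠ 0 := by exact_mod_cast hω.ne'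
    have hsub : (gapWt ν x k : ℂ) = (amp ν x k true : ℂ) ^ 2 - (amp ν x k false : ℂ) ^ 2 := by
      rw [← amp_sub hb hkm]
      push_cast
      rfl
    refine mul_left_cancel₀ hω' ?_
    linear_combination (amp ν x k true : ℂ) * hk.1 + (amp ν x k false : ℂ) * hk.2.1 -
      freq x k * amp ν x k true * hsub
  have a1 := ae_fst_ae (p := fun k q => (amp ν x k true : ℂ) * f.regMat ν x k q false true =
        amp ν x k false * f.regMat ν x k q true true ∧
      (amp ν x q true : ℂ) * f.regMat ν x k q true false =
        amp ν x q false * f.regMat ν x k q true true) hrow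
  have a2 := ae_snd_ae (p := fun k q => (amp ν x k true : ℂ) * f.regMat ν x k q false true =
        amp ν x k false * f.regMat ν x k q true true ∧
      (amp ν x q true : ℂ) * f.regMat ν x k q true false =
        amp ν x q false * f.regMat ν x k q true true) hrow
  filter_upwards [hf.isSolution.riccati_regMat hν hb, hrow, a1, a2,
    Measure.quasiMeasurePreserving_fst.ae hloc, Measure.quasiMeasurePreserving_snd.ae hloc,
    Measure.quasiMeasurePreserving_fst.ae ae_mem_momentum,
    Measure.quasiMeasurePreserving_snd.ae ae_mem_momentum,
    Measure.quasiMeasurePreserving_fst.ae (memLp_two_section hR),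
    Measure.quasiMeasurePreserving_snd.ae (memLp_two_section (memLp_two_swap hR))]
    with ⟨k, q⟩ heq hz h1 h2 hlk hlq hk hq hRk hRq
  simp only at heq hz h1 h2 hlk hlq hk hq hRk hRq ⊢
  have vk : (amp ν x k true : ℂ) ≠ 0 := by exact_mod_cast (amp_true_pos hb hk).ne'
  have vq : (amp ν x q true : ℂ) ≠ 0 := by exact_mod_cast (amp_true_pos hb hq).ne'
  have e := congrArg (fun A : BranchMat => A true true) heq
  simp only [BranchMat.integral_apply (integrable_mul_mul hRk hRq signMat), BranchMat.add_apply,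
    BranchMat.smul_apply] at e
  -- Branch-freeness expresses the entries through the branch `+`, so the signed sum over branches
  -- collapses to the factor `1 - (amp₋/amp₊)²`, which is `gapRatio`.
  have hint : ∫ r, f.regMat ν x k r true true *
      (gapRatio ν x r * f.regMat ν x r q true true) ∂momentum =
      ∫ r, (f.regMat ν x k r * signMat * f.regMat ν x r q) true true ∂momentum := by
    refine integral_congr_ae ?_
    filter_upwards [h1, h2, ae_mem_momentum] with r hr1 hr2 hr
    have vr : (amp ν x r true : ℂ) ≠ 0 := by exact_mod_cast (amp_true_pos hb hr).ne'
    have hθ : (gapRatio ν x r : ℂ) * amp ν x r true ^ 2 =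
        amp ν x r true ^ 2 - amp ν x r false ^ 2 := by exact_mod_cast gapRatio_eq hb hr
    simp [BranchMat.mul_apply, signMat, BranchMat.mk_apply]
    refine mul_left_cancel₀ (pow_ne_zero 2 vr) ?_
    linear_combination (f.regMat ν x k r true true * f.regMat ν x r q true true) * hθ +
      (amp ν x r true * f.regMat ν x k r true false) * hr2.1 +
      (amp ν x r false * f.regMat ν x r q true true) * hr1.2
  rw [hint, e]
  simp only [BranchMat.mul_apply, ampCol, ampRow, BranchMat.mk_apply, diaMat']
  simp
  refine mul_left_cancel₀ vk (mul_left_cancel₀ vq ?_)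
  linear_combination (amp ν x q true * f.regMat ν x k q true true) * hlk +
    (amp ν x k true * f.regMat ν x k q true true) * hlq +
    (amp ν x q true * f.diaMat ν x k true false) * hz.1 +
    (amp ν x k true * f.diaMat ν x q true false) * hz.2

/-- Positivity of the Hessian on functions that do not distinguish the branches. -/
lemma Rigid.realFormPos (hν : Measurable ν) (hb : BoundedDensity ν)
    (hgap : ∀ᵐ k ∂momentum, 0 < gap ν k) (hf : f.Rigid ν lam x) :
    RealFormPos momentum (freq x) (gapRatio ν x) fun k q => f.regMat ν x k q true true := by
  intro ψ hψm hψ hne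
  have hR := hf.isSolution.1.memLp_regMat hν hb
  -- The test function is the same on both branches and is normalised so that `amp·α` equals `ψ` on
  -- the branch `+`.
  have hα : Measurable fun k => ψ k / amp ν x k true := hψm.div (measurable_amp hν x true)
  have hψs : ∀ s, MemLp (fun k => amp ν x k s * (ψ k / amp ν x k true)) 2 momentum := by
    intro s
    refine MemLp.of_le hψ ((measurable_amp hν x s).mul hα).aestronglyMeasurable ?_
    filter_upwards [ae_mem_momentum, hgap] with k hk hg
    have h1 := amp_true_pos (x := x) hb hk
    have h2 : amp ν x k s ≤ amp ν x k true := by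
      cases s
      · exact (amp_false_lt hb hk hg).le
      · exact le_rfl
    rw [norm_mul, norm_div, Real.norm_of_nonneg (amp_nonneg s), Real.norm_of_nonneg h1.le,
      mul_div_left_comm]
    exact mul_le_of_le_one_right (norm_nonneg _) (div_le_one_of_le₀ h2 h1.le)
  have hloc : ∀ᵐ k ∂momentum, f.localForm ν x (fun s k => amp ν x k s * (ψ k / amp ν x k true)) k =
      freq x k * gapRatio ν x k * ψ k ^ 2 := by
    filter_upwards [ae_mem_momentum, hf.diaMat_eq hν hb hgap, ae_gapWt_pos hgap x] with k hk hL hω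
    have h1 := amp_true_pos (x := x) hb hk
    have hsub := amp_sub (x := x) hb hk
    obtain ⟨l1, l2, l3, l4⟩ := hL
    have m1 := congrArg Complex.re l1
    have m2 := congrArg Complex.re l2
    have m3 := congrArg Complex.re l3
    have m4 := congrArg Complex.re l4
    have c1 : (freq x k * ((amp ν x k true : ℂ) ^ 2 + (amp ν x k false : ℂ) ^ 2)).re =
        freq x k * (amp ν x k true ^ 2 + amp ν x k false ^ 2) := by
      rw [Complex.re_ofReal_mul]
      norm_cast
    have c2 : (-2 * (freq x k : ℂ) * amp ν x k true * amp ν x k false).re =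
        -2 * freq x k * amp ν x k true * amp ν x k false := by
      norm_cast
    rw [Complex.re_ofReal_mul, c1] at m1
    rw [Complex.re_ofReal_mul, c2] at m2
    rw [Complex.neg_re] at m3 m4
    simp only [localForm, Fintype.sum_bool, m3, m4, branchSign_true, branchSign_false, gapRatio]
    set p := amp ν x k true
    set n := amp ν x k false
    set a := (f.diaMat ν x k true true).re
    set b := (f.diaMat ν x k true false).re
    have e : (p ^ 2 + n ^ 2) * a + 2 * p * n * b = freq x k * gapWt ν x k := by
      refine mul_left_cancel₀ hω.ne' ?_
      have : gapWt ν x k ^ 2 = (p ^ 2 - n ^ 2) ^ 2 := by rw [hsub]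
      linear_combination (p ^ 2 + n ^ 2) * m1 + 2 * p * n * m2 - freq x k * this
    field_simp
    linear_combination ψ k ^ 2 * e
  have hnon : ∀ᵐ z ∂momentum.prod momentum,
      f.nonlocalForm ν x (fun s k => amp ν x k s * (ψ k / amp ν x k true)) z =
      ψ z.1 * gapRatio ν x z.1 * (f.regMat ν x z.1 z.2 true true).re *
        (gapRatio ν x z.2 * ψ z.2) := by
    filter_upwards [hf.branchFree, Measure.quasiMeasurePreserving_fst.ae ae_mem_momentum,
      Measure.quasiMeasurePreserving_snd.ae ae_mem_momentum] with z hz hk hq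
    have h1 := amp_true_pos (x := x) hb hk
    have h2 := amp_true_pos (x := x) hb hq
    have g1 := gapRatio_eq (x := x) hb hk
    have g2 := gapRatio_eq (x := x) hb hq
    have hre : ∀ s t, (f.regMat ν x z.1 z.2 s t).re = amp ν x z.1 s * amp ν x z.2 t /
        (amp ν x z.1 true * amp ν x z.2 true) * (f.regMat ν x z.1 z.2 true true).re := by
      intro s t
      have h := congrArg Complex.re (hz s t)
      rw [← Complex.ofReal_mul, ← Complex.ofReal_mul, Complex.re_ofReal_mul,
        Complex.re_ofReal_mul] at h
      rw [div_mul_eq_mul_div, eq_div_iff (by positivity)]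
      linarith
    rw [← eq_div_iff (by positivity)] at g1 g2
    simp only [nonlocalForm, Fintype.sum_bool, branchSign_true, branchSign_false]
    rw [hre true false, hre false true, hre false false, g1, g2]
    field_simp
    ring
  have hN : Integrable (fun k => freq x k * gapRatio ν x k * ψ k ^ 2) momentum := by
    have hm := ((measurable_freq x).mul (measurable_gapRatio hν x)).mul (hψm.pow_const 2)
    refine (hψ.integrable_sq.const_mul (2 * Real.pi * (1 + |x|))).mono'
      hm.aestronglyMeasurable ?_
    filter_upwards [ae_abs_gapRatio_le hb hgap x] with k hk
    have h1 := freq_le x k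
    have h2 := freq_nonneg x k
    rw [norm_mul, norm_mul, Real.norm_eq_abs (gapRatio ν x k), Real.norm_of_nonneg h2,
      Real.norm_of_nonneg (sq_nonneg _)]
    calc _ ≤ 2 * Real.pi * (1 + |x|) * 1 * ψ k ^ 2 := by gcongr
      _ = _ := by ring
  have h := hf.posDef.form_pos hν hb hf.isSolution.1 (α := fun _ k => ψ k / amp ν x k true)
    (fun _ => hα) hψs (hN.congr (hloc.mono fun k hk => hk.symm)) ?_
  · rw [integral_congr_ae hloc, integral_congr_ae hnon] at h
    exact h
  · intro hall
    refine hne ?_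
    filter_upwards [hall true, ae_mem_momentum] with k hk hkm
    have h1 := (amp_true_pos (x := x) hb hkm).ne'
    rw [mul_div_cancel₀ _ h1] at hk
    exact hk

/-- Uniqueness of the solution with positive definite Hessian. -/
theorem Rigid.unique (hν : Measurable ν) (hb : BoundedDensity ν)
    (hgap : ∀ᵐ k ∂momentum, 0 < gap ν k) (hf : f.Rigid ν lam x) (hg : g.Rigid ν lam x) :
    AEEq ν f g := by
  constructor
  · filter_upwards [hf.diaMat_eq hν hb hgap, hg.diaMat_eq hν hb hgap, ae_gapWt_pos hgap x,
      ae_mem_momentum] with k h1 h2 hω hk s t hs ht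
    have hω' : (gapWt ν x k : ℂ) ≠ 0 := by exact_mod_cast hω.ne'
    have cs : (amp ν x k s : ℂ) ≠ 0 := by exact_mod_cast (amp_ne_zero_iff hb hk s).mpr hs
    have ct : (amp ν x k t : ℂ) ≠ 0 := by exact_mod_cast (amp_ne_zero_iff hb hk t).mpr ht
    have e1 : f.diaMat ν x k true true = g.diaMat ν x k true true :=
      mul_left_cancel₀ hω' (h1.1.trans h2.1.symm)
    have e2 : f.diaMat ν x k true false = g.diaMat ν x k true false :=
      mul_left_cancel₀ hω' (h1.2.1.trans h2.2.1.symm)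
    have e : f.diaMat ν x k s t = g.diaMat ν x k s t := by
      cases s <;> cases t
      · rw [h1.2.2.2, h2.2.2.2, e1]
      · rw [h1.2.2.1, h2.2.2.1, e2]
      · exact e2
      · exact e1
    have hbs : (branchSign t : ℂ) ≠ 0 := by cases t <;> simp
    simp only [diaMat, BranchMat.mk_apply] at e
    exact mul_left_cancel₀ cs (mul_right_cancel₀ ct (mul_right_cancel₀ hbs (sub_right_inj.mp e)))
  · have key := scalar_riccati_unique (R := fun k q => f.regMat ν x k q true true)
      (R' := fun k q => g.regMat ν x k q true true)
      (G := fun k q => ((16 * Real.pi * lam : ℝ) : ℂ) * (amp ν x k true * amp ν x q true))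
      (hf.isSolution.1.measurable_entry hν true true)
      (BranchMat.memLp_iff.mp (hf.isSolution.1.memLp_regMat hν hb) true true)
      (fun k q => regMat_comm hf.isSolution.1 k q true true)
      (hg.isSolution.1.measurable_entry hν true true)
      (BranchMat.memLp_iff.mp (hg.isSolution.1.memLp_regMat hν hb) true true)
      (fun k q => regMat_comm hg.isSolution.1 k q true true)
      (measurable_freq x) (M := 2 * Real.pi * (1 + |x|))
      (fun k => by rw [abs_of_nonneg (freq_nonneg x k)]; exact freq_le x k)
      (measurable_gapRatio hν x) (ae_abs_gapRatio_le hb hgap x) (ae_gapRatio_pos hb hgap x)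
      (hf.scalar_riccati hν hb hgap) (hg.scalar_riccati hν hb hgap)
      (hf.realFormPos hν hb hgap) (hg.realFormPos hν hb hgap)
    refine (ae_modes_prod_iff hν hb).mpr fun s t => ?_
    filter_upwards [key, hf.branchFree, hg.branchFree,
      Measure.quasiMeasurePreserving_fst.ae ae_mem_momentum,
      Measure.quasiMeasurePreserving_snd.ae ae_mem_momentum] with z h hzf hzg hk hq hs ht
    have cs : (amp ν x z.1 s : ℂ) ≠ 0 := by exact_mod_cast (amp_ne_zero_iff hb hk s).mpr hs
    have ct : (amp ν x z.2 t : ℂ) ≠ 0 := by exact_mod_cast (amp_ne_zero_iff hb hq t).mpr ht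
    have vk : (amp ν x z.1 true : ℂ) ≠ 0 := by exact_mod_cast (amp_true_pos hb hk).ne'
    have vq : (amp ν x z.2 true : ℂ) ≠ 0 := by exact_mod_cast (amp_true_pos hb hq).ne'
    have e : f.regMat ν x z.1 z.2 s t = g.regMat ν x z.1 z.2 s t := by
      refine mul_left_cancel₀ (mul_ne_zero vk vq) ?_
      rw [hzf s t, hzg s t, h]
    simp only [regMat, BranchMat.mk_apply] at e
    exact mul_left_cancel₀ cs (mul_right_cancel₀ ct e)

end DKernel

end Uniqueness

end RiccatiHessian

end

theorem mainTheorem1 (h lam x : ℝ) (hlam : lam ≠ 0)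
    (ν : ℝ → ℝ) (hν : Measurable ν)
    (hbound : ∀ k ∈ Set.Ioo (0 : ℝ) Real.pi, 0 ≤ ν k ∧ ν k ≤ 1 / (4 * Real.pi))
    (hstrict : ∀ᵐ k ∂ RiccatiHessian.momentum, ν k ≠ 1 / (4 * Real.pi))
    (hx : RiccatiHessian.MeanField ν h lam x)
    (hnondeg : ¬ HasDerivAt (deriv (RiccatiHessian.energy ν h lam)) 0 x) :
    ((∃ f : RiccatiHessian.DKernel, f.IsSolution ν lam x ∧ f.HessianPosDef ν x) ↔
      ((0 ≤ lam ∧ IsLocalMax (RiccatiHessian.energy ν h lam) x) ∨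
        (lam < 0 ∧ IsLocalMin (RiccatiHessian.energy ν h lam) x))) ∧
    ((x ≠ 0 ∨ ν =ᵐ[RiccatiHessian.momentum] 0) →
      ∀ f g : RiccatiHessian.DKernel,
        f.IsSolution ν lam x → f.HessianPosDef ν x →
        g.IsSolution ν lam x → g.HessianPosDef ν x →
        RiccatiHessian.DKernel.AEEq ν f g) := by
  have hgap := RiccatiHessian.ae_gap_pos hbound hstrict
  refine ⟨RiccatiHessian.exists_solution_iff hν hbound hgap hlam hx hnondeg, ?_⟩
  intro hcase f g hf hfp hg hgp
  exact (hf.rigid hν hbound hlam hcase hfp).unique hν hbound hgap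
    (hg.rigid hν hbound hlam hcase hgp)
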